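/- Let $f:\mathbb R^2\to\mathbb R$ be differentiable, and suppose that the function $g(x,y)=f(x,y)+x\,\partial_y f(x,y)-y\,\partial_x f(x,y)$ is of class $C^3$. Let $a_0,a_1,a_2,a_3,b_1,b_2,b_3\in\mathbb R$. For $\varepsilon\in\mathbb R$ consider the piecewise smooth vector field on $\mathbb R^3$ with switching plane $\Sigma=\{y=0\}$, $$X_\varepsilon(x,y,z)=\begin{cases}X^+_\varepsilon=\big(-y+\varepsilon(a_0+a_1z)+\varepsilon^2(a_2+a_3z),\ x,\ -z+g(x,y)\big), & y>0,\\[2pt] X^-_\varepsilon=\big(-y,\ x+\varepsilon b_1z+\varepsilon^2(b_2+b_3z),\ -z+g(x,y)\big), & y<0.\end{cases}$$ A point $p\in\Sigma$ is a crossing point if the $y$-components of $X^+_\varepsilon(p)$ and $X^-_\varepsilon(p)$ have the same strict sign; there, solutions are concatenations of trajectories of $X^\pm_\varepsilon$ (Filippov's convention). A crossing limit cycle is a non-constant periodic solution, with minimal period $T$, that meets $\Sigma$, does so only at crossing points, and whose orbit has a neighbourhood containing no other periodic orbit of $X_\varepsilon$. For $r>0$ write $\tilde f(\theta,r)=f(r\cos\theta,r\sin\theta)$,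 $\tilde g(\theta,r)=g(r\cos\theta,r\sin\theta)$ and $$G(\theta,r)=\frac{\partial}{\partial r}\Big(e^{-\theta}\int_0^\theta e^{s}\,\tilde g(s,r)\,ds\Big).$$ Let $$f_1(r)=a_1\int_0^{\pi}\tilde f(\phi,r)\cos\phi\,d\phi+b_1\int_\pi^{2\pi}\tilde f(\phi,r)\sin\phi\,d\phi$$ and (omitting the argument $r$ of $\tilde f,\tilde g,G$) $$\begin{aligned} f_2(r)={}&\int_0^\pi\cos s\,\bigg[a_1\Big(G(s)\int_0^s\cos\phi\,(a_0+a_1\tilde f(\phi))\,d\phi\\ &\qquad-e^{-s}\int_0^s e^{\phi}(a_0+a_1\tilde f(\phi))\Big(\cos\phi\,G(\phi)+\frac{\sin\phi}{r}(\tilde f(\phi)-\tilde g(\phi))\Big)d\phi\Big)\\ &\qquad+a_2+a_3\tilde f(s)+\frac{\sin s}{r}(a_0+a_1\tilde f(s))^2\bigg]ds\\ &+\frac{e^{-2\pi}(1+e^\pi)}{2(1-e^{2\pi})}(a_1e^{\pi}-b_1)\bigg[\int_0^\pi e^\phi G(\phi)\cos\phi\,(a_0+a_1\tilde f(\phi))\,d\phi\\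 &\qquad-\int_0^\pi\frac{e^\phi\sin\phi}{r}(a_0+a_1\tilde f(\phi))(\tilde g(\phi)-\tilde f(\phi))\,d\phi +b_1\int_\pi^{2\pi}e^\phi G(\phi)\sin\phi\,\tilde f(\phi)\,d\phi\\ &\qquad+\frac{b_1}{r}\int_\pi^{2\pi}e^\phi\cos\phi\,\tilde f(\phi)(\tilde g(\phi)-\tilde f(\phi))\,d\phi\bigg]\\ &+\int_\pi^{2\pi}\sin s\,\bigg[b_2+b_3\tilde f(s)-\frac{b_1^2}{r}\cos s\,\tilde f(s)^2\\ &\qquad+b_1\Big(G(s)\int_0^\pi\cos\phi\,(a_0+a_1\tilde f(\phi))\,d\phi+b_1G(s)\int_\pi^s\sin\phi\,\tilde f(\phi)\,d\phi\\ &\qquad+e^{-s}\Big(\int_0^\pi e^\phi(a_0+a_1\tilde f(\phi))\Big(-\cos\phi\,G(\phi)+\frac{\sin\phi}{r}(\tilde g(\phi)-\tilde f(\phi))\Big)d\phi\\ &\qquad+b_1\int_\pi^s e^\phi\tilde f(\phi)\Big(\frac{\cos\phi}{r}(\tilde f(\phi)-\tilde g(\phi))-G(\phi)\sin\phi\Big)d\phi\Big)\Big)\bigg]ds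 . \end{aligned}$$ Assume that $f_1(r)=0$ for all $r>0$, and let $r^*>0$ satisfy $f_2(r^*)=0$ and $f_2'(r^*)\neq0$. Then there are constants $C>0$ and $\varepsilon_0>0$ such that, for every $\varepsilon$ with $0<|\varepsilon|<\varepsilon_0$, the field $X_\varepsilon$ has a crossing limit cycle $\varphi(\cdot,\varepsilon)$, of period $T_\varepsilon$, with $$|T_\varepsilon-2\pi|\le C|\varepsilon|\quad\text{and}\quad \big\|\varphi(t,\varepsilon)-\big(r^*\cos t,\ r^*\sin t,\ f(r^*\cos t,r^*\sin t)\big)\big\|\le C|\varepsilon|\quad\text{for all }t\in[0,T_\varepsilon].$$ In particular it is $O(\varepsilon)$-close to the periodic orbit of radius $r^*$ of the unperturbed field on the surface $z=f(x,y)$. -/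

import Mathlib

namespace PiecewiseField

open Real

/-- The real coefficients of the perturbation. -/
structure Coeffs where
  (a0 a1 a2 a3 b1 b2 b3 : ℝ)

/-- The vector field used in the half-space `y > 0`. -/
noncomputable def Xplus (c : Coeffs) (g : ℝ × ℝ → ℝ) (ε : ℝ) (p : ℝ × ℝ × ℝ) : ℝ × ℝ × ℝ :=
  (-p.2.1 + ε * (c.a0 + c.a1 * p.2.2) + ε ^ 2 * (c.a2 + c.a3 * p.2.2),
    p.1,
    -p.2.2 + g (p.1, p.2.1))

/-- The vector field used in the half-space `y < 0`. -/
noncomputable def Xminus (c : Coeffs) (g : ℝ × ℝ → ℝ) (ε : ℝ) (p : ℝ × ℝ × ℝ) : ℝ × ℝ × ℝ :=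
  (-p.2.1,
    p.1 + ε * c.b1 * p.2.2 + ε ^ 2 * (c.b2 + c.b3 * p.2.2),
    -p.2.2 + g (p.1, p.2.1))

/-- `p` is a crossing point of the switching plane `y = 0`: the derivatives of `h (x, y, z) = y`
along the two fields, that is their second components, have the same strict sign. -/
def IsCrossingPoint (Xp Xm : ℝ × ℝ × ℝ → ℝ × ℝ × ℝ) (p : ℝ × ℝ × ℝ) : Prop :=
  p.2.1 = 0 ∧ 0 < (Xp p).2.1 * (Xm p).2.1

/-- `φ` is a solution, defined for all times, of the piecewise field (`Xp` on `y > 0`, `Xm` on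
`y < 0`) which meets the plane `y = 0` only at crossing points, where, by Filippov's convention, it
is the concatenation of trajectories of the two fields: if both fields point upwards, `φ` arrives
from `y < 0` with velocity `Xm` and leaves into `y > 0` with velocity `Xp`; if both point
downwards, the other way round. -/
structure IsCrossingSolution (Xp Xm : ℝ × ℝ × ℝ → ℝ × ℝ × ℝ) (φ : ℝ → ℝ × ℝ × ℝ) : Prop where
  upper : ∀ t, 0 < (φ t).2.1 → HasDerivAt φ (Xp (φ t)) t
  lower : ∀ t, (φ t).2.1 < 0 → HasDerivAt φ (Xm (φ t)) t
  crossing : ∀ t, (φ t).2.1 = 0 → IsCrossingPoint Xp Xm (φ t)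
  upward : ∀ t, (φ t).2.1 = 0 → 0 < (Xp (φ t)).2.1 →
    HasDerivWithinAt φ (Xm (φ t)) (Set.Iic t) t ∧ HasDerivWithinAt φ (Xp (φ t)) (Set.Ici t) t
  downward : ∀ t, (φ t).2.1 = 0 → (Xp (φ t)).2.1 < 0 →
    HasDerivWithinAt φ (Xp (φ t)) (Set.Iic t) t ∧ HasDerivWithinAt φ (Xm (φ t)) (Set.Ici t) t

/-- `φ` is a crossing limit cycle of (minimal) period `T`: a periodic solution that meets the plane
`y = 0`, does so only at crossing points, and whose orbit is isolated, i.e. has a neighbourhood that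
contains no other periodic orbit (of any period). Near such an orbit all points of `y = 0` are
crossing points, so it is enough to consider crossing solutions there. -/
structure IsCrossingLimitCycle (Xp Xm : ℝ × ℝ × ℝ → ℝ × ℝ × ℝ) (φ : ℝ → ℝ × ℝ × ℝ) (T : ℝ) :
    Prop where
  solution : IsCrossingSolution Xp Xm φ
  period : IsLeast {S : ℝ | 0 < S ∧ Function.Periodic φ S} T
  meets : ∃ t, (φ t).2.1 = 0
  isolated : ∃ U : Set (ℝ × ℝ × ℝ), IsOpen U ∧ Set.range φ ⊆ U ∧
    ∀ (ψ : ℝ → ℝ × ℝ × ℝ) (S : ℝ), IsCrossingSolution Xp Xm ψ → 0 < S → Function.Periodic ψ S →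
      Set.range ψ ⊆ U → Set.range ψ = Set.range φ

/-- A function of `(x, y)` in polar coordinates. -/
noncomputable def polar (u : ℝ × ℝ → ℝ) (θ r : ℝ) : ℝ := u (r * cos θ, r * sin θ)

/-- The `z`-component at angle `θ` of the solution of the unperturbed system `r' = 0`,
`z' = polar g θ r - z` that starts at `(r, z₀)` for `θ = 0`. -/
noncomputable def zbar (g : ℝ × ℝ → ℝ) (θ r z₀ : ℝ) : ℝ :=
  exp (-θ) * (z₀ + ∫ s in (0 : ℝ)..θ, exp s * polar g s r)

/-- The derivative of `zbar` in `r`; it does not depend on `z₀`, which is therefore set to `0`. -/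
noncomputable def G (g : ℝ × ℝ → ℝ) (θ r : ℝ) : ℝ := deriv (fun ρ => zbar g θ ρ 0) r

/-- The first-order bifurcation function. -/
noncomputable def f₁ (c : Coeffs) (f : ℝ × ℝ → ℝ) (r : ℝ) : ℝ :=
  c.a1 * (∫ φ in (0 : ℝ)..π, polar f φ r * cos φ)
    + c.b1 * (∫ φ in π..(2 * π), polar f φ r * sin φ)

/-- The contribution of `y > 0` to the second-order bifurcation function. -/
noncomputable def f₂upper (c : Coeffs) (f g : ℝ × ℝ → ℝ) (r : ℝ) : ℝ :=
  ∫ s in (0 : ℝ)..π, cos s *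
    (c.a1 * (G g s r * (∫ φ in (0 : ℝ)..s, cos φ * (c.a0 + c.a1 * polar f φ r))
        - exp (-s) * (∫ φ in (0 : ℝ)..s, exp φ * (c.a0 + c.a1 * polar f φ r) *
            (cos φ * G g φ r + sin φ / r * (polar f φ r - polar g φ r))))
      + c.a2 + c.a3 * polar f s r + sin s / r * (c.a0 + c.a1 * polar f s r) ^ 2)

/-- The contribution to the second-order bifurcation function of the first-order displacement of
the `z`-coordinate of the initial point. -/
noncomputable def f₂mid (c : Coeffs) (f g : ℝ × ℝ → ℝ) (r : ℝ) : ℝ :=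
  exp (-2 * π) * (1 + exp π) / (2 * (1 - exp (2 * π))) * (c.a1 * exp π - c.b1) *
    ((∫ φ in (0 : ℝ)..π, exp φ * G g φ r * cos φ * (c.a0 + c.a1 * polar f φ r))
      - (∫ φ in (0 : ℝ)..π, exp φ * sin φ / r * (c.a0 + c.a1 * polar f φ r) *
          (polar g φ r - polar f φ r))
      + c.b1 * (∫ φ in π..(2 * π), exp φ * G g φ r * sin φ * polar f φ r)
      + c.b1 / r * (∫ φ in π..(2 * π), exp φ * cos φ * polar f φ r *
          (polar g φ r - polar f φ r)))

/-- The contribution of `y < 0` to the second-order bifurcation function. -/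
noncomputable def f₂lower (c : Coeffs) (f g : ℝ × ℝ → ℝ) (r : ℝ) : ℝ :=
  ∫ s in π..(2 * π), sin s *
    (c.b2 + c.b3 * polar f s r - c.b1 ^ 2 / r * cos s * polar f s r ^ 2
      + c.b1 * (G g s r * (∫ φ in (0 : ℝ)..π, cos φ * (c.a0 + c.a1 * polar f φ r))
        + c.b1 * G g s r * (∫ φ in π..s, sin φ * polar f φ r)
        + exp (-s) *
          ((∫ φ in (0 : ℝ)..π, exp φ * (c.a0 + c.a1 * polar f φ r) *
              (-cos φ * G g φ r + sin φ / r * (polar g φ r - polar f φ r)))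
            + c.b1 * (∫ φ in π..s, exp φ * polar f φ r *
              (cos φ / r * (polar f φ r - polar g φ r) - G g φ r * sin φ)))))

/-- The second-order bifurcation function. -/
noncomputable def f₂ (c : Coeffs) (f g : ℝ × ℝ → ℝ) (r : ℝ) : ℝ :=
  f₂upper c f g r + f₂mid c f g r + f₂lower c f g r

/-- The unperturbed periodic solution of radius `r` on the surface `z = f (x, y)`. -/
noncomputable def baseOrbit (f : ℝ × ℝ → ℝ) (r t : ℝ) : ℝ × ℝ × ℝ :=
  (r * cos t, r * sin t, f (r * cos t, r * sin t))

end PiecewiseField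

namespace PiecewiseField

open Set Filter Topology MeasureTheory

/-! ### Parametric integrals -/

/-! The unperturbed field rotates (x, y) rigidly and contracts z towards the surface z = f, because
f' = g - f along a rotation. For small ε the angle θ can replace the time. Write r = r₀ + εR and z =
f + ε e^{-θ} W. The weight e^θ cancels the linear contraction, so for ε = 0 the derivatives of R and
W depend on θ and r₀ only. `HalfCoeffs.field` is the resulting equation, regular at ε = 0 and common
to both half-spaces up to a quarter turn of the direction of the perturbation.

The vanishing of f₁ says that for ε = 0 the component R returns to 0 after one turn, so the radius
changes by O(ε²) only. To divide by ε once more, a component Q with Q' = (R' - R'|_{ε=0}) / ε is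
integrated along with R and W; then the radius changes by ε² Q(2π) (`radial_increment`). On the
section θ = 0, with coordinates r and V = (z - f) / ε, the return map is (r, V) ↦ (r + ε² S, N). By
`solution_zero_eval`, at ε = 0 one has S = f₂(r) + κ (V - v(r)) and N = l V + (1 - l) v(r) with l =
e^{-2π}: the height is strongly contracted to v(r), while r drifts slowly under f₂.

The rescaled equation is only C². Instead of differentiating its flow, `exists_flow` bounds first
and second differences by Grönwall's inequality. This is enough for a contraction argument giving a
fixed point at distance O(ε) from (r*, v(r*)) (`ReturnData.exists_fixedPoint`), and for excluding
all other periodic points, of any period, from a neighbourhood whose size does not depend on ε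
(`ReturnData.eq_fixedPoint_of_periodic`).

`exists_crossingSolution` inverts the time function and turns the fixed point into a periodic
crossing solution. For its isolation, a periodic crossing solution inside a tube of width O(ε) is
given a continuous, increasing angle; it follows the flow from one passage of the section to the
next, so its section points form a periodic orbit of the return map and all equal the fixed point
(`range_eq_of_subset_tube`). -/

theorem contDiff_parametric_intervalIntegral_aux {E : Type} [NormedAddCommGroup E]
    [NormedSpace ℝ E] [FiniteDimensional ℝ E] (a b : ℝ) (n : ℕ) :
    ∀ {F : Type} [NormedAddCommGroup F] [NormedSpace ℝ F] (H : E × ℝ → F),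
      ContDiff ℝ n H → ContDiff ℝ n (fun x => ∫ s in a..b, H (x, s)) := by
  -- The target space is quantified inside the induction because the derivative of the integrand
  -- takes values in `E →L[ℝ] F`.
  induction n with
  | zero =>
    intro F _ _ H hH
    have hc : Continuous H := hH.continuous
    refine contDiff_zero.2 ?_
    exact intervalIntegral.continuous_parametric_intervalIntegral_of_continuous'
      (f := fun x s => H (x, s)) hc a b
  | succ n ih =>
    intro F _ _ H hH
    have hH1 : ContDiff ℝ ((n : WithTop ℕ∞) + 1) H := by exact_mod_cast hH
    have hdiff : Differentiable ℝ H := hH1.differentiable (by simp)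
    let H' : E × ℝ → E →L[ℝ] F := fun p => (fderiv ℝ H p).comp (ContinuousLinearMap.inl ℝ E ℝ)
    have hH' : ContDiff ℝ n H' :=
      (hH1.fderiv_right (m := n) le_rfl).clm_comp contDiff_const
    have hH'c : Continuous H' := hH'.continuous
    have hder : ∀ x s, HasFDerivAt (fun x => H (x, s)) (H' (x, s)) x := by
      intro x s
      have h1 := (hdiff (x, s)).hasFDerivAt
      exact h1.comp x (hasFDerivAt_prodMk_left x s)
    have key : ∀ x, HasFDerivAt (fun x => ∫ s in a..b, H (x, s)) (∫ s in a..b, H' (x, s)) x := by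
      intro x
      have : ProperSpace E := FiniteDimensional.proper ℝ E
      obtain ⟨C, hC⟩ := ((isCompact_closedBall x 1).prod (isCompact_uIcc (a := a) (b := b))
        ).exists_bound_of_continuousOn hH'c.continuousOn
      refine intervalIntegral.hasFDerivAt_integral_of_dominated_of_fderiv_le
        (F := fun x s => H (x, s)) (F' := fun x s => H' (x, s)) (s := Metric.ball x 1)
        (bound := fun _ => C) (Metric.ball_mem_nhds x one_pos) ?_ ?_ ?_ ?_ ?_ ?_
      · refine Eventually.of_forall fun y => ?_
        exact (hH.continuous.comp (Continuous.prodMk_right y)).aestronglyMeasurable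
      · exact (hH.continuous.comp (Continuous.prodMk_right x)).intervalIntegrable _ _
      · exact (hH'c.comp (Continuous.prodMk_right x)).aestronglyMeasurable
      · refine Eventually.of_forall fun s hs y hy => hC (y, s) ⟨Metric.ball_subset_closedBall hy, ?_⟩
        exact uIoc_subset_uIcc hs
      · exact intervalIntegrable_const
      · exact Eventually.of_forall fun s _ y _ => hder y s
    have h2 : ContDiff ℝ ((n : WithTop ℕ∞) + 1) (fun x => ∫ s in a..b, H (x, s)) := by
      rw [contDiff_succ_iff_fderiv]
      refine ⟨fun x => (key x).differentiableAt, by simp, ?_⟩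
      have : fderiv ℝ (fun x => ∫ s in a..b, H (x, s)) = fun x => ∫ s in a..b, H' (x, s) := by
        ext1 x; exact (key x).fderiv
      rw [this]
      exact ih H' hH'
    exact_mod_cast h2

theorem contDiff_parametric_intervalIntegral {E F : Type} [NormedAddCommGroup E]
    [NormedSpace ℝ E] [FiniteDimensional ℝ E] [NormedAddCommGroup F] [NormedSpace ℝ F]
    (a b : ℝ) (n : ℕ) {H : E × ℝ → F} (hH : ContDiff ℝ n H) :
    ContDiff ℝ n (fun x => ∫ s in a..b, H (x, s)) :=
  contDiff_parametric_intervalIntegral_aux a b n H hH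

/-! ### Second-difference bounds for `C²` maps -/

/-- The second difference is the increment over [0, 1] of H along the segment from b to a minus H
along the segment from b' to a'. The derivative of this function splits into DH applied to a - b -
a' + b' and a difference of values of DH applied to a - b; bounds for DH and D²H on B finish. Unlike
a C² statement, this bound passes to flows by Grönwall's inequality alone. -/
theorem exists_doubleDiff_bound {E F : Type*} [NormedAddCommGroup E] [NormedSpace ℝ E]
    [NormedAddCommGroup F] [NormedSpace ℝ F] {H : E → F} {B : Set E} (hBc : IsCompact B)
    (hBconv : Convex ℝ B) (hH : ∀ x ∈ B, ContDiffAt ℝ 2 H x) :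
    ∃ K : ℝ, 0 ≤ K ∧ (∀ a ∈ B, ‖H a‖ ≤ K) ∧ (∀ a ∈ B, ∀ b ∈ B, ‖H a - H b‖ ≤ K * ‖a - b‖) ∧
      ∀ a ∈ B, ∀ b ∈ B, ∀ a' ∈ B, ∀ b' ∈ B, ‖H a - H b - H a' + H b'‖ ≤
        K * (‖a - b - a' + b'‖ + ‖a - b‖ * (‖a - a'‖ + ‖b - b'‖)) := by
  have hd : ∀ x ∈ B, HasFDerivAt H (fderiv ℝ H x) x := fun x hx =>
    ((hH x hx).differentiableAt (by norm_num)).hasFDerivAt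
  have hd1 : ∀ x ∈ B, ContDiffAt ℝ 1 (fderiv ℝ H) x := fun x hx =>
    (hH x hx).fderiv_right (by norm_num)
  obtain ⟨K0, hK0⟩ := hBc.exists_bound_of_continuousOn
    (fun x hx => (hH x hx).continuousAt.continuousWithinAt : ContinuousOn H B)
  obtain ⟨K1, hK1⟩ := hBc.exists_bound_of_continuousOn
    (fun x hx => (hd1 x hx).continuousAt.continuousWithinAt : ContinuousOn (fderiv ℝ H) B)
  obtain ⟨K2, hK2⟩ := hBc.exists_bound_of_continuousOn
    (fun x hx => ((hd1 x hx).fderiv_right (m := 0) (by norm_num)).continuousAt.continuousWithinAt :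
      ContinuousOn (fderiv ℝ (fderiv ℝ H)) B)
  set K := max 0 (max K0 (max K1 K2)) with hK
  have hKp : 0 ≤ K := le_max_left _ _
  have hle0 : K0 ≤ K := by simp [hK]
  have hle1 : K1 ≤ K := by simp [hK]
  have hle2 : K2 ≤ K := by simp [hK]
  have lip1 : ∀ a ∈ B, ∀ b ∈ B, ‖fderiv ℝ H a - fderiv ℝ H b‖ ≤ K * ‖a - b‖ := by
    intro a ha b hb
    refine hBconv.norm_image_sub_le_of_norm_hasFDerivWithin_le (f := fderiv ℝ H)
      (f' := fderiv ℝ (fderiv ℝ H)) (fun x hx => ?_) (fun x hx => (hK2 x hx).trans hle2) hb ha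
    exact ((hd1 x hx).differentiableAt (by norm_num)).hasFDerivAt.hasFDerivWithinAt
  refine ⟨K, hKp, fun a ha => (hK0 a ha).trans hle0, ?_, ?_⟩
  · intro a ha b hb
    exact hBconv.norm_image_sub_le_of_norm_hasFDerivWithin_le
      (fun x hx => (hd x hx).hasFDerivWithinAt) (fun x hx => (hK1 x hx).trans hle1) hb ha
  · intro a ha b hb a' ha' b' hb'
    have hmem : ∀ s ∈ Icc (0 : ℝ) 1, ∀ a ∈ B, ∀ b ∈ B, b + s • (a - b) ∈ B := by
      intro s hs a ha b hb
      exact hBconv.add_smul_sub_mem hb ha hs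
    let k : ℝ → F := fun s => H (b + s • (a - b)) - H (b' + s • (a' - b'))
    let k' : ℝ → F := fun s => fderiv ℝ H (b + s • (a - b)) (a - b)
      - fderiv ℝ H (b' + s • (a' - b')) (a' - b')
    have hline : ∀ (a b : E) (s : ℝ), HasDerivAt (fun s : ℝ => b + s • (a - b)) (a - b) s := by
      intro a b s
      simpa using ((hasDerivAt_id s).smul_const (a - b)).const_add b
    have hk : ∀ s ∈ Icc (0 : ℝ) 1, HasDerivWithinAt k (k' s) (Icc 0 1) s := by
      intro s hs
      have h1 := (hd _ (hmem s hs a ha b hb)).comp_hasDerivAt s (hline a b s)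
      have h2 := (hd _ (hmem s hs a' ha' b' hb')).comp_hasDerivAt s (hline a' b' s)
      exact (h1.sub h2).hasDerivWithinAt
    have hb1 : ∀ s ∈ Ico (0 : ℝ) 1, ‖k' s‖ ≤
        K * (‖a - b - a' + b'‖ + ‖a - b‖ * (‖a - a'‖ + ‖b - b'‖)) := by
      intro s hs
      have hs' : s ∈ Icc (0 : ℝ) 1 := ⟨hs.1, hs.2.le⟩
      have e : k' s = fderiv ℝ H (b' + s • (a' - b')) (a - b - a' + b')
          + (fderiv ℝ H (b + s • (a - b)) - fderiv ℝ H (b' + s • (a' - b'))) (a - b) := by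
        have : a - b - a' + b' = (a - b) - (a' - b') := by abel
        rw [this, map_sub]
        simp only [k', _root_.sub_apply]
        abel
      have hdist : ‖b + s • (a - b) - (b' + s • (a' - b'))‖ ≤ ‖a - a'‖ + ‖b - b'‖ := by
        have : b + s • (a - b) - (b' + s • (a' - b')) = s • (a - a') + (1 - s) • (b - b') := by
          module
        rw [this]
        refine (norm_add_le _ _).trans ?_
        rw [norm_smul, norm_smul, Real.norm_of_nonneg hs'.1, Real.norm_of_nonneg (by linarith [hs'.2])]
        have := norm_nonneg (a - a'); have := norm_nonneg (b - b')
        nlinarith [hs'.1, hs'.2]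
      rw [e, mul_add]
      refine (norm_add_le _ _).trans (add_le_add ?_ ?_)
      · refine (ContinuousLinearMap.le_opNorm _ _).trans ?_
        gcongr
        exact (hK1 _ (hmem s hs' a' ha' b' hb')).trans hle1
      · refine (ContinuousLinearMap.le_opNorm _ _).trans ?_
        have h3 := (lip1 _ (hmem s hs' a ha b hb) _ (hmem s hs' a' ha' b' hb')).trans
          (mul_le_mul_of_nonneg_left hdist hKp)
        calc _ ≤ (K * (‖a - a'‖ + ‖b - b'‖)) * ‖a - b‖ := by gcongr
          _ = _ := by ring
    have := norm_image_sub_le_of_norm_deriv_le_segment_01' hk hb1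
    have e2 : k 1 - k 0 = H a - H b - H a' + H b' := by
      simp only [k, one_smul, zero_smul, add_zero]
      rw [add_sub_cancel, add_sub_cancel]; abel
    rwa [e2] at this

/-! ### Ordinary differential equations -/

/-- Grönwall's inequality in a cruder form, linear in δ + ε. Working with K + 1 avoids the separate
case K = 0 in `gronwallBound`. -/
theorem norm_le_of_norm_deriv_right_le {E : Type*} [NormedAddCommGroup E] [NormedSpace ℝ E]
    {f f' : ℝ → E} {δ K ε a b : ℝ} (hf : ContinuousOn f (Icc a b))
    (hf' : ∀ x ∈ Ico a b, HasDerivWithinAt f (f' x) (Ici x) x) (ha : ‖f a‖ ≤ δ)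
    (hδ : 0 ≤ δ) (hε : 0 ≤ ε) (hK : 0 ≤ K)
    (bound : ∀ x ∈ Ico a b, ‖f' x‖ ≤ K * ‖f x‖ + ε) :
    ∀ x ∈ Icc a b, ‖f x‖ ≤ (δ + ε) * Real.exp ((K + 1) * (b - a)) := by
  intro x hx
  have h := norm_le_gronwallBound_of_norm_deriv_right_le (K := K + 1) (ε := ε) hf hf' ha
    (fun x hx => (bound x hx).trans (by have := norm_nonneg (f x); nlinarith)) x hx
  refine h.trans ?_
  rw [gronwallBound_of_K_ne_0 (by positivity)]
  have h1 : Real.exp ((K + 1) * (x - a)) ≤ Real.exp ((K + 1) * (b - a)) := by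
    gcongr; exact hx.2
  have h2 : 1 ≤ Real.exp ((K + 1) * (x - a)) :=
    Real.one_le_exp (mul_nonneg (by positivity) (by linarith [hx.1]))
  have h3 : ε / (K + 1) ≤ ε := div_le_self hε (by linarith)
  have h4 : 0 ≤ ε / (K + 1) := by positivity
  calc δ * Real.exp ((K + 1) * (x - a)) + ε / (K + 1) * (Real.exp ((K + 1) * (x - a)) - 1)
      ≤ δ * Real.exp ((K + 1) * (x - a)) + ε * Real.exp ((K + 1) * (x - a)) := by
        refine add_le_add le_rfl (mul_le_mul h3 (by linarith) (by linarith) hε)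
    _ = (δ + ε) * Real.exp ((K + 1) * (x - a)) := by ring
    _ ≤ _ := by gcongr

/-- A global bound K lets Picard–Lindelöf run at once on all of [a, b], in the ball of radius K (b -
a). -/
theorem exists_solution_of_bounded_lipschitz {E : Type*} [NormedAddCommGroup E] [NormedSpace ℝ E]
    [CompleteSpace E] {v : ℝ → E → E} {a b : ℝ} (hab : a ≤ b) (x₀ : E) {K : ℝ} (hK : 0 ≤ K)
    (hlip : ∀ t ∈ Icc a b, ∀ x y, ‖v t x - v t y‖ ≤ K * ‖x - y‖)
    (hcont : ∀ x, ContinuousOn (fun t => v t x) (Icc a b))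
    (hbd : ∀ t ∈ Icc a b, ∀ x, ‖v t x‖ ≤ K) :
    ∃ X : ℝ → E, X a = x₀ ∧ ∀ t ∈ Icc a b, HasDerivWithinAt X (v t (X t)) (Icc a b) t := by
  lift K to NNReal using hK
  have hab' : 0 ≤ b - a := sub_nonneg.2 hab
  have hP : IsPicardLindelof v (tmin := a) (tmax := b) ⟨a, left_mem_Icc.2 hab⟩ x₀
      (K * ⟨b - a, hab'⟩) 0 K K := by
    refine ⟨fun t ht => ?_, fun x _ => hcont x, fun t ht x _ => hbd t ht x, ?_⟩
    · refine LipschitzOnWith.of_dist_le_mul fun x _ y _ => ?_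
      rw [dist_eq_norm, dist_eq_norm]; exact hlip t ht x y
    · simp only [sub_self, NNReal.coe_zero, sub_zero, max_eq_left hab']
      exact le_rfl
  exact hP.exists_eq_forall_mem_Icc_hasDerivWithinAt₀

theorem hasDerivWithinAt_Icc_Ici {E : Type*} [NormedAddCommGroup E] [NormedSpace ℝ E]
    {f : ℝ → E} {f' : E} {a b t : ℝ} (h : HasDerivWithinAt f f' (Icc a b) t) (ha : a ≤ t)
    (hb : t < b) : HasDerivWithinAt f f' (Ici t) t :=
  h.mono_of_mem_nhdsWithin (mem_of_superset (Icc_mem_nhdsGE hb) (Icc_subset_Icc_left ha))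

/-- The data of a solution on `[0, 2π]` of an equation that has different right-hand sides on
`[0, π]` and on `[π, 2π]`. -/
structure IsTwoPieceSolution {E : Type*} [NormedAddCommGroup E] [NormedSpace ℝ E]
    (v₁ v₂ : ℝ → E → E) (X : ℝ → E) : Prop where
  left : ∀ t ∈ Icc 0 Real.pi, HasDerivWithinAt X (v₁ t (X t)) (Icc 0 Real.pi) t
  right : ∀ t ∈ Icc Real.pi (2 * Real.pi),
    HasDerivWithinAt X (v₂ t (X t)) (Icc Real.pi (2 * Real.pi)) t

namespace IsTwoPieceSolution

variable {E : Type*} [NormedAddCommGroup E] [NormedSpace ℝ E] {v₁ v₂ : ℝ → E → E} {X : ℝ → E}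

theorem hasDerivWithinAt_Ici (h : IsTwoPieceSolution v₁ v₂ X) {t : ℝ}
    (ht : t ∈ Ico 0 (2 * Real.pi)) :
    HasDerivWithinAt X (if t < Real.pi then v₁ t (X t) else v₂ t (X t)) (Ici t) t := by
  split_ifs with h1
  · exact hasDerivWithinAt_Icc_Ici (h.left t ⟨ht.1, h1.le⟩) ht.1 h1
  · exact hasDerivWithinAt_Icc_Ici (h.right t ⟨not_lt.1 h1, ht.2.le⟩) (not_lt.1 h1) ht.2

theorem continuousOn (h : IsTwoPieceSolution v₁ v₂ X) : ContinuousOn X (Icc 0 (2 * Real.pi)) := by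
  have hpi := Real.pi_pos
  have e : Icc 0 (2 * Real.pi) = Icc 0 Real.pi ∪ Icc Real.pi (2 * Real.pi) :=
    (Icc_union_Icc_eq_Icc hpi.le (by linarith)).symm
  rw [e]
  refine ContinuousOn.union_of_isClosed ?_ ?_ isClosed_Icc isClosed_Icc
  · exact fun t ht => (h.left t ht).continuousWithinAt
  · exact fun t ht => (h.right t ht).continuousWithinAt

theorem exists_of_bounded_lipschitz [CompleteSpace E] (x₀ : E) {K : ℝ} (hK : 0 ≤ K)
    (hlip₁ : ∀ t ∈ Icc 0 (2 * Real.pi), ∀ x y, ‖v₁ t x - v₁ t y‖ ≤ K * ‖x - y‖)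
    (hlip₂ : ∀ t ∈ Icc 0 (2 * Real.pi), ∀ x y, ‖v₂ t x - v₂ t y‖ ≤ K * ‖x - y‖)
    (hcont₁ : ∀ x, ContinuousOn (fun t => v₁ t x) (Icc 0 (2 * Real.pi)))
    (hcont₂ : ∀ x, ContinuousOn (fun t => v₂ t x) (Icc 0 (2 * Real.pi)))
    (hbd₁ : ∀ t ∈ Icc 0 (2 * Real.pi), ∀ x, ‖v₁ t x‖ ≤ K)
    (hbd₂ : ∀ t ∈ Icc 0 (2 * Real.pi), ∀ x, ‖v₂ t x‖ ≤ K) :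
    ∃ X : ℝ → E, X 0 = x₀ ∧ IsTwoPieceSolution v₁ v₂ X := by
  have hpi := Real.pi_pos
  have s1 : Icc 0 Real.pi ⊆ Icc 0 (2 * Real.pi) := Icc_subset_Icc_right (by linarith)
  have s2 : Icc Real.pi (2 * Real.pi) ⊆ Icc 0 (2 * Real.pi) := Icc_subset_Icc_left hpi.le
  obtain ⟨X₁, h10, h1⟩ := exists_solution_of_bounded_lipschitz hpi.le x₀ hK
    (fun t ht => hlip₁ t (s1 ht)) (fun x => (hcont₁ x).mono s1) (fun t ht => hbd₁ t (s1 ht))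
  obtain ⟨X₂, h20, h2⟩ := exists_solution_of_bounded_lipschitz (a := Real.pi) (b := 2 * Real.pi)
    (by linarith) (X₁ Real.pi) hK
    (fun t ht => hlip₂ t (s2 ht)) (fun x => (hcont₂ x).mono s2) (fun t ht => hbd₂ t (s2 ht))
  have e1 : ∀ t ∈ Icc 0 Real.pi, (if t ≤ Real.pi then X₁ t else X₂ t) = X₁ t :=
    fun t ht => if_pos ht.2
  have e2 : ∀ t ∈ Icc Real.pi (2 * Real.pi), (if t ≤ Real.pi then X₁ t else X₂ t) = X₂ t := by
    intro t ht
    split_ifs with h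
    · have : t = Real.pi := le_antisymm h ht.1
      rw [this, h20]
    · rfl
  refine ⟨fun t => if t ≤ Real.pi then X₁ t else X₂ t, ?_, ?_, ?_⟩
  · simp [hpi.le, h10]
  · intro t ht
    simp only [e1 t ht]
    exact (h1 t ht).congr e1 (e1 t ht)
  · intro t ht
    simp only [e2 t ht]
    exact (h2 t ht).congr e2 (e2 t ht)

end IsTwoPieceSolution

/-- The points `(θ, (r₀, ε), (R, W))` with `θ ∈ [0, 2π]`, `r₀` comparable with `rs`, `|ε| ≤ e` and
`|R|, |W| ≤ M`. -/
def box (rs M e : ℝ) : Set (ℝ × (ℝ × ℝ) × (ℝ × ℝ)) :=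
  Icc 0 (2 * Real.pi) ×ˢ ((Icc (rs / 2) (3 * rs / 2) ×ˢ Icc (-e) e) ×ˢ
    (Icc (-M) M ×ˢ Icc (-M) M))

theorem isCompact_box (rs M e : ℝ) : IsCompact (box rs M e) :=
  isCompact_Icc.prod ((isCompact_Icc.prod isCompact_Icc).prod (isCompact_Icc.prod isCompact_Icc))

theorem convex_box (rs M e : ℝ) : Convex ℝ (box rs M e) :=
  (convex_Icc _ _).prod
    (((convex_Icc _ _).prod (convex_Icc _ _)).prod ((convex_Icc _ _).prod (convex_Icc _ _)))

theorem box_mono {rs M e e' : ℝ} (h : e' ≤ e) : box rs M e' ⊆ box rs M e := by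
  refine prod_mono le_rfl (prod_mono (prod_mono le_rfl ?_) le_rfl)
  exact Icc_subset_Icc (by linarith) h

/-- The truncation of a vector to the square `[-M, M]²`. -/
noncomputable def clamp {M : ℝ} (hM : -M ≤ M) (x : ℝ × ℝ) : ℝ × ℝ :=
  (projIcc (-M) M hM x.1, projIcc (-M) M hM x.2)

theorem clamp_mem {M : ℝ} (hM : -M ≤ M) (x : ℝ × ℝ) : clamp hM x ∈ Icc (-M) M ×ˢ Icc (-M) M :=
  ⟨(projIcc (-M) M hM x.1).2, (projIcc (-M) M hM x.2).2⟩

theorem clamp_of_mem {M : ℝ} (hM : -M ≤ M) {x : ℝ × ℝ} (hx : x ∈ Icc (-M) M ×ˢ Icc (-M) M) :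
    clamp hM x = x := by
  simp [clamp, projIcc_of_mem hM hx.1, projIcc_of_mem hM hx.2]

theorem norm_clamp_sub_le {M : ℝ} (hM : -M ≤ M) (x y : ℝ × ℝ) :
    ‖clamp hM x - clamp hM y‖ ≤ ‖x - y‖ := by
  have h : ∀ s t : ℝ, ‖(projIcc (-M) M hM s : ℝ) - projIcc (-M) M hM t‖ ≤ ‖s - t‖ := by
    intro s t
    have := (LipschitzWith.projIcc hM).dist_le_mul s t
    simpa [Subtype.dist_eq, dist_eq_norm] using this
  exact max_le_max (h _ _) (h _ _)

theorem norm_triple_le (a : ℝ) (l x : ℝ × ℝ) : ‖(a, l, x)‖ ≤ ‖a‖ + ‖l‖ + ‖x‖ := by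
  have h1 := norm_nonneg a; have h2 := norm_nonneg l; have h3 := norm_nonneg x
  refine max_le (by linarith) (max_le ?_ ?_) <;> simp only <;> linarith

theorem norm_pair_le (a b : ℝ) : ‖(a, b)‖ ≤ ‖a‖ + ‖b‖ :=
  max_le (by simp) (by simp)

theorem norm_initial_le (a : ℝ) : ‖(((0, a), (0, 0)) : (ℝ × ℝ) × (ℝ × ℝ))‖ ≤ ‖a‖ :=
  max_le (max_le (by simp) le_rfl) (max_le (by simp) (by simp))

/-- Collects terms in `exists_flow`: a, b, c are distances between initial data, d is the distance
of the parameters and n the norm of a second difference. -/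
theorem add_mul_le_of_one_le {C a b c d n : ℝ} (hC : 1 ≤ C) (ha : 0 ≤ a) (hb : 0 ≤ b)
    (hc : 0 ≤ c) (hn : 0 ≤ n) :
    n + C * a * (C * (b + d) + C * (c + d)) ≤ 2 * C ^ 2 * (n + a * (b + c + d)) := by
  have h1 : 1 ≤ C ^ 2 := one_le_pow₀ hC
  have h2 : 0 ≤ C ^ 2 * (a * (b + c)) := by positivity
  have h3 : n ≤ C ^ 2 * n := le_mul_of_one_le_left hn h1
  nlinarith

/-- The time-dependent vector field on `(ℝ × ℝ) × (ℝ × ℝ)` defined by `H`. -/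
def flowField (H : ℝ × (ℝ × ℝ) × (ℝ × ℝ) → (ℝ × ℝ) × (ℝ × ℝ)) (r ε : ℝ) (θ : ℝ)
    (X : (ℝ × ℝ) × (ℝ × ℝ)) : (ℝ × ℝ) × (ℝ × ℝ) := H (θ, (r, ε), X.1)

set_option maxHeartbeats 1000000 in
/-- Existence of solutions with estimates for their first and second differences with respect to
the initial data `p = (r₀, V₀)` and the parameter `ε`. -/
theorem exists_flow (H₁ H₂ : ℝ × (ℝ × ℝ) × (ℝ × ℝ) → (ℝ × ℝ) × (ℝ × ℝ)) {rs k vs : ℝ}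
    (hk : 0 ≤ k)
    (hsm : ∀ M, 0 < M → ∃ e > 0, ∀ u ∈ box rs M e, ContDiffAt ℝ 2 H₁ u ∧ ContDiffAt ℝ 2 H₂ u)
    (hk₁ : ∀ θ ∈ Icc 0 (2 * Real.pi), ∀ r ∈ Icc (rs / 2) (3 * rs / 2), ∀ x,
      ‖(H₁ (θ, (r, 0), x)).1‖ ≤ k)
    (hk₂ : ∀ θ ∈ Icc 0 (2 * Real.pi), ∀ r ∈ Icc (rs / 2) (3 * rs / 2), ∀ x,
      ‖(H₂ (θ, (r, 0), x)).1‖ ≤ k) :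
    ∃ M > 0, ∃ e > 0, ∃ C > 0, ∃ X : ℝ × ℝ → ℝ → ℝ → (ℝ × ℝ) × (ℝ × ℝ),
      (∀ p ∈ Icc (rs / 2) (3 * rs / 2) ×ˢ Icc (vs - 1) (vs + 1), ∀ ε ∈ Icc (-e) e,
        X p ε 0 = ((0, p.2), (0, 0)) ∧
        IsTwoPieceSolution (flowField H₁ p.1 ε) (flowField H₂ p.1 ε) (X p ε) ∧
        ∀ θ ∈ Icc 0 (2 * Real.pi), (X p ε θ).1 ∈ Icc (-M) M ×ˢ Icc (-M) M) ∧
      (∀ p ∈ Icc (rs / 2) (3 * rs / 2) ×ˢ Icc (vs - 1) (vs + 1), ∀ ε ∈ Icc (-e) e,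
        ∀ q ∈ Icc (rs / 2) (3 * rs / 2) ×ˢ Icc (vs - 1) (vs + 1), ∀ ε' ∈ Icc (-e) e,
        ∀ θ ∈ Icc 0 (2 * Real.pi), ‖X p ε θ - X q ε' θ‖ ≤ C * (‖p - q‖ + |ε - ε'|)) ∧
      (∀ p ∈ Icc (rs / 2) (3 * rs / 2) ×ˢ Icc (vs - 1) (vs + 1),
        ∀ q ∈ Icc (rs / 2) (3 * rs / 2) ×ˢ Icc (vs - 1) (vs + 1),
        ∀ p' ∈ Icc (rs / 2) (3 * rs / 2) ×ˢ Icc (vs - 1) (vs + 1),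
        ∀ q' ∈ Icc (rs / 2) (3 * rs / 2) ×ˢ Icc (vs - 1) (vs + 1),
        ∀ ε ∈ Icc (-e) e, ∀ ε' ∈ Icc (-e) e, ∀ θ ∈ Icc 0 (2 * Real.pi),
        ‖X p ε θ - X q ε θ - X p' ε' θ + X q' ε' θ‖ ≤
          C * (‖p - q - p' + q'‖ + ‖p - q‖ * (‖p - p'‖ + ‖q - q'‖ + |ε - ε'|))) := by
  have hpi := Real.pi_pos
  set I := Icc (rs / 2) (3 * rs / 2) ×ˢ Icc (vs - 1) (vs + 1) with hI
  -- For ε = 0 the speed of (R, W) is at most k wherever (R, W) is, so M can be fixed before the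
  -- range of ε: a start of norm at most |vs| + 1 and speed k + 1 lead no further than M within 2π.
  set M : ℝ := |vs| + 1 + 2 * Real.pi * (k + 1) with hMdef
  have hM : 0 < M := by positivity
  have hMM : -M ≤ M := by linarith
  obtain ⟨e₀, he₀, hsm'⟩ := hsm M hM
  obtain ⟨K₁, hK₁, hb₁, hl₁, hd₁⟩ := exists_doubleDiff_bound (isCompact_box rs M e₀)
    (convex_box rs M e₀) (fun u hu => (hsm' u hu).1)
  obtain ⟨K₂, hK₂, hb₂, hl₂, hd₂⟩ := exists_doubleDiff_bound (isCompact_box rs M e₀)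
    (convex_box rs M e₀) (fun u hu => (hsm' u hu).2)
  set K := max K₁ K₂ with hKdef
  have hK : 0 ≤ K := hK₁.trans (le_max_left _ _)
  -- K e ≤ 1 keeps the speed of (R, W) below k + 1 for every |ε| ≤ e.
  set e := min e₀ (1 / (K + 1)) with hedef
  have he : 0 < e := lt_min he₀ (by positivity)
  have hee : e ≤ e₀ := min_le_left _ _
  have hKe : K * e ≤ 1 := by
    have : e ≤ 1 / (K + 1) := min_le_right _ _
    rw [le_div_iff₀ (by positivity)] at this
    nlinarith
  -- uniform treatment of the two fields
  have good : ∀ H, (H = H₁ ∨ H = H₂) → (∀ u ∈ box rs M e, ContinuousAt H u) ∧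
      (∀ u ∈ box rs M e, ‖H u‖ ≤ K) ∧
      (∀ u ∈ box rs M e, ∀ w ∈ box rs M e, ‖H u - H w‖ ≤ K * ‖u - w‖) ∧
      (∀ a ∈ box rs M e, ∀ b ∈ box rs M e, ∀ a' ∈ box rs M e, ∀ b' ∈ box rs M e,
        ‖H a - H b - H a' + H b'‖ ≤
          K * (‖a - b - a' + b'‖ + ‖a - b‖ * (‖a - a'‖ + ‖b - b'‖))) ∧
      (∀ θ ∈ Icc 0 (2 * Real.pi), ∀ r ∈ Icc (rs / 2) (3 * rs / 2), ∀ x, ‖(H (θ, (r, 0), x)).1‖ ≤ k)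
      := by
    have hm := box_mono (rs := rs) (M := M) hee
    rintro H (rfl | rfl)
    · refine ⟨fun u hu => (hsm' u (hm hu)).1.continuousAt,
        fun u hu => (hb₁ u (hm hu)).trans (le_max_left _ _),
        fun u hu w hw => (hl₁ u (hm hu) w (hm hw)).trans ?_,
        fun a ha b hb a' ha' b' hb' =>
          (hd₁ a (hm ha) b (hm hb) a' (hm ha') b' (hm hb')).trans ?_, hk₁⟩
      · gcongr; exact le_max_left _ _
      · gcongr; exact le_max_left _ _
    · refine ⟨fun u hu => (hsm' u (hm hu)).2.continuousAt,
        fun u hu => (hb₂ u (hm hu)).trans (le_max_right _ _),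
        fun u hu w hw => (hl₂ u (hm hu) w (hm hw)).trans ?_,
        fun a ha b hb a' ha' b' hb' =>
          (hd₂ a (hm ha) b (hm hb) a' (hm ha') b' (hm hb')).trans ?_, hk₂⟩
      · gcongr; exact le_max_right _ _
      · gcongr; exact le_max_right _ _
  -- Truncating (R, W) to the square makes the fields globally bounded and Lipschitz.
  have cf : ∀ H, (H = H₁ ∨ H = H₂) → ∀ r ∈ Icc (rs / 2) (3 * rs / 2), ∀ ε ∈ Icc (-e) e,
      (∀ t ∈ Icc 0 (2 * Real.pi), ∀ x y : (ℝ × ℝ) × (ℝ × ℝ),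
        ‖H (t, (r, ε), clamp hMM x.1) - H (t, (r, ε), clamp hMM y.1)‖ ≤ K * ‖x - y‖) ∧
      (∀ x : (ℝ × ℝ) × (ℝ × ℝ), ContinuousOn (fun t => H (t, (r, ε), clamp hMM x.1))
        (Icc 0 (2 * Real.pi))) ∧
      (∀ t ∈ Icc 0 (2 * Real.pi), ∀ x : (ℝ × ℝ) × (ℝ × ℝ),
        ‖H (t, (r, ε), clamp hMM x.1)‖ ≤ K) ∧
      (∀ t ∈ Icc 0 (2 * Real.pi), ∀ x : (ℝ × ℝ) × (ℝ × ℝ),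
        ‖(H (t, (r, ε), clamp hMM x.1)).1‖ ≤ k + 1) := by
    intro H hH r hr ε hε
    obtain ⟨gc, gb, gl, -, gk⟩ := good H hH
    have mem : ∀ t ∈ Icc 0 (2 * Real.pi), ∀ x : (ℝ × ℝ) × (ℝ × ℝ),
        (t, (r, ε), clamp hMM x.1) ∈ box rs M e := fun t ht x =>
      ⟨ht, ⟨hr, hε⟩, clamp_mem hMM x.1⟩
    have mem0 : ∀ t ∈ Icc 0 (2 * Real.pi), ∀ x : (ℝ × ℝ) × (ℝ × ℝ),
        (t, (r, (0 : ℝ)), clamp hMM x.1) ∈ box rs M e := fun t ht x =>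
      ⟨ht, ⟨hr, ⟨by simp [he.le], by simp [he.le]⟩⟩, clamp_mem hMM x.1⟩
    refine ⟨fun t ht x y => ?_, fun x t ht => ?_, fun t ht x => gb _ (mem t ht x),
      fun t ht x => ?_⟩
    · refine (gl _ (mem t ht x) _ (mem t ht y)).trans ?_
      gcongr
      rw [Prod.mk_sub_mk, Prod.mk_sub_mk, sub_self, sub_self]
      refine (norm_triple_le _ _ _).trans ?_
      rw [norm_zero, norm_zero, zero_add, zero_add]
      exact (norm_clamp_sub_le hMM _ _).trans (norm_fst_le (x - y))
    · exact ((gc _ (mem t ht x)).comp (f := fun t => (t, (r, ε), clamp hMM x.1))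
        (Continuous.continuousAt (by fun_prop))).continuousWithinAt
    · have h1 := gl _ (mem t ht x) _ (mem0 t ht x)
      have h2 : ‖((t, (r, ε), clamp hMM x.1) : ℝ × (ℝ × ℝ) × (ℝ × ℝ))
          - (t, (r, 0), clamp hMM x.1)‖ ≤ e := by
        rw [Prod.mk_sub_mk, Prod.mk_sub_mk, Prod.mk_sub_mk, sub_self, sub_self, sub_self, sub_zero]
        refine (norm_triple_le _ _ _).trans ?_
        rw [norm_zero, norm_zero, zero_add, add_zero]
        refine (norm_pair_le _ _).trans ?_
        rw [norm_zero, zero_add]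
        exact abs_le.2 hε
      have h3 := gk t ht r hr (clamp hMM x.1)
      have h4 := norm_fst_le (H (t, (r, ε), clamp hMM x.1) - H (t, (r, 0), clamp hMM x.1))
      have h5 := norm_le_insert' (H (t, (r, ε), clamp hMM x.1)).1 (H (t, (r, 0), clamp hMM x.1)).1
      have h6 : K * ‖((t, (r, ε), clamp hMM x.1) : ℝ × (ℝ × ℝ) × (ℝ × ℝ))
          - (t, (r, 0), clamp hMM x.1)‖ ≤ K * e := by gcongr
      rw [Prod.fst_sub] at h4
      linarith
  have ex : ∀ p ∈ I, ∀ ε ∈ Icc (-e) e, ∃ X : ℝ → (ℝ × ℝ) × (ℝ × ℝ), X 0 = ((0, p.2), (0, 0)) ∧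
        IsTwoPieceSolution (flowField H₁ p.1 ε) (flowField H₂ p.1 ε) X ∧
        ∀ θ ∈ Icc 0 (2 * Real.pi), (X θ).1 ∈ Icc (-M) M ×ˢ Icc (-M) M := by
    intro p hp ε hε
    obtain ⟨c1, c2, c3, c4⟩ := cf H₁ (Or.inl rfl) p.1 hp.1 ε hε
    obtain ⟨d1, d2, d3, d4⟩ := cf H₂ (Or.inr rfl) p.1 hp.1 ε hε
    obtain ⟨X, hX0, hX⟩ := IsTwoPieceSolution.exists_of_bounded_lipschitz
      (v₁ := fun t x => H₁ (t, (p.1, ε), clamp hMM x.1))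
      (v₂ := fun t x => H₂ (t, (p.1, ε), clamp hMM x.1)) ((0, p.2), (0, 0)) hK c1 d1 c2 d2 c3 d3
    -- The solution of the truncated equation stays in the square, hence solves the original
    -- equation.
    have stay : ∀ θ ∈ Icc 0 (2 * Real.pi), (X θ).1 ∈ Icc (-M) M ×ˢ Icc (-M) M := by
      intro θ hθ
      have h := norm_image_sub_le_of_norm_deriv_right_le_segment (f := fun t => (X t).1)
        (C := k + 1) (f' := fun t => (if t < Real.pi then H₁ (t, (p.1, ε), clamp hMM (X t).1)
          else H₂ (t, (p.1, ε), clamp hMM (X t).1)).1)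
        (continuous_fst.comp_continuousOn hX.continuousOn)
        (fun t ht => (ContinuousLinearMap.fst ℝ (ℝ × ℝ) (ℝ × ℝ)).hasFDerivAt.comp_hasDerivWithinAt t
          (hX.hasDerivWithinAt_Ici ht)) (fun t ht => by
            have ht' : t ∈ Icc 0 (2 * Real.pi) := ⟨ht.1, ht.2.le⟩
            split_ifs
            · exact c4 t ht' (X t)
            · exact d4 t ht' (X t)) θ hθ
      have h2 : ‖(X 0).1‖ ≤ |vs| + 1 := by
        rw [hX0]
        refine (norm_pair_le _ _).trans ?_
        rw [norm_zero, zero_add, Real.norm_eq_abs, abs_le]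
        have h3 := hp.2.1; have h4 := hp.2.2
        exact ⟨by linarith [neg_abs_le vs], by linarith [le_abs_self vs]⟩
      have h3 : ‖(X θ).1‖ ≤ M := by
        have h4 := norm_le_insert' (X θ).1 (X 0).1
        have h5 : (k + 1) * (θ - 0) ≤ 2 * Real.pi * (k + 1) := by
          have := hθ.2
          nlinarith
        linarith
      exact ⟨abs_le.1 ((norm_fst_le _).trans h3), abs_le.1 ((norm_snd_le _).trans h3)⟩
    refine ⟨X, hX0, ⟨fun t ht => ?_, fun t ht => ?_⟩, stay⟩
    · have := hX.left t ht
      rwa [clamp_of_mem hMM (stay t ⟨ht.1, by linarith [ht.2]⟩)] at this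
    · have := hX.right t ht
      rwa [clamp_of_mem hMM (stay t ⟨by linarith [ht.1], ht.2⟩)] at this
  choose! X hX using ex
  have mem : ∀ p ∈ I, ∀ ε ∈ Icc (-e) e, ∀ t ∈ Icc 0 (2 * Real.pi),
      (t, (p.1, ε), (X p ε t).1) ∈ box rs M e := fun p hp ε hε t ht =>
    ⟨ht, ⟨hp.1, hε⟩, (hX p hp ε hε).2.2 t ht⟩
  set C₁ := (1 + K) * Real.exp ((K + 1) * (2 * Real.pi - 0)) with hC₁
  have hC₁0 : 0 < C₁ := by positivity
  -- Grönwall for first differences: unequal radii and parameters act as a forcing term K (‖p - q‖ +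
  -- |ε - ε'|).
  have lip : ∀ p ∈ I, ∀ ε ∈ Icc (-e) e, ∀ q ∈ I, ∀ ε' ∈ Icc (-e) e,
        ∀ θ ∈ Icc 0 (2 * Real.pi), ‖X p ε θ - X q ε' θ‖ ≤ C₁ * (‖p - q‖ + |ε - ε'|) := by
    intro p hp ε hε q hq ε' hε' θ hθ
    obtain ⟨x0, x1, -⟩ := hX p hp ε hε
    obtain ⟨y0, y1, -⟩ := hX q hq ε' hε'
    have hnn : 0 ≤ ‖p - q‖ + |ε - ε'| := by positivity
    have h := norm_le_of_norm_deriv_right_le (K := K) (δ := ‖p - q‖ + |ε - ε'|)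
      (ε := K * (‖p - q‖ + |ε - ε'|))
      (x1.continuousOn.sub y1.continuousOn)
      (fun t ht => (x1.hasDerivWithinAt_Ici ht).sub (y1.hasDerivWithinAt_Ici ht))
      ?_ hnn (by positivity) hK ?_ θ hθ
    · refine h.trans (le_of_eq ?_)
      rw [hC₁]; ring
    · have e0 : X p ε 0 - X q ε' 0 = ((0, p.2 - q.2), (0, 0)) := by
        rw [x0, y0]; ext <;> simp
      rw [Pi.sub_apply, e0]
      have h1 := norm_snd_le (p - q)
      have h3 := abs_nonneg (ε - ε')
      rw [Prod.snd_sub] at h1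
      exact (norm_initial_le _).trans (by linarith)
    · intro t ht
      have ht' : t ∈ Icc 0 (2 * Real.pi) := ⟨ht.1, ht.2.le⟩
      have key : ∀ H, (H = H₁ ∨ H = H₂) →
          ‖H (t, (p.1, ε), (X p ε t).1) - H (t, (q.1, ε'), (X q ε' t).1)‖ ≤
            K * ‖X p ε t - X q ε' t‖ + K * (‖p - q‖ + |ε - ε'|) := by
        intro H hH
        refine ((good H hH).2.2.1 _ (mem p hp ε hε t ht') _ (mem q hq ε' hε' t ht')).trans ?_
        rw [← mul_add]
        gcongr
        rw [Prod.mk_sub_mk, Prod.mk_sub_mk, Prod.mk_sub_mk, sub_self]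
        refine (norm_triple_le _ _ _).trans ?_
        have h1 := norm_pair_le (p.1 - q.1) (ε - ε')
        have h2 := norm_fst_le (p - q)
        have h3 := norm_fst_le (X p ε t - X q ε' t)
        rw [Prod.fst_sub] at h2 h3
        rw [Real.norm_eq_abs (ε - ε')] at h1
        rw [norm_zero]
        linarith
      simp only [Pi.sub_apply, flowField]
      split_ifs
      · exact key H₁ (Or.inl rfl)
      · exact key H₂ (Or.inr rfl)
  -- For second differences the forcing term is 2K (C₁ + 1)² T: it comes from the second difference
  -- of the data and from products of first differences, each bounded by `lip`.
  set C₂ := (1 + 2 * K * (C₁ + 1) ^ 2) * Real.exp ((K + 1) * (2 * Real.pi - 0)) with hC₂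
  have hC₂0 : 0 < C₂ := by positivity
  refine ⟨M, hM, e, he, max C₁ C₂, lt_max_of_lt_left hC₁0, X, hX, ?_, ?_⟩
  · intro p hp ε hε q hq ε' hε' θ hθ
    refine (lip p hp ε hε q hq ε' hε' θ hθ).trans ?_
    gcongr
    exact le_max_left _ _
  · intro p hp q hq p' hp' q' hq' ε hε ε' hε' θ hθ
    set T := ‖p - q - p' + q'‖ + ‖p - q‖ * (‖p - p'‖ + ‖q - q'‖ + |ε - ε'|) with hT
    have hT0 : 0 ≤ T := by positivity
    obtain ⟨x0, x1, -⟩ := hX p hp ε hε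
    obtain ⟨y0, y1, -⟩ := hX q hq ε hε
    obtain ⟨z0, z1, -⟩ := hX p' hp' ε' hε'
    obtain ⟨w0, w1, -⟩ := hX q' hq' ε' hε'
    have hp1 : ‖p - q - p' + q'‖ ≤ T := by
      rw [hT]; have : 0 ≤ ‖p - q‖ * (‖p - p'‖ + ‖q - q'‖ + |ε - ε'|) := by positivity
      linarith
    have h := norm_le_of_norm_deriv_right_le (K := K) (δ := T) (ε := 2 * K * (C₁ + 1) ^ 2 * T)
      (((x1.continuousOn.sub y1.continuousOn).sub z1.continuousOn).add w1.continuousOn)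
      (fun t ht => (((x1.hasDerivWithinAt_Ici ht).sub (y1.hasDerivWithinAt_Ici ht)).sub
        (z1.hasDerivWithinAt_Ici ht)).add (w1.hasDerivWithinAt_Ici ht))
      ?_ hT0 (by positivity) hK ?_ θ hθ
    · refine h.trans ?_
      calc (T + 2 * K * (C₁ + 1) ^ 2 * T) * Real.exp ((K + 1) * (2 * Real.pi - 0)) = C₂ * T := by
            rw [hC₂]; ring
        _ ≤ _ := by gcongr; exact le_max_right _ _
    · have e0 : X p ε 0 - X q ε 0 - X p' ε' 0 + X q' ε' 0 =
          ((0, p.2 - q.2 - p'.2 + q'.2), (0, 0)) := by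
        rw [x0, y0, z0, w0]; ext <;> simp
      rw [Pi.add_apply, Pi.sub_apply, Pi.sub_apply, e0]
      have h1 := norm_snd_le (p - q - p' + q')
      simp only [Prod.snd_sub, Prod.snd_add] at h1
      exact (norm_initial_le _).trans (by linarith)
    · intro t ht
      have ht' : t ∈ Icc 0 (2 * Real.pi) := ⟨ht.1, ht.2.le⟩
      have dist1 : ∀ p ∈ I, ∀ ε ∈ Icc (-e) e, ∀ q ∈ I, ∀ ε' ∈ Icc (-e) e,
          ‖((t, (p.1, ε), (X p ε t).1) : ℝ × (ℝ × ℝ) × (ℝ × ℝ)) - (t, (q.1, ε'), (X q ε' t).1)‖ ≤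
            (C₁ + 1) * (‖p - q‖ + |ε - ε'|) := by
        intro p hp ε hε q hq ε' hε'
        rw [Prod.mk_sub_mk, Prod.mk_sub_mk, Prod.mk_sub_mk, sub_self]
        refine (norm_triple_le _ _ _).trans ?_
        have h1 := norm_pair_le (p.1 - q.1) (ε - ε')
        have h2 := norm_fst_le (p - q)
        have h3 := norm_fst_le (X p ε t - X q ε' t)
        have h4 := lip p hp ε hε q hq ε' hε' t ht'
        rw [Prod.fst_sub] at h2 h3
        rw [Real.norm_eq_abs (ε - ε')] at h1
        rw [norm_zero]
        linarith
      have key : ∀ H, (H = H₁ ∨ H = H₂) →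
          ‖H (t, (p.1, ε), (X p ε t).1) - H (t, (q.1, ε), (X q ε t).1)
            - H (t, (p'.1, ε'), (X p' ε' t).1) + H (t, (q'.1, ε'), (X q' ε' t).1)‖ ≤
            K * ‖X p ε t - X q ε t - X p' ε' t + X q' ε' t‖ + 2 * K * (C₁ + 1) ^ 2 * T := by
        intro H hH
        refine ((good H hH).2.2.2.1 _ (mem p hp ε hε t ht') _ (mem q hq ε hε t ht')
          _ (mem p' hp' ε' hε' t ht') _ (mem q' hq' ε' hε' t ht')).trans ?_
        have d1 := dist1 p hp ε hε q hq ε hε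
        have d2 := dist1 p hp ε hε p' hp' ε' hε'
        have d3 := dist1 q hq ε hε q' hq' ε' hε'
        rw [sub_self, abs_zero, add_zero] at d1
        have d4 : ‖((t, (p.1, ε), (X p ε t).1) : ℝ × (ℝ × ℝ) × (ℝ × ℝ)) - (t, (q.1, ε), (X q ε t).1)
            - (t, (p'.1, ε'), (X p' ε' t).1) + (t, (q'.1, ε'), (X q' ε' t).1)‖ ≤
            ‖X p ε t - X q ε t - X p' ε' t + X q' ε' t‖ + ‖p - q - p' + q'‖ := by
          simp only [Prod.mk_sub_mk, Prod.mk_add_mk, sub_self, zero_sub, neg_add_cancel]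
          refine (norm_triple_le _ _ _).trans ?_
          have h1 := norm_pair_le (p.1 - q.1 - p'.1 + q'.1) 0
          have h2 := norm_fst_le (p - q - p' + q')
          have h3 := norm_fst_le (X p ε t - X q ε t - X p' ε' t + X q' ε' t)
          simp only [Prod.fst_sub, Prod.fst_add] at h2 h3
          rw [norm_zero] at h1 ⊢
          linarith
        set a := ‖p - q‖
        set b := ‖p - p'‖
        set c := ‖q - q'‖
        set d := |ε - ε'|
        have ha : 0 ≤ a := norm_nonneg _
        have hb : 0 ≤ b := norm_nonneg _
        have hc : 0 ≤ c := norm_nonneg _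
        have hd : 0 ≤ d := abs_nonneg _
        have hpd := norm_nonneg (p - q - p' + q')
        have d5 := mul_le_mul d1 (add_le_add d2 d3) (by positivity) (by positivity)
        have d6 := add_mul_le_of_one_le (C := C₁ + 1) (d := d) (by linarith) ha hb hc hpd
        calc _ ≤ K * ((‖X p ε t - X q ε t - X p' ε' t + X q' ε' t‖ + ‖p - q - p' + q'‖)
              + (C₁ + 1) * a * ((C₁ + 1) * (b + d) + (C₁ + 1) * (c + d))) :=
            mul_le_mul_of_nonneg_left (add_le_add d4 d5) hK
          _ ≤ K * (‖X p ε t - X q ε t - X p' ε' t + X q' ε' t‖ + 2 * (C₁ + 1) ^ 2 * T) := by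
            refine mul_le_mul_of_nonneg_left ?_ hK
            rw [add_assoc]
            exact add_le_add le_rfl d6
          _ = _ := by ring
      simp only [Pi.sub_apply, Pi.add_apply, flowField]
      split_ifs
      · exact key H₁ (Or.inl rfl)
      · exact key H₂ (Or.inr rfl)

/-! ### The function `f` -/

theorem fderiv_apply_pair (f : ℝ × ℝ → ℝ) (p : ℝ × ℝ) (a b : ℝ) :
    fderiv ℝ f p (a, b) = a * fderiv ℝ f p (1, 0) + b * fderiv ℝ f p (0, 1) := by
  have : ((a, b) : ℝ × ℝ) = a • ((1, 0) : ℝ × ℝ) + b • ((0, 1) : ℝ × ℝ) := by ext <;> simp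
  rw [this, map_add, map_smul, map_smul, smul_eq_mul, smul_eq_mul]

/-- The partial differential equation satisfied by `f`. -/
def IsRotationPrimitive (f g : ℝ × ℝ → ℝ) : Prop :=
  ∀ x y : ℝ, g (x, y) =
      f (x, y) + x * fderiv ℝ f (x, y) (0, 1) - y * fderiv ℝ f (x, y) (1, 0)

theorem hasDerivAt_rotate {f g : ℝ × ℝ → ℝ} (hf : Differentiable ℝ f)
    (hfg : IsRotationPrimitive f g) (x y s : ℝ) :
    HasDerivAt (fun s => f (x * Real.cos s - y * Real.sin s, x * Real.sin s + y * Real.cos s))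
      (g (x * Real.cos s - y * Real.sin s, x * Real.sin s + y * Real.cos s)
        - f (x * Real.cos s - y * Real.sin s, x * Real.sin s + y * Real.cos s)) s := by
  have h1 : HasDerivAt (fun s : ℝ => (x * Real.cos s - y * Real.sin s,
      x * Real.sin s + y * Real.cos s))
      (x * (-Real.sin s) - y * Real.cos s, x * Real.cos s + y * (-Real.sin s)) s :=
    (((Real.hasDerivAt_cos s).const_mul x).sub ((Real.hasDerivAt_sin s).const_mul y)).prodMk
      (((Real.hasDerivAt_sin s).const_mul x).add ((Real.hasDerivAt_cos s).const_mul y))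
  have h2 := (hf (x * Real.cos s - y * Real.sin s,
    x * Real.sin s + y * Real.cos s)).hasFDerivAt.comp_hasDerivAt s h1
  convert! h2 using 1
  rw [fderiv_apply_pair, hfg]
  ring

/-- Along a rotation the derivative of eˢ f is eˢ g. Over a full turn f returns to its value, so the
integral is (e^{2π} - 1) f(p). -/
theorem eq_integral_rotate {f g : ℝ × ℝ → ℝ} (hf : Differentiable ℝ f) (hg : Continuous g)
    (hfg : IsRotationPrimitive f g) (p : ℝ × ℝ) :
    f p = (Real.exp (2 * Real.pi) - 1)⁻¹ * ∫ s in (0 : ℝ)..(2 * Real.pi), Real.exp s *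
      g (p.1 * Real.cos s - p.2 * Real.sin s, p.1 * Real.sin s + p.2 * Real.cos s) := by
  have h := intervalIntegral.integral_eq_sub_of_hasDerivAt (a := 0) (b := 2 * Real.pi)
    (f := fun s => Real.exp s *
      f (p.1 * Real.cos s - p.2 * Real.sin s, p.1 * Real.sin s + p.2 * Real.cos s))
    (f' := fun s => Real.exp s *
      g (p.1 * Real.cos s - p.2 * Real.sin s, p.1 * Real.sin s + p.2 * Real.cos s))
    (fun s _ => by
      have := (Real.hasDerivAt_exp s).mul (hasDerivAt_rotate hf hfg p.1 p.2 s)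
      convert! this using 1
      ring) ((by fun_prop : Continuous _).intervalIntegrable _ _)
  have hne : Real.exp (2 * Real.pi) - 1 ≠ 0 := by
    have : 1 < Real.exp (2 * Real.pi) := Real.one_lt_exp_iff.2 (by positivity)
    linarith
  rw [h, eq_inv_mul_iff_mul_eq₀ hne]
  simp
  ring

/-- Averaging over rotations expresses f through g, so f inherits the regularity of g although it is
only assumed differentiable. -/
theorem contDiff_of_isRotationPrimitive {f g : ℝ × ℝ → ℝ} (hf : Differentiable ℝ f)
    (hg : ContDiff ℝ 3 g) (hfg : IsRotationPrimitive f g) : ContDiff ℝ 3 f := by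
  have e := funext (eq_integral_rotate hf hg.continuous hfg)
  rw [e]
  refine contDiff_const.mul ?_
  have hH : ContDiff ℝ ((3 : ℕ) : WithTop ℕ∞) (fun q : (ℝ × ℝ) × ℝ => Real.exp q.2 *
      g (q.1.1 * Real.cos q.2 - q.1.2 * Real.sin q.2,
        q.1.1 * Real.sin q.2 + q.1.2 * Real.cos q.2)) := by
    have hg' : ContDiff ℝ ((3 : ℕ) : WithTop ℕ∞) g := by exact_mod_cast hg
    fun_prop
  exact_mod_cast contDiff_parametric_intervalIntegral 0 (2 * Real.pi) 3 hH

theorem hasDerivAt_polar_angle {f g : ℝ × ℝ → ℝ} (hf : Differentiable ℝ f)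
    (hfg : IsRotationPrimitive f g) (r θ : ℝ) :
    HasDerivAt (fun θ => polar f θ r) (polar g θ r - polar f θ r) θ := by
  simpa [polar] using hasDerivAt_rotate hf hfg r 0 θ

/-- The radial derivative of `f` in polar coordinates. -/
noncomputable def polarDeriv (f : ℝ × ℝ → ℝ) (θ r : ℝ) : ℝ :=
  fderiv ℝ f (r * Real.cos θ, r * Real.sin θ) (Real.cos θ, Real.sin θ)

theorem hasDerivAt_polar_radius {f : ℝ × ℝ → ℝ} (hf : Differentiable ℝ f) (θ r : ℝ) :
    HasDerivAt (fun r => polar f θ r) (polarDeriv f θ r) r := by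
  have h1 : HasDerivAt (fun r : ℝ => (r * Real.cos θ, r * Real.sin θ))
      (Real.cos θ, Real.sin θ) r := by
    simpa using ((hasDerivAt_id r).mul_const (Real.cos θ)).prodMk
      ((hasDerivAt_id r).mul_const (Real.sin θ))
  exact (hf _).hasFDerivAt.comp_hasDerivAt r h1

/-- By the equation for g the angular derivative of f is g - f, so only the radial derivative of f
remains. -/
theorem hasDerivWithinAt_polar {f g : ℝ × ℝ → ℝ} (hf : Differentiable ℝ f)
    (hfg : IsRotationPrimitive f g) {Θ ρ : ℝ → ℝ} {Θ' ρ' t : ℝ} {s : Set ℝ}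
    (hΘ : HasDerivWithinAt Θ Θ' s t) (hρ : HasDerivWithinAt ρ ρ' s t) :
    HasDerivWithinAt (fun t => polar f (Θ t) (ρ t))
      ((polar g (Θ t) (ρ t) - polar f (Θ t) (ρ t)) * Θ' + polarDeriv f (Θ t) (ρ t) * ρ') s t := by
  have h1 : HasDerivWithinAt (fun t : ℝ => (ρ t * Real.cos (Θ t), ρ t * Real.sin (Θ t)))
      (ρ' * Real.cos (Θ t) + ρ t * (-Real.sin (Θ t) * Θ'),
        ρ' * Real.sin (Θ t) + ρ t * (Real.cos (Θ t) * Θ')) s t :=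
    (hρ.mul hΘ.cos).prodMk (hρ.mul hΘ.sin)
  have h2 := (hf (ρ t * Real.cos (Θ t), ρ t * Real.sin (Θ t))).hasFDerivAt.comp_hasDerivWithinAt t h1
  convert! h2 using 1
  simp only [polar, polarDeriv]
  rw [fderiv_apply_pair, fderiv_apply_pair f _ (_ + _), hfg]
  ring

/-- The difference quotient of `f` in the radial direction. -/
noncomputable def polarQuot (f : ℝ × ℝ → ℝ) (θ r h : ℝ) : ℝ :=
  ∫ s in (0 : ℝ)..1, polarDeriv f θ (r + s * h)

theorem contDiff_polarDeriv {f : ℝ × ℝ → ℝ} (hf : ContDiff ℝ 3 f) :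
    ContDiff ℝ 2 (fun p : ℝ × ℝ => polarDeriv f p.1 p.2) := by
  have h1 : ContDiff ℝ 2 (fderiv ℝ f) := hf.fderiv_right (by norm_num)
  unfold polarDeriv
  fun_prop

theorem continuous_polarDeriv {f : ℝ × ℝ → ℝ} (hf : ContDiff ℝ 3 f) (r : ℝ) :
    Continuous (fun θ => polarDeriv f θ r) :=
  (contDiff_polarDeriv hf).continuous.comp (Continuous.prodMk_left r)

theorem continuous_polar {f : ℝ × ℝ → ℝ} (hf : Continuous f) (r : ℝ) :
    Continuous (fun θ => polar f θ r) := by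
  unfold polar; fun_prop

theorem polarQuot_zero (f : ℝ × ℝ → ℝ) (θ r : ℝ) : polarQuot f θ r 0 = polarDeriv f θ r := by
  simp [polarQuot]

/-- Hadamard's formula: the difference quotient extends smoothly across h = 0, at the cost of one
derivative of f. -/
theorem polar_sub_polar {f : ℝ × ℝ → ℝ} (hf : ContDiff ℝ 3 f) (θ r h : ℝ) :
    polar f θ (r + h) - polar f θ r = h * polarQuot f θ r h := by
  have hd : Differentiable ℝ f := hf.differentiable (by norm_num)
  have hc := (contDiff_polarDeriv hf).continuous
  have hc' : Continuous fun s : ℝ => polarDeriv f θ (r + s * h) :=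
    hc.comp (f := fun s : ℝ => (θ, r + s * h)) (by fun_prop)
  have h1 := intervalIntegral.integral_eq_sub_of_hasDerivAt (a := 0) (b := 1)
    (f := fun s => polar f θ (r + s * h)) (f' := fun s => h * polarDeriv f θ (r + s * h))
    (fun s _ => by
      have h2 : HasDerivAt (fun s : ℝ => r + s * h) h s := by
        simpa using ((hasDerivAt_id s).mul_const h).const_add r
      have h3 := (hasDerivAt_polar_radius hd θ (r + s * h)).comp s h2
      rw [mul_comm]; exact h3)
    ((continuous_const.mul hc').intervalIntegrable _ _)
  rw [polarQuot, ← intervalIntegral.integral_const_mul, h1]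
  simp

theorem contDiff_polarQuot {f : ℝ × ℝ → ℝ} (hf : ContDiff ℝ 3 f) :
    ContDiff ℝ 2 (fun p : ℝ × ℝ × ℝ => polarQuot f p.1 p.2.1 p.2.2) := by
  have hH : ContDiff ℝ ((2 : ℕ) : WithTop ℕ∞) (fun q : (ℝ × ℝ × ℝ) × ℝ =>
      polarDeriv f q.1.1 (q.1.2.1 + q.2 * q.1.2.2)) := by
    have h1 : ContDiff ℝ ((2 : ℕ) : WithTop ℕ∞) (fun p : ℝ × ℝ => polarDeriv f p.1 p.2) := by
      exact_mod_cast contDiff_polarDeriv hf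
    exact h1.comp (f := fun q : (ℝ × ℝ × ℝ) × ℝ => (q.1.1, q.1.2.1 + q.2 * q.1.2.2)) (by fun_prop)
  exact_mod_cast contDiff_parametric_intervalIntegral 0 1 2 hH

/-! ### The fields in rescaled polar coordinates -/

/-- The coefficients of the perturbation in one of the half-spaces, which is directed along the
`x`-axis turned by the angle `α`. -/
structure HalfCoeffs where
  (c0 c1 c2 c3 α : ℝ)

namespace HalfCoeffs

variable (k : HalfCoeffs) (f g : ℝ × ℝ → ℝ)

/-- The size of the perturbation, up to the factor `ε`. -/
def pert (ε z : ℝ) : ℝ := k.c0 + k.c1 * z + ε * (k.c2 + k.c3 * z)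

/-- The radial component of the direction of the perturbation. -/
noncomputable def radial (θ : ℝ) : ℝ := Real.cos (θ - k.α)

/-- The angular component of the direction of the perturbation. -/
noncomputable def angular (θ : ℝ) : ℝ := -Real.sin (θ - k.α)

/-- The product of radius and angular speed at the point with polar coordinates `θ, r` and height
`polar f θ r + ε V`. -/
noncomputable def speed (ε θ r V : ℝ) : ℝ :=
  r + ε * k.angular θ * k.pert ε (polar f θ r + ε * V)

/-- The derivatives in `θ` of `R = (r - r₀) / ε`, `W = exp θ * (z - polar f θ r) / ε`, of the
quotient by `ε` of the increment of `R` with respect to `ε = 0`, and of the time. -/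
noncomputable def field (u : ℝ × (ℝ × ℝ) × (ℝ × ℝ)) : (ℝ × ℝ) × (ℝ × ℝ) :=
  let θ := u.1
  let r₀ := u.2.1.1
  let ε := u.2.1.2
  let R := u.2.2.1
  let V := Real.exp (-θ) * u.2.2.2
  let r := r₀ + ε * R
  let z := polar f θ r + ε * V
  let P := k.pert ε z
  let D := k.speed f ε θ r V
  ((k.radial θ * P * r / D,
    Real.exp θ * (ε * k.angular θ * P * V - (polar g θ r - polar f θ r) * k.angular θ * P
      - r * polarDeriv f θ r * k.radial θ * P) / D),
   -- Since r = D - ε · angular · P, the quotient r / D in R' equals 1 - ε · angular · P / D.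
   -- Together with `polarQuot` for the increment of f this carries out the division by ε
   -- explicitly, also at ε = 0.
   (k.radial θ * (k.c1 * R * polarQuot f θ r₀ (ε * R) + k.c1 * V + k.c2 + k.c3 * z
      - k.angular θ * P ^ 2 / D),
    r / D))

variable {f g}

theorem contDiff_speed (hf : ContDiff ℝ 2 f) :
    ContDiff ℝ 2 (fun u : ℝ × (ℝ × ℝ) × (ℝ × ℝ) =>
      k.speed f u.2.1.2 u.1 (u.2.1.1 + u.2.1.2 * u.2.2.1) (Real.exp (-u.1) * u.2.2.2)) := by
  unfold speed pert angular polar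
  fun_prop

/-- Order 2 is what remains of order 3: the field contains `polarDeriv` and `polarQuot`, each of
which costs one derivative of f. -/
theorem contDiffAt_field (hf : ContDiff ℝ 3 f) (hg : ContDiff ℝ 3 g)
    (u : ℝ × (ℝ × ℝ) × (ℝ × ℝ))
    (hD : k.speed f u.2.1.2 u.1 (u.2.1.1 + u.2.1.2 * u.2.2.1) (Real.exp (-u.1) * u.2.2.2) ≠ 0) :
    ContDiffAt ℝ 2 (k.field f g) u := by
  have hf2 : ContDiff ℝ 2 f := hf.of_le (by norm_num)
  have hg2 : ContDiff ℝ 2 g := hg.of_le (by norm_num)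
  have hs := (k.contDiff_speed hf2).contDiffAt (x := u)
  have hp : ContDiff ℝ 2 (fun u : ℝ × (ℝ × ℝ) × (ℝ × ℝ) =>
      polar f u.1 (u.2.1.1 + u.2.1.2 * u.2.2.1)) := by unfold polar; fun_prop
  have hq : ContDiff ℝ 2 (fun u : ℝ × (ℝ × ℝ) × (ℝ × ℝ) =>
      polar g u.1 (u.2.1.1 + u.2.1.2 * u.2.2.1)) := by unfold polar; fun_prop
  have hd : ContDiff ℝ 2 (fun u : ℝ × (ℝ × ℝ) × (ℝ × ℝ) =>
      polarDeriv f u.1 (u.2.1.1 + u.2.1.2 * u.2.2.1)) :=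
    (contDiff_polarDeriv hf).comp (f := fun u : ℝ × (ℝ × ℝ) × (ℝ × ℝ) =>
      (u.1, u.2.1.1 + u.2.1.2 * u.2.2.1)) (by fun_prop)
  have hQ : ContDiff ℝ 2 (fun u : ℝ × (ℝ × ℝ) × (ℝ × ℝ) =>
      polarQuot f u.1 u.2.1.1 (u.2.1.2 * u.2.2.1)) :=
    (contDiff_polarQuot hf).comp (f := fun u : ℝ × (ℝ × ℝ) × (ℝ × ℝ) =>
      (u.1, u.2.1.1, u.2.1.2 * u.2.2.1)) (by fun_prop)
  have hP : ContDiff ℝ 2 (fun u : ℝ × (ℝ × ℝ) × (ℝ × ℝ) => k.pert u.2.1.2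
      (polar f u.1 (u.2.1.1 + u.2.1.2 * u.2.2.1) + u.2.1.2 * (Real.exp (-u.1) * u.2.2.2))) := by
    unfold pert; fun_prop
  have hr : ContDiff ℝ 2 (fun u : ℝ × (ℝ × ℝ) × (ℝ × ℝ) => k.radial u.1) := by
    unfold radial; fun_prop
  have ha : ContDiff ℝ 2 (fun u : ℝ × (ℝ × ℝ) × (ℝ × ℝ) => k.angular u.1) := by
    unfold angular; fun_prop
  refine ContDiffAt.prodMk (ContDiffAt.prodMk ?_ ?_) (ContDiffAt.prodMk ?_ ?_)
  · exact ContDiffAt.div (by fun_prop) hs hD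
  · exact ContDiffAt.div (by fun_prop) hs hD
  · refine hr.contDiffAt.mul (ContDiffAt.sub (by fun_prop) ?_)
    exact ContDiffAt.div (by fun_prop) hs hD
  · exact ContDiffAt.div (by fun_prop) hs hD

/-- For ε = 0 both the radius and the speed equal r₀. On a compact box the radius moves by at most
M|ε| and the speed by at most K|ε|; both are below rs / 8 for e small. -/
theorem exists_speed_bounds (hf : ContDiff ℝ 3 f) {rs M : ℝ} (hrs : 0 < rs) (hM : 0 < M) :
    ∃ e > 0, ∀ u ∈ box rs M e, rs / 4 ≤ u.2.1.1 + u.2.1.2 * u.2.2.1 ∧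
      u.2.1.1 + u.2.1.2 * u.2.2.1 ≤ 2 * rs ∧
      (u.2.1.1 + u.2.1.2 * u.2.2.1) / 2 ≤
        k.speed f u.2.1.2 u.1 (u.2.1.1 + u.2.1.2 * u.2.2.1) (Real.exp (-u.1) * u.2.2.2) ∧
      k.speed f u.2.1.2 u.1 (u.2.1.1 + u.2.1.2 * u.2.2.1) (Real.exp (-u.1) * u.2.2.2) ≤
        2 * (u.2.1.1 + u.2.1.2 * u.2.2.1) := by
  have hf2 : ContDiff ℝ 2 f := hf.of_le (by norm_num)
  obtain ⟨K, hK, -, hl, -⟩ := exists_doubleDiff_bound (isCompact_box rs M 1)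
    (convex_box rs M 1) (fun u _ => (k.contDiff_speed hf2).contDiffAt)
  refine ⟨min 1 (rs / (8 * (K + M + 1))), lt_min one_pos (by positivity), fun u hu => ?_⟩
  obtain ⟨θ, ⟨r, ε⟩, R, W⟩ := u
  have hu1 := box_mono (min_le_left _ _) hu
  have h0 : (θ, (r, (0 : ℝ)), R, W) ∈ box rs M 1 := by
    obtain ⟨a, ⟨b, -⟩, c⟩ := hu
    exact ⟨a, ⟨b, by simp⟩, c⟩
  have h := hl _ hu1 _ h0
  obtain ⟨-, ⟨hr, hε⟩, hR, hW⟩ := hu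
  simp only [mem_Icc] at hr hε hR hW
  have hε' : |ε| ≤ rs / (8 * (K + M + 1)) :=
    (abs_le.2 ⟨hε.1, hε.2⟩).trans (min_le_right _ _)
  have hR' : |R| ≤ M := abs_le.2 hR
  rw [le_div_iff₀ (by positivity)] at hε'
  have hn : ‖((θ, (r, ε), R, W) : ℝ × (ℝ × ℝ) × (ℝ × ℝ)) - (θ, (r, 0), R, W)‖ ≤ |ε| := by
    rw [Prod.mk_sub_mk, Prod.mk_sub_mk, Prod.mk_sub_mk, sub_self, sub_self, sub_self, sub_zero]
    refine (norm_triple_le _ _ _).trans ?_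
    rw [norm_zero, norm_zero, zero_add, add_zero]
    refine (norm_pair_le _ _).trans ?_
    rw [norm_zero, zero_add, Real.norm_eq_abs]
  have hn' : K * ‖((θ, (r, ε), R, W) : ℝ × (ℝ × ℝ) × (ℝ × ℝ)) - (θ, (r, 0), R, W)‖ ≤ K * |ε| := by
    gcongr
  have h2 := h.trans hn'
  simp only [zero_mul, add_zero] at h2 ⊢
  have h3 : k.speed f 0 θ r (Real.exp (-θ) * W) = r := by simp [speed]
  rw [h3, Real.norm_eq_abs, abs_le] at h2
  have h4 : |ε * R| ≤ |ε| * M := by rw [abs_mul]; gcongr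
  have h5 : |ε| * M ≤ rs / 8 := by nlinarith [abs_nonneg ε]
  have h6 : K * |ε| ≤ rs / 8 := by nlinarith [abs_nonneg ε]
  have h7 := abs_le.1 (h4.trans h5)
  obtain ⟨h8, h9⟩ := h2
  refine ⟨?_, ?_, ?_, ?_⟩ <;> linarith [h7.1, h7.2]

/-- At ε = 0 the derivatives of R and W do not involve R and W, that of Q is affine in them, and
time runs like the angle. So this system is solved by successive integrations. -/
theorem field_zero_eq (k : HalfCoeffs) (f g : ℝ × ℝ → ℝ) {θ r : ℝ} (hr : r ≠ 0) (x : ℝ × ℝ) :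
    k.field f g (θ, (r, 0), x) =
      ((k.radial θ * (k.c0 + k.c1 * polar f θ r),
        Real.exp θ * (-((polar g θ r - polar f θ r) * k.angular θ / r
          * (k.c0 + k.c1 * polar f θ r))
          - polarDeriv f θ r * k.radial θ * (k.c0 + k.c1 * polar f θ r))),
       (k.radial θ * (k.c1 * x.1 * polarDeriv f θ r + k.c1 * (Real.exp (-θ) * x.2)
          + k.c2 + k.c3 * polar f θ r
          - k.angular θ / r * (k.c0 + k.c1 * polar f θ r) ^ 2), 1)) := by
  simp only [field, speed, pert, zero_mul, add_zero, polarQuot_zero]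
  ext <;> simp only <;> field_simp
  ring

/-- The pair of rates of R and W is independent of x at ε = 0, so a bound at x = 0 on a compact set
holds for all x. This is the constant k of `exists_flow`. -/
theorem exists_field_zero_bound (hf : ContDiff ℝ 3 f) (hg : ContDiff ℝ 3 g) {rs : ℝ}
    (hrs : 0 < rs) :
    ∃ K, 0 ≤ K ∧ ∀ θ ∈ Icc 0 (2 * Real.pi), ∀ r ∈ Icc (rs / 2) (3 * rs / 2), ∀ x,
      ‖(k.field f g (θ, (r, 0), x)).1‖ ≤ K := by
  have hco : ContinuousOn (k.field f g) (box rs 1 0) := by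
    intro u hu
    refine (k.contDiffAt_field hf hg u ?_).continuousAt.continuousWithinAt
    obtain ⟨θ, ⟨r, ε⟩, R, W⟩ := u
    obtain ⟨-, ⟨hr, hε⟩, -⟩ := hu
    simp only [neg_zero, Icc_self, mem_singleton_iff] at hε
    simp only [speed, hε, zero_mul, add_zero]
    have := hr.1
    simp only at this
    linarith
  obtain ⟨K, hK⟩ := (isCompact_box rs 1 0).exists_bound_of_continuousOn hco
  refine ⟨max 0 K, le_max_left _ _, fun θ hθ r hr x => ?_⟩
  have hr0 : r ≠ 0 := by have := hr.1; linarith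
  have e : (k.field f g (θ, (r, 0), x)).1 = (k.field f g (θ, (r, 0), (0, 0))).1 := by
    rw [field_zero_eq k f g hr0, field_zero_eq k f g hr0]
  rw [e]
  exact ((norm_fst_le _).trans (hK _ ⟨hθ, ⟨hr, by simp⟩, by simp⟩)).trans (le_max_right _ _)

end HalfCoeffs

/-- The coefficients for `y > 0`. -/
noncomputable def Coeffs.upper (c : Coeffs) : HalfCoeffs := ⟨c.a0, c.a1, c.a2, c.a3, 0⟩

/-- The coefficients for `y < 0`. -/
noncomputable def Coeffs.lower (c : Coeffs) : HalfCoeffs := ⟨0, c.b1, c.b2, c.b3, Real.pi / 2⟩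

/-! ### The bifurcation functions and the equation for `ε = 0` -/

theorem hasDerivWithinAt_fst {E F : Type*} [NormedAddCommGroup E] [NormedSpace ℝ E]
    [NormedAddCommGroup F] [NormedSpace ℝ F] {X : ℝ → E × F} {X' : E × F} {s : Set ℝ} {t : ℝ}
    (h : HasDerivWithinAt X X' s t) : HasDerivWithinAt (fun t => (X t).1) X'.1 s t :=
  (ContinuousLinearMap.fst ℝ E F).hasFDerivAt.comp_hasDerivWithinAt t h

theorem hasDerivWithinAt_snd {E F : Type*} [NormedAddCommGroup E] [NormedSpace ℝ E]
    [NormedAddCommGroup F] [NormedSpace ℝ F] {X : ℝ → E × F} {X' : E × F} {s : Set ℝ} {t : ℝ}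
    (h : HasDerivWithinAt X X' s t) : HasDerivWithinAt (fun t => (X t).2) X'.2 s t :=
  (ContinuousLinearMap.snd ℝ E F).hasFDerivAt.comp_hasDerivWithinAt t h

theorem eq_add_integral_of_hasDerivWithinAt {y y' : ℝ → ℝ} {a b : ℝ}
    (hd : ∀ t ∈ Icc a b, HasDerivWithinAt y (y' t) (Icc a b) t) (hc : ContinuousOn y' (Icc a b))
    {t : ℝ} (ht : t ∈ Icc a b) : y t = y a + ∫ s in a..t, y' s := by
  have hsub : Icc a t ⊆ Icc a b := Icc_subset_Icc_right ht.2
  have h := intervalIntegral.integral_eq_sub_of_hasDeriv_right_of_le ht.1 (f := y) (f' := y')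
    (fun s hs => (hd s (hsub hs)).continuousWithinAt.mono hsub)
    (fun s hs => (hasDerivWithinAt_Icc_Ici (hd s (hsub (Ioo_subset_Icc_self hs))) hs.1.le
      (hs.2.trans_le ht.2)).mono Ioi_subset_Ici_self)
    ((hc.mono hsub).intervalIntegrable_of_Icc ht.1)
  rw [h]; ring

theorem zbar_zero_eq {f g : ℝ × ℝ → ℝ} (hf : Differentiable ℝ f) (hg : Continuous g)
    (hfg : IsRotationPrimitive f g) (θ r : ℝ) :
    zbar g θ r 0 = polar f θ r - Real.exp (-θ) * polar f 0 r := by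
  have hc := continuous_polar hg r
  have h := intervalIntegral.integral_eq_sub_of_hasDerivAt (a := 0) (b := θ)
    (f := fun s => Real.exp s * polar f s r) (f' := fun s => Real.exp s * polar g s r)
    (fun s _ => by
      have := (Real.hasDerivAt_exp s).mul (hasDerivAt_polar_angle hf hfg r s)
      convert! this using 1
      ring) ((by fun_prop : Continuous _).intervalIntegrable _ _)
  rw [zbar, h, zero_add, mul_sub, ← mul_assoc, ← Real.exp_add]
  simp

/-- This splits `G` into the radial derivative of f, which the equation for Q contains, and
multiples of `polarDeriv f 0 r`. The latter cancel in `f₂upper` and `f₂lower`, and in `f₂mid` when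
f₁ = 0. -/
theorem G_eq {f g : ℝ × ℝ → ℝ} (hf : Differentiable ℝ f) (hg : Continuous g)
    (hfg : IsRotationPrimitive f g) (θ r : ℝ) :
    G g θ r = polarDeriv f θ r - Real.exp (-θ) * polarDeriv f 0 r := by
  have e : (fun ρ => zbar g θ ρ 0) = fun ρ => polar f θ ρ - Real.exp (-θ) * polar f 0 ρ :=
    funext fun ρ => zbar_zero_eq hf hg hfg θ ρ
  rw [G, e]
  exact ((hasDerivAt_polar_radius hf θ r).sub
    ((hasDerivAt_polar_radius hf 0 r).const_mul _)).deriv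

/-- This integral and the next one give the effect on Q of an initial height V, which decays like
e^{-θ}; they are the ingredients of `kappa`. -/
theorem integral_cos_mul_exp_neg :
    ∫ s in (0 : ℝ)..Real.pi, Real.cos s * Real.exp (-s) = (1 + Real.exp (-Real.pi)) / 2 := by
  have h := intervalIntegral.integral_eq_sub_of_hasDerivAt (a := 0) (b := Real.pi)
    (f := fun s => Real.exp (-s) * (Real.sin s - Real.cos s) / 2)
    (f' := fun s => Real.cos s * Real.exp (-s))
    (fun s _ => by
      have h1 : HasDerivAt (fun s : ℝ => Real.exp (-s)) (Real.exp (-s) * (-1)) s :=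
        (hasDerivAt_neg s).exp
      have := (h1.mul ((Real.hasDerivAt_sin s).sub (Real.hasDerivAt_cos s))).div_const 2
      convert! this using 1
      simp only [Pi.sub_apply]
      ring) ((by fun_prop : Continuous _).intervalIntegrable _ _)
  rw [h]; simp; ring

theorem integral_sin_mul_exp_neg :
    ∫ s in Real.pi..(2 * Real.pi), Real.sin s * Real.exp (-s) =
      -(Real.exp (-(2 * Real.pi)) + Real.exp (-Real.pi)) / 2 := by
  have h := intervalIntegral.integral_eq_sub_of_hasDerivAt (a := Real.pi) (b := 2 * Real.pi)
    (f := fun s => -(Real.exp (-s) * (Real.sin s + Real.cos s)) / 2)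
    (f' := fun s => Real.sin s * Real.exp (-s))
    (fun s _ => by
      have h1 : HasDerivAt (fun s : ℝ => Real.exp (-s)) (Real.exp (-s) * (-1)) s :=
        (hasDerivAt_neg s).exp
      have := (h1.mul ((Real.hasDerivAt_sin s).add (Real.hasDerivAt_cos s))).neg.div_const 2
      convert! this using 1
      simp only [Pi.add_apply]
      ring) ((by fun_prop : Continuous _).intervalIntegrable _ _)
  rw [h]; simp; ring

theorem Coeffs.upper_radial (c : Coeffs) (θ : ℝ) : c.upper.radial θ = Real.cos θ := by
  simp [HalfCoeffs.radial, Coeffs.upper]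

theorem Coeffs.upper_angular (c : Coeffs) (θ : ℝ) : c.upper.angular θ = -Real.sin θ := by
  simp [HalfCoeffs.angular, Coeffs.upper]

theorem Coeffs.lower_radial (c : Coeffs) (θ : ℝ) : c.lower.radial θ = Real.sin θ := by
  simp [HalfCoeffs.radial, Coeffs.lower, Real.cos_sub_pi_div_two]

theorem Coeffs.lower_angular (c : Coeffs) (θ : ℝ) : c.lower.angular θ = Real.cos θ := by
  simp [HalfCoeffs.angular, Coeffs.lower, Real.sin_sub_pi_div_two]

/-- The derivative of `W` for `ε = 0`, in `y > 0`. -/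
noncomputable def dispUpper (c : Coeffs) (f g : ℝ × ℝ → ℝ) (r s : ℝ) : ℝ :=
  Real.exp s * ((polar g s r - polar f s r) * Real.sin s / r
    - polarDeriv f s r * Real.cos s) * (c.a0 + c.a1 * polar f s r)

/-- The derivative of `W` for `ε = 0`, in `y < 0`. -/
noncomputable def dispLower (c : Coeffs) (f g : ℝ × ℝ → ℝ) (r s : ℝ) : ℝ :=
  Real.exp s * (-((polar g s r - polar f s r) * Real.cos s / r)
    - polarDeriv f s r * Real.sin s) * (c.b1 * polar f s r)

/-- The increment of `W` on `[0, 2π]` for `ε = 0`. -/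
noncomputable def disp (c : Coeffs) (f g : ℝ × ℝ → ℝ) (r : ℝ) : ℝ :=
  (∫ s in (0 : ℝ)..Real.pi, dispUpper c f g r s)
    + ∫ s in Real.pi..(2 * Real.pi), dispLower c f g r s

/-- The derivative of the second-order displacement in `r` with respect to `V`. -/
noncomputable def kappa (c : Coeffs) : ℝ :=
  c.a1 * ((1 + Real.exp (-Real.pi)) / 2)
    + c.b1 * (-(Real.exp (-(2 * Real.pi)) + Real.exp (-Real.pi)) / 2)

theorem continuous_dispUpper {c : Coeffs} {f g : ℝ × ℝ → ℝ} (hf : ContDiff ℝ 3 f)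
    (hg : ContDiff ℝ 3 g)
    (r : ℝ) : Continuous (dispUpper c f g r) := by
  have h1 := continuous_polar hf.continuous r
  have h2 := continuous_polar hg.continuous r
  have h3 := continuous_polarDeriv hf r
  unfold dispUpper
  fun_prop

theorem continuous_dispLower {c : Coeffs} {f g : ℝ × ℝ → ℝ} (hf : ContDiff ℝ 3 f)
    (hg : ContDiff ℝ 3 g)
    (r : ℝ) : Continuous (dispLower c f g r) := by
  have h1 := continuous_polar hf.continuous r
  have h2 := continuous_polar hg.continuous r
  have h3 := continuous_polarDeriv hf r
  unfold dispLower
  fun_prop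

theorem continuous_G {f g : ℝ × ℝ → ℝ} (hf : ContDiff ℝ 3 f) (hg : ContDiff ℝ 3 g)
    (hfg : IsRotationPrimitive f g)
    (r : ℝ) : Continuous (fun θ => G g θ r) := by
  have h3 := continuous_polarDeriv hf r
  rw [funext fun θ => G_eq (hf.differentiable (by norm_num)) hg.continuous hfg θ r]
  fun_prop

/-- After `G_eq` the integrand is minus the rate of W, minus `polarDeriv f 0 r` times the rate of R.
-/
theorem integral_upper_eq {c : Coeffs} {f g : ℝ × ℝ → ℝ} (hf : ContDiff ℝ 3 f)
    (hg : ContDiff ℝ 3 g) (hfg : IsRotationPrimitive f g)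
    (r s : ℝ) :
    ∫ φ in (0 : ℝ)..s, Real.exp φ * (c.a0 + c.a1 * polar f φ r) *
            (Real.cos φ * G g φ r + Real.sin φ / r * (polar f φ r - polar g φ r)) =
      -(∫ φ in (0 : ℝ)..s, dispUpper c f g r φ)
        - polarDeriv f 0 r * ∫ φ in (0 : ℝ)..s, Real.cos φ * (c.a0 + c.a1 * polar f φ r) := by
  have h1 := continuous_polar hf.continuous r
  have h4 := continuous_dispUpper (c := c) hf hg r
  rw [← intervalIntegral.integral_const_mul, ← intervalIntegral.integral_neg,
    ← intervalIntegral.integral_sub ((by fun_prop : Continuous _).intervalIntegrable _ _)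
      ((by fun_prop : Continuous _).intervalIntegrable _ _)]
  congr 1
  ext φ
  rw [G_eq (hf.differentiable (by norm_num)) hg.continuous hfg, dispUpper, Real.exp_neg]
  have := (Real.exp_pos φ).ne'
  field_simp
  ring

theorem integral_lower_eq {c : Coeffs} {f g : ℝ × ℝ → ℝ} (hf : ContDiff ℝ 3 f)
    (hg : ContDiff ℝ 3 g) (hfg : IsRotationPrimitive f g)
    (r s : ℝ) :
    c.b1 * ∫ φ in Real.pi..s, Real.exp φ * polar f φ r *
            (Real.cos φ / r * (polar f φ r - polar g φ r) - G g φ r * Real.sin φ) =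
      (∫ φ in Real.pi..s, dispLower c f g r φ)
        + polarDeriv f 0 r * (c.b1 * ∫ φ in Real.pi..s, Real.sin φ * polar f φ r) := by
  have h1 := continuous_polar hf.continuous r
  have h4 := continuous_dispLower (c := c) hf hg r
  rw [← intervalIntegral.integral_const_mul, ← intervalIntegral.integral_const_mul,
    ← intervalIntegral.integral_const_mul,
    ← intervalIntegral.integral_add ((by fun_prop : Continuous _).intervalIntegrable _ _)
      ((by fun_prop : Continuous _).intervalIntegrable _ _)]
  congr 1
  ext φ
  rw [G_eq (hf.differentiable (by norm_num)) hg.continuous hfg, dispLower, Real.exp_neg]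
  have := (Real.exp_pos φ).ne'
  field_simp
  ring

/-- The left side is R(2π) for ε = 0; a0 drops out because cos has integral 0 over [0, π]. -/
theorem first_order_eq {c : Coeffs} {f : ℝ × ℝ → ℝ} (hf : ContDiff ℝ 3 f)
    (r : ℝ) :
    (∫ φ in (0 : ℝ)..Real.pi, Real.cos φ * (c.a0 + c.a1 * polar f φ r))
      + c.b1 * (∫ φ in Real.pi..(2 * Real.pi), Real.sin φ * polar f φ r) = f₁ c f r := by
  have h1 := continuous_polar hf.continuous r
  have e1 : (∫ φ in (0 : ℝ)..Real.pi, Real.cos φ * (c.a0 + c.a1 * polar f φ r)) =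
      c.a1 * ∫ φ in (0 : ℝ)..Real.pi, polar f φ r * Real.cos φ := by
    have e : (fun φ => Real.cos φ * (c.a0 + c.a1 * polar f φ r)) =
        fun φ => c.a0 * Real.cos φ + c.a1 * (polar f φ r * Real.cos φ) := by
      ext φ; ring
    rw [e, intervalIntegral.integral_add ((by fun_prop : Continuous _).intervalIntegrable _ _)
      ((by fun_prop : Continuous _).intervalIntegrable _ _), intervalIntegral.integral_const_mul,
      intervalIntegral.integral_const_mul, integral_cos]
    simp
  rw [f₁, e1]
  simp only [mul_comm (Real.sin _)]

/-- For ε = 0 the height returns to itself when e^{-2π} (V + disp) = V, that is V = disp / (e^{2π} -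
1), and `f₂mid` is the contribution κV of this height to Q(2π). -/
theorem f₂mid_eq {c : Coeffs} {f g : ℝ × ℝ → ℝ} (hf : ContDiff ℝ 3 f)
    (hg : ContDiff ℝ 3 g) (hfg : IsRotationPrimitive f g)
    (hf₁ : f₁ c f r = 0) :
    f₂mid c f g r = kappa c * (disp c f g r / (Real.exp (2 * Real.pi) - 1)) := by
  have h1 := continuous_polar hf.continuous r
  have h2 := continuous_polar hg.continuous r
  have hG := continuous_G hf hg hfg r
  have e1 : (∫ φ in (0 : ℝ)..Real.pi,
          Real.exp φ * G g φ r * Real.cos φ * (c.a0 + c.a1 * polar f φ r))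
      - (∫ φ in (0 : ℝ)..Real.pi, Real.exp φ * Real.sin φ / r * (c.a0 + c.a1 * polar f φ r) *
          (polar g φ r - polar f φ r)) =
      ∫ φ in (0 : ℝ)..Real.pi, Real.exp φ * (c.a0 + c.a1 * polar f φ r) *
            (Real.cos φ * G g φ r + Real.sin φ / r * (polar f φ r - polar g φ r)) := by
    rw [← intervalIntegral.integral_sub ((by fun_prop : Continuous _).intervalIntegrable _ _)
      ((by fun_prop : Continuous _).intervalIntegrable _ _)]
    congr 1
    ext φ
    ring
  have e2 : c.b1 * (∫ φ in Real.pi..(2 * Real.pi),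
          Real.exp φ * G g φ r * Real.sin φ * polar f φ r)
      + c.b1 / r * (∫ φ in Real.pi..(2 * Real.pi), Real.exp φ * Real.cos φ * polar f φ r *
          (polar g φ r - polar f φ r)) =
      -(c.b1 * ∫ φ in Real.pi..(2 * Real.pi), Real.exp φ * polar f φ r *
            (Real.cos φ / r * (polar f φ r - polar g φ r) - G g φ r * Real.sin φ)) := by
    rw [← intervalIntegral.integral_const_mul, ← intervalIntegral.integral_const_mul,
      ← intervalIntegral.integral_const_mul, ← intervalIntegral.integral_neg,
      ← intervalIntegral.integral_add ((by fun_prop : Continuous _).intervalIntegrable _ _)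
      ((by fun_prop : Continuous _).intervalIntegrable _ _)]
    congr 1
    ext φ
    ring
  have e3 := first_order_eq (c := c) hf r
  rw [hf₁] at e3
  rw [f₂mid, add_assoc, e1, e2, integral_upper_eq hf hg hfg, integral_lower_eq hf hg hfg]
  have e4 : ∀ A B A' B' h : ℝ, A' + B' = 0 → -A - h * A' + -(B + h * B') = -(A + B) := by
    intro A B A' B' h h0
    linear_combination -h * h0
  rw [e4 _ _ _ _ _ e3, ← disp, kappa]
  have hE : Real.exp (2 * Real.pi) = Real.exp Real.pi ^ 2 := by
    rw [← Real.exp_nat_mul]; norm_num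
  have h5 : (1 : ℝ) < Real.exp Real.pi := Real.one_lt_exp_iff.2 Real.pi_pos
  rw [neg_mul 2 Real.pi, Real.exp_neg, Real.exp_neg, hE]
  have h6 : Real.exp Real.pi ^ 2 - 1 ≠ 0 := by nlinarith
  have h7 : 1 - Real.exp Real.pi ^ 2 ≠ 0 := by nlinarith
  have h8 : Real.exp Real.pi ≠ 0 := by positivity
  field_simp
  ring

/-- The values at `θ = 2π` of the solution for `ε = 0`. -/
theorem solution_zero_eval {c : Coeffs} {f g : ℝ × ℝ → ℝ} (hf : ContDiff ℝ 3 f)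
    (hg : ContDiff ℝ 3 g) (hfg : IsRotationPrimitive f g)
    {r V : ℝ} (hr : 0 < r) (hf₁ : f₁ c f r = 0)
    {X : ℝ → (ℝ × ℝ) × (ℝ × ℝ)} (hX0 : X 0 = ((0, V), (0, 0)))
    (hX : IsTwoPieceSolution (flowField (c.upper.field f g) r 0)
      (flowField (c.lower.field f g) r 0) X) :
    (X (2 * Real.pi)).1.1 = 0 ∧ (X (2 * Real.pi)).1.2 = V + disp c f g r ∧
    (X (2 * Real.pi)).2.1 = f₂ c f g r
      + kappa c * (V - disp c f g r / (Real.exp (2 * Real.pi) - 1)) ∧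
    ∀ θ ∈ Icc 0 (2 * Real.pi), (X θ).2.2 = θ := by
  have hpi := Real.pi_pos
  have h1 := continuous_polar hf.continuous r
  have h2 := continuous_polar hg.continuous r
  have h3 := continuous_polarDeriv hf r
  have hU := continuous_dispUpper (c := c) hf hg r
  have hL := continuous_dispLower (c := c) hf hg r
  have mL : Real.pi ∈ Icc 0 Real.pi := ⟨hpi.le, le_rfl⟩
  have mR : 2 * Real.pi ∈ Icc Real.pi (2 * Real.pi) := ⟨by linarith, le_rfl⟩
  -- the two fields
  have fU : ∀ θ, flowField (c.upper.field f g) r 0 θ (X θ) =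
      ((Real.cos θ * (c.a0 + c.a1 * polar f θ r), dispUpper c f g r θ),
       (Real.cos θ * (c.a1 * (X θ).1.1 * polarDeriv f θ r + c.a1 * (Real.exp (-θ) * (X θ).1.2)
          + c.a2 + c.a3 * polar f θ r
          + Real.sin θ / r * (c.a0 + c.a1 * polar f θ r) ^ 2), 1)) := by
    intro θ
    rw [flowField, HalfCoeffs.field_zero_eq _ _ _ hr.ne', Coeffs.upper_radial,
      Coeffs.upper_angular]
    simp only [Coeffs.upper, dispUpper]
    ext <;> simp only
    · ring
    · ring
  have fL : ∀ θ, flowField (c.lower.field f g) r 0 θ (X θ) =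
      ((c.b1 * (Real.sin θ * polar f θ r), dispLower c f g r θ),
       (Real.sin θ * (c.b1 * (X θ).1.1 * polarDeriv f θ r + c.b1 * (Real.exp (-θ) * (X θ).1.2)
          + c.b2 + c.b3 * polar f θ r
          - Real.cos θ / r * (c.b1 * polar f θ r) ^ 2), 1)) := by
    intro θ
    rw [flowField, HalfCoeffs.field_zero_eq _ _ _ hr.ne', Coeffs.lower_radial,
      Coeffs.lower_angular]
    simp only [Coeffs.lower, dispLower, zero_add]
    ext <;> simp only
    · ring
    · ring
  have dU : ∀ t ∈ Icc 0 Real.pi, HasDerivWithinAt X _ (Icc 0 Real.pi) t := fun t ht =>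
    (fU t) ▸ hX.left t ht
  have dL : ∀ t ∈ Icc Real.pi (2 * Real.pi),
      HasDerivWithinAt X _ (Icc Real.pi (2 * Real.pi)) t := fun t ht => (fL t) ▸ hX.right t ht
  have cX := hX.continuousOn
  have cX1 : ContinuousOn X (Icc 0 Real.pi) := cX.mono (Icc_subset_Icc_right (by linarith))
  have cX2 : ContinuousOn X (Icc Real.pi (2 * Real.pi)) := cX.mono (Icc_subset_Icc_left hpi.le)
  -- the component `R`
  have RU : ∀ t ∈ Icc 0 Real.pi, (X t).1.1 =
      ∫ φ in (0 : ℝ)..t, Real.cos φ * (c.a0 + c.a1 * polar f φ r) := by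
    intro t ht
    have := eq_add_integral_of_hasDerivWithinAt (y := fun t => (X t).1.1)
      (y' := fun φ => Real.cos φ * (c.a0 + c.a1 * polar f φ r))
      (fun t ht => hasDerivWithinAt_fst (hasDerivWithinAt_fst (dU t ht)))
      (by fun_prop) ht
    simpa [hX0] using this
  have RL : ∀ t ∈ Icc Real.pi (2 * Real.pi), (X t).1.1 =
      (∫ φ in (0 : ℝ)..Real.pi, Real.cos φ * (c.a0 + c.a1 * polar f φ r))
        + c.b1 * ∫ φ in Real.pi..t, Real.sin φ * polar f φ r := by
    intro t ht
    have := eq_add_integral_of_hasDerivWithinAt (y := fun t => (X t).1.1)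
      (y' := fun φ => c.b1 * (Real.sin φ * polar f φ r))
      (fun t ht => hasDerivWithinAt_fst (hasDerivWithinAt_fst (dL t ht)))
      (by fun_prop) ht
    rw [intervalIntegral.integral_const_mul] at this
    rw [this, RU _ mL]
  -- the component `W`
  have WU : ∀ t ∈ Icc 0 Real.pi, (X t).1.2 = V + ∫ φ in (0 : ℝ)..t, dispUpper c f g r φ := by
    intro t ht
    have := eq_add_integral_of_hasDerivWithinAt (y := fun t => (X t).1.2)
      (y' := dispUpper c f g r)
      (fun t ht => hasDerivWithinAt_snd (hasDerivWithinAt_fst (dU t ht)))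
      (by fun_prop) ht
    simpa [hX0] using this
  have WL : ∀ t ∈ Icc Real.pi (2 * Real.pi), (X t).1.2 =
      V + (∫ φ in (0 : ℝ)..Real.pi, dispUpper c f g r φ)
        + ∫ φ in Real.pi..t, dispLower c f g r φ := by
    intro t ht
    have := eq_add_integral_of_hasDerivWithinAt (y := fun t => (X t).1.2)
      (y' := dispLower c f g r)
      (fun t ht => hasDerivWithinAt_snd (hasDerivWithinAt_fst (dL t ht)))
      (by fun_prop) ht
    rw [this, WU _ mL]
  -- the component `Q`
  have QU := eq_add_integral_of_hasDerivWithinAt (y := fun t => (X t).2.1)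
      (y' := fun θ => Real.cos θ * (c.a1 * (X θ).1.1 * polarDeriv f θ r
          + c.a1 * (Real.exp (-θ) * (X θ).1.2) + c.a2 + c.a3 * polar f θ r
          + Real.sin θ / r * (c.a0 + c.a1 * polar f θ r) ^ 2))
      (fun t ht => hasDerivWithinAt_fst (hasDerivWithinAt_snd (dU t ht)))
      (by fun_prop) mL
  have QL := eq_add_integral_of_hasDerivWithinAt (y := fun t => (X t).2.1)
      (y' := fun θ => Real.sin θ * (c.b1 * (X θ).1.1 * polarDeriv f θ r
          + c.b1 * (Real.exp (-θ) * (X θ).1.2) + c.b2 + c.b3 * polar f θ r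
          - Real.cos θ / r * (c.b1 * polar f θ r) ^ 2))
      (fun t ht => hasDerivWithinAt_fst (hasDerivWithinAt_snd (dL t ht)))
      (by fun_prop) mR
  -- With W = V + ∫ dispUpper, the constant V gives the linear term. The rest is the integrand of
  -- `f₂upper`, since the terms with `polarDeriv f 0 r` coming from G and from `integral_upper_eq`
  -- cancel.
  have QU' : (∫ θ in (0 : ℝ)..Real.pi, Real.cos θ * (c.a1 * (X θ).1.1 * polarDeriv f θ r
          + c.a1 * (Real.exp (-θ) * (X θ).1.2) + c.a2 + c.a3 * polar f θ r
          + Real.sin θ / r * (c.a0 + c.a1 * polar f θ r) ^ 2)) =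
      f₂upper c f g r + V * (c.a1 * ((1 + Real.exp (-Real.pi)) / 2)) := by
    rw [← integral_cos_mul_exp_neg, ← intervalIntegral.integral_const_mul,
      ← intervalIntegral.integral_const_mul, f₂upper, ← sub_eq_iff_eq_add,
      ← intervalIntegral.integral_sub]
    · refine intervalIntegral.integral_congr fun s hs => ?_
      rw [uIcc_of_le hpi.le] at hs
      rw [integral_upper_eq hf hg hfg, RU s hs, WU s hs,
        G_eq (hf.differentiable (by norm_num)) hg.continuous hfg]
      ring
    · refine ContinuousOn.intervalIntegrable_of_Icc hpi.le ?_
      fun_prop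
    · exact (by fun_prop : Continuous _).intervalIntegrable _ _
  have QL' : (∫ θ in Real.pi..(2 * Real.pi), Real.sin θ * (c.b1 * (X θ).1.1 * polarDeriv f θ r
          + c.b1 * (Real.exp (-θ) * (X θ).1.2) + c.b2 + c.b3 * polar f θ r
          - Real.cos θ / r * (c.b1 * polar f θ r) ^ 2)) =
      f₂lower c f g r
        + V * (c.b1 * (-(Real.exp (-(2 * Real.pi)) + Real.exp (-Real.pi)) / 2)) := by
    rw [← integral_sin_mul_exp_neg, ← intervalIntegral.integral_const_mul,
      ← intervalIntegral.integral_const_mul, f₂lower, ← sub_eq_iff_eq_add,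
      ← intervalIntegral.integral_sub]
    · refine intervalIntegral.integral_congr fun s hs => ?_
      rw [uIcc_of_le (by linarith)] at hs
      have e : (∫ φ in (0 : ℝ)..Real.pi, Real.exp φ * (c.a0 + c.a1 * polar f φ r) *
              (-Real.cos φ * G g φ r + Real.sin φ / r * (polar g φ r - polar f φ r))) =
          -∫ φ in (0 : ℝ)..Real.pi, Real.exp φ * (c.a0 + c.a1 * polar f φ r) *
            (Real.cos φ * G g φ r + Real.sin φ / r * (polar f φ r - polar g φ r)) := by
        rw [← intervalIntegral.integral_neg]
        congr 1
        ext φ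
        ring
      rw [e, integral_upper_eq hf hg hfg, integral_lower_eq hf hg hfg, RL s hs, WL s hs,
        G_eq (hf.differentiable (by norm_num)) hg.continuous hfg]
      ring
    · refine ContinuousOn.intervalIntegrable_of_Icc (by linarith) ?_
      fun_prop
    · exact (by fun_prop : Continuous _).intervalIntegrable _ _
  -- the component `τ`
  have TU : ∀ t ∈ Icc 0 Real.pi, (X t).2.2 = t := by
    intro t ht
    have := eq_add_integral_of_hasDerivWithinAt (y := fun t => (X t).2.2) (y' := fun _ => 1)
      (fun t ht => hasDerivWithinAt_snd (hasDerivWithinAt_snd (dU t ht)))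
      (by fun_prop) ht
    simpa [hX0] using this
  have TL : ∀ t ∈ Icc Real.pi (2 * Real.pi), (X t).2.2 = t := by
    intro t ht
    have := eq_add_integral_of_hasDerivWithinAt (y := fun t => (X t).2.2) (y' := fun _ => 1)
      (fun t ht => hasDerivWithinAt_snd (hasDerivWithinAt_snd (dL t ht)))
      (by fun_prop) ht
    simpa [TU _ mL] using this
  refine ⟨?_, ?_, ?_, ?_⟩
  · rw [RL _ mR, first_order_eq hf r, hf₁]
  · rw [WL _ mR, add_assoc, ← disp]
  · rw [QL, QU, hX0, QL', QU', f₂, f₂mid_eq hf hg hfg hf₁, kappa]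
    ring
  · intro θ hθ
    rcases le_total θ Real.pi with h | h
    · exact TU θ ⟨hθ.1, h⟩
    · exact TL θ ⟨h, hθ.2⟩

/-! ### Fixed points and periodic points of the return map -/

theorem exists_max_abs_of_periodic {ρ : ℕ → ℝ} {n : ℕ} (hn : 0 < n)
    (hρ : ∀ k, ρ (k + n) = ρ k) : ∃ j, ∀ k, |ρ k| ≤ |ρ j| := by
  obtain ⟨j, -, hj⟩ := Finset.exists_max_image (Finset.range n) (fun k => |ρ k|)
    ⟨0, Finset.mem_range.2 hn⟩
  refine ⟨j, fun k => ?_⟩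
  have h : Function.Periodic ρ n := hρ
  rw [← h.map_mod_nat k]
  exact hj _ (Finset.mem_range.2 (Nat.mod_lt _ hn))

/-- On a periodic orbit the maxima A of |ρ| and B of |μ| are attained. The contraction of μ gives B
≤ qA, so ρ is multiplied by 1 + ac up to an error of at most a|c|A / 2. Neither a contraction nor an
expansion of ρ is compatible with periodicity unless A = 0. -/
theorem periodic_eq_zero {ρ μ : ℕ → ℝ} {n : ℕ} (hn : 0 < n) (hρ : ∀ k, ρ (k + n) = ρ k)
    (hμ : ∀ k, μ (k + n) = μ k) {a l d c K q : ℝ} (ha : 0 < a) (hl : 0 ≤ l) (hd : 0 ≤ d)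
    (hK : 0 ≤ K) (hc : c ≠ 0)
    (h1 : ∀ k, |μ (k + 1)| ≤ l * |μ k| + d * (|ρ k| + |μ k|))
    (h2 : ∀ k, |ρ (k + 1) - (1 + a * c) * ρ k| ≤ a * (|c| / 4 * |ρ k| + K * |μ k|))
    (hld : l + d < 1) (hq : d ≤ q * (1 - l - d)) (hKq : K * q ≤ |c| / 4) (hac : a * |c| ≤ 1)
    (k : ℕ) : ρ k = 0 ∧ μ k = 0 := by
  obtain ⟨i, hi⟩ := exists_max_abs_of_periodic hn hρ
  obtain ⟨j, hj⟩ := exists_max_abs_of_periodic hn hμ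
  set A := |ρ i| with hA
  set B := |μ j| with hB
  have hA0 : 0 ≤ A := abs_nonneg _
  have hB0 : 0 ≤ B := abs_nonneg _
  have hcp : 0 < |c| := abs_pos.2 hc
  have pred : ∀ (σ : ℕ → ℝ), (∀ k, σ (k + n) = σ k) → ∀ j, ∃ j', σ (j' + 1) = σ j := by
    intro σ hσ j
    refine ⟨j + n - 1, ?_⟩
    rw [Nat.sub_add_cancel (by omega), hσ]
  have hBA : B ≤ q * A := by
    obtain ⟨j', hj'⟩ := pred μ hμ j
    have h := h1 j'
    rw [hj', ← hB] at h
    have h3 : B ≤ l * B + d * (A + B) := by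
      refine h.trans ?_
      gcongr
      · exact hj j'
      · exact hi j'
      · exact hj j'
    have h4 : (1 - l - d) * B ≤ (1 - l - d) * (q * A) := by nlinarith
    exact le_of_mul_le_mul_left h4 (by linarith)
  have h3 : ∀ k, |ρ (k + 1) - (1 + a * c) * ρ k| ≤ a * (|c| / 2 * A) := by
    intro k
    refine (h2 k).trans ?_
    gcongr
    have h5 : |c| / 4 * |ρ k| ≤ |c| / 4 * A := by gcongr; exact hi k
    have h6 : K * |μ k| ≤ K * (q * A) := by gcongr; exact (hj k).trans hBA
    have h7 : K * (q * A) ≤ |c| / 4 * A := by rw [← mul_assoc]; gcongr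
    linarith
  have hAz : A = 0 := by
    by_contra hne
    have hAp : 0 < A := lt_of_le_of_ne hA0 (Ne.symm hne)
    rcases lt_or_gt_of_ne hc with hneg | hpos
    -- Contraction: the predecessor of a maximum would have to be larger than it.
    · obtain ⟨i', hi'⟩ := pred ρ hρ i
      have h := h3 i'
      rw [hi', abs_of_neg hneg] at h
      rw [abs_of_neg hneg] at hac
      have h4 : A ≤ |ρ i - (1 + a * c) * ρ i'| + |(1 + a * c) * ρ i'| := by
        rw [hA]
        have := abs_add_le (ρ i - (1 + a * c) * ρ i') ((1 + a * c) * ρ i')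
        simpa using this
      have h5 : |(1 + a * c) * ρ i'| ≤ (1 + a * c) * A := by
        rw [abs_mul, abs_of_nonneg (by linarith)]
        exact mul_le_mul_of_nonneg_left (hi i') (by linarith)
      have h6 : 0 < a * -c * A := by
        have : 0 < -c := by linarith
        positivity
      nlinarith
    -- Expansion: the successor of a maximum would be larger than it.
    · have h := h3 i
      rw [abs_of_pos hpos] at h
      have h4 : |(1 + a * c) * ρ i| ≤ |ρ (i + 1)| + |ρ (i + 1) - (1 + a * c) * ρ i| := by
        have := abs_sub (ρ (i + 1)) (ρ (i + 1) - (1 + a * c) * ρ i)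
        simpa using this
      rw [abs_mul, abs_of_pos (by positivity : 0 < 1 + a * c), ← hA] at h4
      have h5 := hi (i + 1)
      have h6 : 0 < a * c * A := by positivity
      nlinarith
  have hBz : B = 0 := le_antisymm (by rw [hAz, mul_zero] at hBA; exact hBA) hB0
  exact ⟨abs_eq_zero.1 (le_antisymm ((hi k).trans hAz.le) (abs_nonneg _)),
    abs_eq_zero.1 (le_antisymm ((hj k).trans hBz.le) (abs_nonneg _))⟩

/-- A function with a second-difference bound which is differentiable at a point is strictly
differentiable there. -/
theorem strict_of_doubleDiff {F : ℝ → ℝ} {rs c C : ℝ} (hrs : 0 < rs) (hC : 0 ≤ C)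
    (hd : HasDerivAt F c rs)
    (hF : ∀ a ∈ Icc (rs / 2) (3 * rs / 2), ∀ b ∈ Icc (rs / 2) (3 * rs / 2),
      ∀ a' ∈ Icc (rs / 2) (3 * rs / 2), ∀ b' ∈ Icc (rs / 2) (3 * rs / 2),
      |F a - F b - F a' + F b'| ≤ C * (|a - b - a' + b'| + |a - b| * (|a - a'| + |b - b'|)))
    {η : ℝ} (hη : 0 < η) :
    ∃ δ > 0, δ ≤ rs / 4 ∧ ∀ a b, |a - rs| ≤ δ → |b - rs| ≤ δ →
      |F a - F b - c * (a - b)| ≤ η * |a - b| := by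
  have h := (hasDerivAt_iff_isLittleO.1 hd).def (half_pos hη)
  obtain ⟨δ₁, hδ₁, h⟩ := Metric.eventually_nhds_iff.1 h
  refine ⟨min (min (rs / 4) (δ₁ / 4)) (η / (4 * (C + 1))),
    lt_min (lt_min (by positivity) (by positivity)) (by positivity),
    (min_le_left _ _).trans (min_le_left _ _), fun a b ha hb => ?_⟩
  have ha1 := ha.trans ((min_le_left _ _).trans (min_le_left _ _))
  have hb1 := hb.trans ((min_le_left _ _).trans (min_le_left _ _))
  have ha2 := ha.trans ((min_le_left _ _).trans (min_le_right _ _))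
  have hb2 := hb.trans ((min_le_left _ _).trans (min_le_right _ _))
  have hb3 := hb.trans (min_le_right _ _)
  have hab : |a - b| ≤ |a - rs| + |b - rs| := by
    have := abs_sub (a - rs) (b - rs); simpa using this
  rw [abs_le] at ha1 hb1
  -- The comparison pair is the translate (rs + (a - b), rs). The increments agree, so only the
  -- quadratic term of the bound is left, and differentiability at rs itself handles the translated
  -- pair.
  have h1 := hF a ⟨by linarith, by linarith⟩ b ⟨by linarith, by linarith⟩ (rs + (a - b))
    ⟨by linarith, by linarith⟩ rs ⟨by linarith, by linarith⟩
  have e1 : a - b - (rs + (a - b)) + rs = 0 := by ring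
  have e2 : a - (rs + (a - b)) = b - rs := by ring
  rw [e1, e2, abs_zero, zero_add] at h1
  have h2 : |F (rs + (a - b)) - F rs - c * (a - b)| ≤ η / 2 * |a - b| := by
    have := h (y := rs + (a - b)) (by
      rw [Real.dist_eq, add_sub_cancel_left]; linarith)
    simpa [mul_comm] using this
  have h3 : C * (|a - b| * (|b - rs| + |b - rs|)) ≤ η / 2 * |a - b| := by
    rw [le_div_iff₀ (by positivity)] at hb3
    have h4 : C * (|b - rs| + |b - rs|) ≤ η / 2 := by nlinarith [abs_nonneg (b - rs)]
    calc _ = C * (|b - rs| + |b - rs|) * |a - b| := by ring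
      _ ≤ _ := by gcongr
  have h4 := abs_add_le (F a - F b - F (rs + (a - b)) + F rs)
    (F (rs + (a - b)) - F rs - c * (a - b))
  have e3 : F a - F b - F (rs + (a - b)) + F rs + (F (rs + (a - b)) - F rs - c * (a - b)) =
      F a - F b - c * (a - b) := by ring
  rw [e3] at h4
  linarith

theorem abs_fst_le_norm (p : ℝ × ℝ) : |p.1| ≤ ‖p‖ := norm_fst_le p

theorem abs_snd_le_norm (p : ℝ × ℝ) : |p.2| ≤ ‖p‖ := norm_snd_le p

/-- The hypotheses on the displacement functions: `S` is the displacement of the radius divided by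
`ε²` and `N` the new height. -/
structure ReturnData (rs vs e C l κ : ℝ) (F v : ℝ → ℝ) (S N : ℝ × ℝ → ℝ → ℝ) : Prop where
  rs_pos : 0 < rs
  e_pos : 0 < e
  C_pos : 0 < C
  l_pos : 0 < l
  l_lt : l < 1
  vs_eq : v rs = vs
  zero : F rs = 0
  S_zero : ∀ p ∈ Icc (rs / 2) (3 * rs / 2) ×ˢ Icc (vs - 1) (vs + 1),
    S p 0 = F p.1 + κ * (p.2 - v p.1)
  N_zero : ∀ p ∈ Icc (rs / 2) (3 * rs / 2) ×ˢ Icc (vs - 1) (vs + 1),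
    N p 0 = l * p.2 + (1 - l) * v p.1
  lip : ∀ H, (H = S ∨ H = N) → ∀ p ∈ Icc (rs / 2) (3 * rs / 2) ×ˢ Icc (vs - 1) (vs + 1),
    ∀ ε ∈ Icc (-e) e, ∀ q ∈ Icc (rs / 2) (3 * rs / 2) ×ˢ Icc (vs - 1) (vs + 1),
    ∀ ε' ∈ Icc (-e) e, |H p ε - H q ε'| ≤ C * (‖p - q‖ + |ε - ε'|)
  dd : ∀ H, (H = S ∨ H = N) → ∀ p ∈ Icc (rs / 2) (3 * rs / 2) ×ˢ Icc (vs - 1) (vs + 1),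
    ∀ q ∈ Icc (rs / 2) (3 * rs / 2) ×ˢ Icc (vs - 1) (vs + 1),
    ∀ p' ∈ Icc (rs / 2) (3 * rs / 2) ×ˢ Icc (vs - 1) (vs + 1),
    ∀ q' ∈ Icc (rs / 2) (3 * rs / 2) ×ˢ Icc (vs - 1) (vs + 1),
    ∀ ε ∈ Icc (-e) e, ∀ ε' ∈ Icc (-e) e,
    |H p ε - H q ε - H p' ε' + H q' ε'| ≤
      C * (‖p - q - p' + q'‖ + ‖p - q‖ * (‖p - p'‖ + ‖q - q'‖ + |ε - ε'|))

namespace ReturnData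

variable {rs vs e C l κ : ℝ} {F v : ℝ → ℝ} {S N : ℝ × ℝ → ℝ → ℝ}

theorem mem_zero (h : ReturnData rs vs e C l κ F v S N) : (0 : ℝ) ∈ Icc (-e) e :=
  ⟨by linarith [h.e_pos], h.e_pos.le⟩

theorem v_eq (h : ReturnData rs vs e C l κ F v S N) {r : ℝ}
    (hr : r ∈ Icc (rs / 2) (3 * rs / 2)) : v r = (N (r, vs) 0 - l * vs) / (1 - l) := by
  have h1 := h.N_zero (r, vs) ⟨hr, ⟨by simp, by simp⟩⟩
  have h2 : 1 - l ≠ 0 := by linarith [h.l_lt]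
  rw [h1]; field_simp; ring

/-- At ε = 0 the combination S + κ / (1 - l) · (N - V) does not depend on V. Evaluating it at V = vs
lets F inherit the second-difference bounds of S and N, just as `v_eq` lets v inherit a Lipschitz
bound. -/
theorem F_eq (h : ReturnData rs vs e C l κ F v S N) {r : ℝ}
    (hr : r ∈ Icc (rs / 2) (3 * rs / 2)) :
    F r = S (r, vs) 0 + κ / (1 - l) * (N (r, vs) 0 - vs) := by
  have h1 := h.N_zero (r, vs) ⟨hr, ⟨by simp, by simp⟩⟩
  have h3 := h.S_zero (r, vs) ⟨hr, ⟨by simp, by simp⟩⟩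
  have h2 : 1 - l ≠ 0 := by linarith [h.l_lt]
  rw [h1, h3]; field_simp; ring

theorem v_lip (h : ReturnData rs vs e C l κ F v S N) {a b : ℝ}
    (ha : a ∈ Icc (rs / 2) (3 * rs / 2)) (hb : b ∈ Icc (rs / 2) (3 * rs / 2)) :
    |v a - v b| ≤ C / (1 - l) * |a - b| := by
  have h2 : 0 < 1 - l := by linarith [h.l_lt]
  have h1 := h.lip N (Or.inr rfl) (a, vs) ⟨ha, ⟨by simp, by simp⟩⟩ 0 h.mem_zero (b, vs)
    ⟨hb, ⟨by simp, by simp⟩⟩ 0 h.mem_zero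
  rw [sub_self, abs_zero, add_zero, Prod.mk_sub_mk, sub_self] at h1
  have h3 : ‖(a - b, (0 : ℝ))‖ ≤ |a - b| := by
    refine (norm_pair_le _ _).trans ?_
    simp
  rw [h.v_eq ha, h.v_eq hb, ← sub_div, abs_div, abs_of_pos h2, div_mul_eq_mul_div]
  gcongr
  have e1 : N (a, vs) 0 - l * vs - (N (b, vs) 0 - l * vs) = N (a, vs) 0 - N (b, vs) 0 := by ring
  rw [e1]
  refine h1.trans ?_
  have := h.C_pos
  gcongr

theorem F_dd (h : ReturnData rs vs e C l κ F v S N) :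
    ∀ a ∈ Icc (rs / 2) (3 * rs / 2), ∀ b ∈ Icc (rs / 2) (3 * rs / 2),
      ∀ a' ∈ Icc (rs / 2) (3 * rs / 2), ∀ b' ∈ Icc (rs / 2) (3 * rs / 2),
      |F a - F b - F a' + F b'| ≤ (C * (1 + |κ / (1 - l)|)) *
        (|a - b - a' + b'| + |a - b| * (|a - a'| + |b - b'|)) := by
  intro a ha b hb a' ha' b' hb'
  have hm : ∀ r ∈ Icc (rs / 2) (3 * rs / 2),
      (r, vs) ∈ Icc (rs / 2) (3 * rs / 2) ×ˢ Icc (vs - 1) (vs + 1) :=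
    fun r hr => ⟨hr, ⟨by simp, by simp⟩⟩
  have hn : ∀ x : ℝ, ‖(x, (0 : ℝ))‖ = |x| := fun x => by simp [Prod.norm_def]
  have h1 := h.dd S (Or.inl rfl) _ (hm a ha) _ (hm b hb) _ (hm a' ha') _ (hm b' hb')
    0 h.mem_zero 0 h.mem_zero
  have h2 := h.dd N (Or.inr rfl) _ (hm a ha) _ (hm b hb) _ (hm a' ha') _ (hm b' hb')
    0 h.mem_zero 0 h.mem_zero
  simp only [Prod.mk_sub_mk, Prod.mk_add_mk, sub_self, zero_sub, neg_add_cancel, hn, abs_zero,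
    add_zero] at h1 h2
  rw [h.F_eq ha, h.F_eq hb, h.F_eq ha', h.F_eq hb']
  set T := |a - b - a' + b'| + |a - b| * (|a - a'| + |b - b'|)
  have e1 : S (a, vs) 0 + κ / (1 - l) * (N (a, vs) 0 - vs)
      - (S (b, vs) 0 + κ / (1 - l) * (N (b, vs) 0 - vs))
      - (S (a', vs) 0 + κ / (1 - l) * (N (a', vs) 0 - vs))
      + (S (b', vs) 0 + κ / (1 - l) * (N (b', vs) 0 - vs)) =
      (S (a, vs) 0 - S (b, vs) 0 - S (a', vs) 0 + S (b', vs) 0)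
      + κ / (1 - l) * (N (a, vs) 0 - N (b, vs) 0 - N (a', vs) 0 + N (b', vs) 0) := by ring
  rw [e1]
  refine (abs_add_le _ _).trans ?_
  rw [abs_mul]
  have h3 := mul_le_mul_of_nonneg_left h2 (abs_nonneg (κ / (1 - l)))
  calc _ ≤ C * T + |κ / (1 - l)| * (C * T) := add_le_add h1 h3
    _ = _ := by ring

/-- The dependence on `ε` of the differences of `S` and `N`. -/
theorem diff_zero (h : ReturnData rs vs e C l κ F v S N) {H : ℝ × ℝ → ℝ → ℝ} (hH : H = S ∨ H = N)
    {p q : ℝ × ℝ} (hp : p ∈ Icc (rs / 2) (3 * rs / 2) ×ˢ Icc (vs - 1) (vs + 1))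
    (hq : q ∈ Icc (rs / 2) (3 * rs / 2) ×ˢ Icc (vs - 1) (vs + 1)) {ε : ℝ} (hε : ε ∈ Icc (-e) e) :
    |H p ε - H q ε - (H p 0 - H q 0)| ≤ C * |ε| * ‖p - q‖ := by
  have h1 := h.dd H hH p hp q hq p hp q hq ε hε 0 h.mem_zero
  have e1 : p - q - p + q = 0 := by abel
  rw [e1, sub_self, sub_self, norm_zero, zero_add, zero_add, zero_add, sub_zero] at h1
  have e2 : H p ε - H q ε - (H p 0 - H q 0) = H p ε - H q ε - H p 0 + H q 0 := by ring
  rw [e2]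
  refine h1.trans (le_of_eq ?_)
  ring

theorem center_mem (h : ReturnData rs vs e C l κ F v S N) :
    (rs, vs) ∈ Icc (rs / 2) (3 * rs / 2) ×ˢ Icc (vs - 1) (vs + 1) := by
  have := h.rs_pos
  exact ⟨⟨by simp; linarith, by simp; linarith⟩, ⟨by simp, by simp⟩⟩

theorem mem_of_norm_le {δ : ℝ} (h1 : δ ≤ rs / 2)
    (h2 : δ ≤ 1) {p : ℝ × ℝ} (hp : ‖p - (rs, vs)‖ ≤ δ) :
    p ∈ Icc (rs / 2) (3 * rs / 2) ×ˢ Icc (vs - 1) (vs + 1) := by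
  have h3 := abs_le.1 ((abs_fst_le_norm _).trans hp)
  have h4 := abs_le.1 ((abs_snd_le_norm _).trans hp)
  simp only [Prod.fst_sub, Prod.snd_sub] at h3 h4
  exact ⟨⟨by linarith, by linarith⟩, ⟨by linarith, by linarith⟩⟩

/-- At ε = 0 the combination S + κ / (1 - l) · (N - V) is F(r), and V + (N - V) / (1 - l) is v(r). A
Newton step with slope c for r and the substitution V ↦ v(r) therefore give a contraction. For ε ≠ 0
both it and its displacement of the centre change by O(ε). -/
theorem exists_fixedPoint (h : ReturnData rs vs e C l κ F v S N) {c : ℝ} (hc : c ≠ 0)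
    (hd : HasDerivAt F c rs) :
    ∃ B > 0, ∃ ε₁ > 0, ∀ ε, |ε| < ε₁ → ∃ p ∈ Icc (rs / 2) (3 * rs / 2) ×ˢ Icc (vs - 1) (vs + 1),
      ‖p - (rs, vs)‖ ≤ B * |ε| ∧ S p ε = 0 ∧ N p ε = p.2 := by
  have hcp : 0 < |c| := abs_pos.2 hc
  have hl : 0 < 1 - l := by linarith [h.l_lt]
  have hC := h.C_pos
  have he := h.e_pos
  have hrs := h.rs_pos
  obtain ⟨δ, hδ, hδr, hst⟩ := strict_of_doubleDiff hrs (by positivity) hd h.F_dd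
    (η := |c| / 4) (by positivity)
  set m := C / (1 - l) with hm
  have hm0 : 0 < m := by positivity
  -- Stretching the first coordinate by L gives y₁ ↦ v(y₁ / L) the Lipschitz constant m / L ≤ 1/4.
  set L := 4 * m + 4 with hL
  have hL0 : 0 < L := by positivity
  set k := |κ / (1 - l)| with hk
  have hk0 : 0 ≤ k := abs_nonneg _
  -- J|ε| bounds the displacement of the centre and the contributions of ε to the contraction
  -- constant; as this constant is 1/2, the ball of radius 2J|ε| is mapped into itself.
  set J := m + L * (C * (1 + k)) / |c| with hJ
  have hJ0 : 0 < J := by positivity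
  refine ⟨2 * J, by positivity, min (min e (1 / (4 * J))) (min δ 1 / (2 * J)),
    lt_min (lt_min he (by positivity)) (by positivity), fun ε hε => ?_⟩
  have hεe : ε ∈ Icc (-e) e := abs_le.1 (hε.le.trans ((min_le_left _ _).trans (min_le_left _ _)))
  have hεJ : |ε| * J ≤ 1 / 4 := by
    have := hε.le.trans ((min_le_left _ _).trans (min_le_right _ _))
    rw [le_div_iff₀ (by positivity)] at this
    linarith
  have hεδ : 2 * J * |ε| ≤ min δ 1 := by
    have := hε.le.trans (min_le_right _ _)
    rw [le_div_iff₀ (by positivity)] at this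
    linarith
  have hr1 : 2 * J * |ε| ≤ δ := hεδ.trans (min_le_left _ _)
  have hr2 : 2 * J * |ε| ≤ 1 := hεδ.trans (min_le_right _ _)
  set T : ℝ × ℝ → ℝ × ℝ := fun y =>
    (y.1 - L * ((S (y.1 / L, y.2) ε + κ / (1 - l) * (N (y.1 / L, y.2) ε - y.2)) / c),
      y.2 + (N (y.1 / L, y.2) ε - y.2) / (1 - l)) with hT
  set y₀ : ℝ × ℝ := (L * rs, vs) with hy₀
  set s := Metric.closedBall y₀ (2 * J * |ε|) with hs
  have L1 : 1 ≤ L := by linarith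
  have scale : ∀ y z : ℝ × ℝ, ‖((y.1 / L, y.2) : ℝ × ℝ) - (z.1 / L, z.2)‖ ≤ ‖y - z‖ := by
    intro y z
    refine max_le ?_ (norm_snd_le (y - z))
    simp only [Prod.fst_sub]
    rw [← sub_div, norm_div, Real.norm_of_nonneg hL0.le]
    exact (div_le_self (norm_nonneg _) L1).trans (norm_fst_le (y - z))
  have ps : ∀ y ∈ s, ‖((y.1 / L, y.2) : ℝ × ℝ) - (rs, vs)‖ ≤ 2 * J * |ε| := by
    intro y hy
    have h1 := scale y y₀
    rw [hy₀, mul_div_cancel_left₀ _ hL0.ne'] at h1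
    rw [hs, Metric.mem_closedBall, dist_eq_norm] at hy
    exact h1.trans hy
  have mem : ∀ y ∈ s, ((y.1 / L, y.2) : ℝ × ℝ) ∈
      Icc (rs / 2) (3 * rs / 2) ×ˢ Icc (vs - 1) (vs + 1) := fun y hy =>
    mem_of_norm_le (hr1.trans (hδr.trans (by linarith))) hr2 (ps y hy)
  have near : ∀ y ∈ s, |y.1 / L - rs| ≤ δ := fun y hy =>
    (abs_fst_le_norm _).trans ((ps y hy).trans hr1)
  -- the contraction estimate
  have contr : ∀ y ∈ s, ∀ z ∈ s, ‖T y - T z‖ ≤ 1 / 2 * ‖y - z‖ := by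
    intro y hy z hz
    set p : ℝ × ℝ := (y.1 / L, y.2) with hp
    set q : ℝ × ℝ := (z.1 / L, z.2) with hq
    have dS := h.diff_zero (Or.inl rfl) (mem y hy) (mem z hz) hεe (H := S)
    have dN := h.diff_zero (Or.inr rfl) (mem y hy) (mem z hz) hεe (H := N)
    rw [h.S_zero p (mem y hy), h.S_zero q (mem z hz)] at dS
    rw [h.N_zero p (mem y hy), h.N_zero q (mem z hz)] at dN
    have hpq : ‖p - q‖ ≤ ‖y - z‖ := scale y z
    have hsn := abs_snd_le_norm (y - z)
    have hfn := abs_fst_le_norm (y - z)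
    rw [Prod.snd_sub] at hsn
    rw [Prod.fst_sub] at hfn
    have hF := hst (y.1 / L) (z.1 / L) (near y hy) (near z hz)
    have hv := h.v_lip (mem y hy).1 (mem z hz).1
    rw [← hm] at hv
    have hdiv : |y.1 / L - z.1 / L| = |y.1 - z.1| / L := by
      rw [← sub_div, abs_div, abs_of_pos hL0]
    set w := ‖y - z‖ with hw
    have hw0 : 0 ≤ w := norm_nonneg _
    set e₁ := S p ε - S q ε - (F p.1 + κ * (p.2 - v p.1) - (F q.1 + κ * (q.2 - v q.1))) with he₁
    set e₂ := N p ε - N q ε - (l * p.2 + (1 - l) * v p.1 - (l * q.2 + (1 - l) * v q.1)) with he₂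
    have b1 : |e₁| ≤ C * |ε| * w := dS.trans (by gcongr)
    have b2 : |e₂| ≤ C * |ε| * w := dN.trans (by gcongr)
    have eV : (T y - T z).2 = (v p.1 - v q.1) + e₂ / (1 - l) := by
      simp only [hT, Prod.snd_sub, he₂, hp, hq]
      field_simp
      ring
    have eR : (T y - T z).1 = -(L / c) * (F p.1 - F q.1 - c * (p.1 - q.1))
        - L / c * (e₁ + κ / (1 - l) * e₂) := by
      simp only [hT, Prod.fst_sub, he₂, he₁, hp, hq]
      field_simp
      ring
    refine max_le ?_ ?_
    · change |(T y - T z).1| ≤ _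
      rw [eR]
      have h1 : |(-(L / c)) * (F p.1 - F q.1 - c * (p.1 - q.1))| ≤ w / 4 := by
        rw [abs_mul, abs_neg, abs_div, abs_of_pos hL0]
        calc L / |c| * |F p.1 - F q.1 - c * (p.1 - q.1)| ≤ L / |c| * (|c| / 4 * (|y.1 - z.1| / L)) := by
              rw [← hdiv]
              gcongr
          _ = |y.1 - z.1| / 4 := by field_simp
          _ ≤ w / 4 := by linarith
      have h2 : |L / c * (e₁ + κ / (1 - l) * e₂)| ≤ w / 4 := by
        rw [abs_mul, abs_div, abs_of_pos hL0]
        have h3 : |e₁ + κ / (1 - l) * e₂| ≤ C * (1 + k) * (|ε| * w) := by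
          refine (abs_add_le _ _).trans ?_
          rw [abs_mul, ← hk]
          have := mul_le_mul_of_nonneg_left b2 hk0
          linarith
        calc L / |c| * |e₁ + κ / (1 - l) * e₂| ≤ L / |c| * (C * (1 + k) * (|ε| * w)) := by gcongr
          _ = (|ε| * (L * (C * (1 + k)) / |c|)) * w := by ring
          _ ≤ (|ε| * J) * w := by
            gcongr
            rw [hJ]; linarith
          _ ≤ 1 / 4 * w := by gcongr
          _ = w / 4 := by ring
      have h3 := abs_sub ((-(L / c)) * (F p.1 - F q.1 - c * (p.1 - q.1)))
        (L / c * (e₁ + κ / (1 - l) * e₂))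
      linarith
    · change |(T y - T z).2| ≤ _
      rw [eV]
      have h1 : |v p.1 - v q.1| ≤ w / 4 := by
        refine hv.trans ?_
        rw [hdiv]
        calc m * (|y.1 - z.1| / L) ≤ m * (w / L) := by gcongr
          _ = (m / L) * w := by ring
          _ ≤ 1 / 4 * w := by
            refine mul_le_mul_of_nonneg_right ?_ hw0
            rw [div_le_iff₀ hL0]; linarith
          _ = w / 4 := by ring
      have h2 : |e₂ / (1 - l)| ≤ w / 4 := by
        rw [abs_div, abs_of_pos hl]
        calc |e₂| / (1 - l) ≤ C * |ε| * w / (1 - l) := by gcongr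
          _ = (|ε| * m) * w := by rw [hm]; ring
          _ ≤ (|ε| * J) * w := by
            gcongr
            rw [hJ]
            have : 0 ≤ L * (C * (1 + k)) / |c| := by positivity
            linarith
          _ ≤ 1 / 4 * w := by gcongr
          _ = w / 4 := by ring
      have h3 := abs_add_le (v p.1 - v q.1) (e₂ / (1 - l))
      linarith
  have start : ‖T y₀ - y₀‖ ≤ J * |ε| := by
    have hcm := h.center_mem
    have hS := h.lip S (Or.inl rfl) _ hcm ε hεe _ hcm 0 h.mem_zero
    have hN := h.lip N (Or.inr rfl) _ hcm ε hεe _ hcm 0 h.mem_zero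
    rw [h.S_zero _ hcm] at hS
    simp only [h.zero, h.vs_eq, sub_self, norm_zero, mul_zero, add_zero, sub_zero, zero_add] at hS
    have e1 : l * vs + (1 - l) * vs = vs := by ring
    rw [h.N_zero _ hcm] at hN
    simp only [h.vs_eq, e1, sub_self, norm_zero, sub_zero, zero_add] at hN
    have eV : (T y₀ - y₀).2 = (N (rs, vs) ε - vs) / (1 - l) := by
      simp [hT, hy₀, mul_div_cancel_left₀ _ hL0.ne']
    have eR : (T y₀ - y₀).1 = -(L * ((S (rs, vs) ε + κ / (1 - l) * (N (rs, vs) ε - vs)) / c)) := by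
      simp [hT, hy₀, mul_div_cancel_left₀ _ hL0.ne']
    have hx : 0 ≤ L * (C * (1 + k)) / |c| := by positivity
    refine max_le ?_ ?_
    · change |(T y₀ - y₀).1| ≤ _
      rw [eR, abs_neg, abs_mul, abs_div, abs_of_pos hL0]
      have h3 : |S (rs, vs) ε + κ / (1 - l) * (N (rs, vs) ε - vs)| ≤ C * (1 + k) * |ε| := by
        refine (abs_add_le _ _).trans ?_
        rw [abs_mul, ← hk]
        have := mul_le_mul_of_nonneg_left hN hk0
        linarith
      calc _ ≤ L * (C * (1 + k) * |ε| / |c|) := by gcongr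
        _ = L * (C * (1 + k)) / |c| * |ε| := by ring
        _ ≤ J * |ε| := by
          gcongr
          rw [hJ]; linarith
    · change |(T y₀ - y₀).2| ≤ _
      rw [eV, abs_div, abs_of_pos hl]
      calc _ ≤ C * |ε| / (1 - l) := by gcongr
        _ = m * |ε| := by rw [hm]; ring
        _ ≤ J * |ε| := by
          gcongr
          rw [hJ]; linarith
  have y0s : y₀ ∈ s := Metric.mem_closedBall_self (by positivity)
  have maps : MapsTo T s s := by
    intro y hy
    have h1 := contr y hy y₀ y0s
    have h2 : ‖y - y₀‖ ≤ 2 * J * |ε| := by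
      rw [← dist_eq_norm]; exact hy
    rw [hs, Metric.mem_closedBall, dist_eq_norm]
    have h3 := norm_sub_le_norm_sub_add_norm_sub (T y) (T y₀) y₀
    nlinarith
  have hcw : ContractingWith (1 / 2 : NNReal) (maps.restrict T s s) := by
    refine ⟨by rw [← NNReal.coe_lt_coe]; norm_num, LipschitzWith.of_dist_le_mul ?_⟩
    rintro ⟨y, hy⟩ ⟨z, hz⟩
    rw [Subtype.dist_eq, Subtype.dist_eq, dist_eq_norm, dist_eq_norm]
    exact (contr y hy z hz).trans (by norm_num)
  obtain ⟨y, hy, hfix, -⟩ := hcw.exists_fixedPoint' Metric.isClosed_closedBall.isComplete maps y0s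
    (edist_ne_top _ _)
  refine ⟨(y.1 / L, y.2), mem y hy, ps y hy, ?_⟩
  have f1 := congrArg Prod.fst hfix
  have f2 := congrArg Prod.snd hfix
  simp only [hT] at f1 f2
  have g2 : N (y.1 / L, y.2) ε - y.2 = 0 := by
    have : (N (y.1 / L, y.2) ε - y.2) / (1 - l) = 0 := by linarith
    exact (div_eq_zero_iff.1 this).resolve_right hl.ne'
  rw [g2, mul_zero, add_zero] at f1
  have g1 : L * (S (y.1 / L, y.2) ε / c) = 0 := by linarith
  refine ⟨?_, by linarith⟩
  exact (div_eq_zero_iff.1 ((mul_eq_zero.1 g1).resolve_left hL0.ne')).resolve_right hc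

set_option maxHeartbeats 800000 in
/-- Near the base point the return map has no periodic points except the fixed point. -/
theorem eq_fixedPoint_of_periodic (h : ReturnData rs vs e C l κ F v S N) {c : ℝ} (hc : c ≠ 0)
    (hd : HasDerivAt F c rs) :
    ∃ δ > 0, δ ≤ rs / 4 ∧ δ ≤ 1 / 2 ∧ ∃ ε₁ > 0, ∀ ε, ε ≠ 0 → |ε| < ε₁ →
      ∀ ps : ℝ × ℝ, ‖ps - (rs, vs)‖ ≤ δ → S ps ε = 0 → N ps ε = ps.2 →
      ∀ (n : ℕ) (p : ℕ → ℝ × ℝ), 0 < n → (∀ k, ‖p k - (rs, vs)‖ ≤ δ) →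
        (∀ k, p (k + 1) = ((p k).1 + ε ^ 2 * S (p k) ε, N (p k) ε)) → p n = p 0 →
        ∀ k, p k = ps := by
  have hcp : 0 < |c| := abs_pos.2 hc
  have hl : 0 < 1 - l := by linarith [h.l_lt]
  have hC := h.C_pos
  have he := h.e_pos
  have hrs := h.rs_pos
  obtain ⟨δ, hδ, hδr, hst⟩ := strict_of_doubleDiff hrs (by positivity) hd h.F_dd
    (η := |c| / 8) (by positivity)
  set m := C / (1 - l) with hm
  have hm0 : 0 < m := by positivity
  -- bounds for the differences of `S` and `N`
  set D₁ := C * (1 + m) with hD₁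
  have hD₁0 : 0 < D₁ := by positivity
  set D₂ := 2 * |c| + |κ| + D₁ with hD₂
  have hD₂0 : 0 < D₂ := by positivity
  set D₃ := D₁ + m * D₂ with hD₃
  have hD₃0 : 0 < D₃ := by positivity
  set K := |κ| + D₁ with hK
  have hK0 : 0 < K := by positivity
  -- The ratio allowed between the deviations of height and radius; K q = |c| / 4 lets the expansion
  -- or contraction of the radius dominate.
  set q := |c| / (4 * K) with hq
  have hq0 : 0 < q := by positivity
  refine ⟨min δ (1 / 2), lt_min hδ (by norm_num), (min_le_left _ _).trans hδr, min_le_right _ _,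
    min (min e 1) (min (|c| / (8 * D₁)) (min (1 / |c|) (min ((1 - l) / (2 * D₃))
      (q * (1 - l) / (2 * D₃))))), ?_, ?_⟩
  · refine lt_min (lt_min he one_pos) (lt_min (by positivity) (lt_min (by positivity)
      (lt_min (by positivity) (by positivity))))
  intro ε hε0 hε ps hps hS0 hN0 n p hn hp hstep hper
  simp only [lt_min_iff] at hε
  obtain ⟨⟨hεe', hε1⟩, hε2, hε3, hε4, hε5⟩ := hε
  have hεe : ε ∈ Icc (-e) e := abs_le.1 hεe'.le
  have hεp : 0 < |ε| := abs_pos.2 hε0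
  rw [lt_div_iff₀ (by positivity)] at hε2 hε3 hε4 hε5
  have hmem : ∀ p : ℝ × ℝ, ‖p - (rs, vs)‖ ≤ min δ (1 / 2) →
      p ∈ Icc (rs / 2) (3 * rs / 2) ×ˢ Icc (vs - 1) (vs + 1) := fun p hp =>
    mem_of_norm_le (((min_le_left _ _).trans hδr).trans (by linarith))
      ((min_le_right _ _).trans (by norm_num)) hp
  have hnear : ∀ p : ℝ × ℝ, ‖p - (rs, vs)‖ ≤ min δ (1 / 2) → |p.1 - rs| ≤ δ := fun p hp =>
    (abs_fst_le_norm _).trans (hp.trans (min_le_left _ _))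
  have hperk : ∀ k, p (k + n) = p k := by
    intro k
    induction k with
    | zero => rw [zero_add, hper]
    | succ k ih => rw [show k + 1 + n = (k + n) + 1 by ring, hstep, ih, ← hstep]
  set ρ : ℕ → ℝ := fun k => (p k).1 - ps.1 with hρ
  -- The height is measured from the curve V = v(r). At ε = 0 this deviation is multiplied by l; the
  -- motion of r shifts the curve by O(ε²) times the deviations.
  set μ : ℕ → ℝ := fun k => ((p k).2 - v (p k).1) - (ps.2 - v ps.1) with hμ
  have hε2sq : ε ^ 2 = |ε| ^ 2 := (sq_abs ε).symm
  have key : ∀ k, |μ (k + 1)| ≤ l * |μ k| + (D₃ * |ε|) * (|ρ k| + |μ k|) ∧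
      |ρ (k + 1) - (1 + ε ^ 2 * c) * ρ k| ≤ ε ^ 2 * (|c| / 4 * |ρ k| + K * |μ k|) := by
    intro k
    have mk := hmem _ (hp k)
    have ms := hmem _ hps
    have dS := h.diff_zero (Or.inl rfl) mk ms hεe (H := S)
    have dN := h.diff_zero (Or.inr rfl) mk ms hεe (H := N)
    rw [h.S_zero _ mk, h.S_zero _ ms, hS0, sub_zero] at dS
    rw [h.N_zero _ mk, h.N_zero _ ms, hN0] at dN
    have hF := hst _ _ (hnear _ (hp k)) (hnear _ hps)
    have hv := h.v_lip mk.1 ms.1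
    have hv' := h.v_lip mk.1 (hmem _ (hp (k + 1))).1
    rw [← hm] at hv hv'
    have hstep1 : (p (k + 1)).1 = (p k).1 + ε ^ 2 * S (p k) ε := by rw [hstep]
    have hstep2 : (p (k + 1)).2 = N (p k) ε := by rw [hstep]
    have hu : ‖p k - ps‖ ≤ (1 + m) * (|ρ k| + |μ k|) := by
      have e1 : (p k).2 - ps.2 = μ k + (v (p k).1 - v ps.1) := by simp only [hμ]; ring
      have h1 : |(p k).2 - ps.2| ≤ |μ k| + m * |ρ k| := by
        rw [e1]
        exact (abs_add_le _ _).trans (add_le_add le_rfl hv)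
      have h2 := abs_nonneg (μ k)
      have h3 := abs_nonneg (ρ k)
      refine max_le ?_ ?_
      · change |ρ k| ≤ _
        nlinarith
      · change |(p k).2 - ps.2| ≤ _
        nlinarith
    have hr0 := abs_nonneg (ρ k)
    have hm0' := abs_nonneg (μ k)
    have bu : C * |ε| * ‖p k - ps‖ ≤ D₁ * |ε| * (|ρ k| + |μ k|) := by
      calc _ ≤ C * |ε| * ((1 + m) * (|ρ k| + |μ k|)) := by gcongr
        _ = _ := by rw [hD₁]; ring
    set e₁ := S (p k) ε - (F (p k).1 + κ * ((p k).2 - v (p k).1)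
      - (F ps.1 + κ * (ps.2 - v ps.1))) with he₁
    set e₂ := N (p k) ε - ps.2 - (l * (p k).2 + (1 - l) * v (p k).1
      - (l * ps.2 + (1 - l) * v ps.1)) with he₂
    have b1 := dS.trans bu
    have b2 := dN.trans bu
    set e₃ := F (p k).1 - F ps.1 - c * ((p k).1 - ps.1) with he₃
    have eS : S (p k) ε = c * ρ k + e₃ + κ * μ k + e₁ := by
      simp only [he₁, he₃, hρ, hμ]; ring
    have b3 : |e₃| ≤ |c| / 8 * |ρ k| := hF
    have b4 : |κ * μ k| = |κ| * |μ k| := abs_mul _ _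
    have b5 : D₁ * |ε| * (|ρ k| + |μ k|) ≤ |c| / 8 * |ρ k| + D₁ * |μ k| := by
      have h1 : D₁ * |ε| * |ρ k| ≤ |c| / 8 * |ρ k| := by
        gcongr; linarith
      have h2 : D₁ * |ε| * |μ k| ≤ D₁ * |μ k| := by
        gcongr
        nlinarith
      linarith
    refine ⟨?_, ?_⟩
    · have eM : μ (k + 1) = l * μ k + e₂ + (v (p k).1 - v (p (k + 1)).1) := by
        simp only [hμ, he₂, hstep2]; ring
      have hSb : |S (p k) ε| ≤ D₂ * (|ρ k| + |μ k|) := by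
        rw [eS]
        have t1 := abs_add_le (c * ρ k + e₃ + κ * μ k) e₁
        have t2 := abs_add_le (c * ρ k + e₃) (κ * μ k)
        have t3 := abs_add_le (c * ρ k) e₃
        rw [abs_mul] at t3
        have t4 : 0 ≤ |c| * |ρ k| := by positivity
        have t5 : 0 ≤ |c| * |μ k| := by positivity
        have t6 : 0 ≤ |κ| * |ρ k| := by positivity
        have t7 : 0 ≤ D₁ * |ρ k| := by positivity
        have t8 : D₂ * (|ρ k| + |μ k|) = 2 * (|c| * |ρ k|) + 2 * (|c| * |μ k|) + |κ| * |ρ k|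
            + |κ| * |μ k| + D₁ * |ρ k| + D₁ * |μ k| := by rw [hD₂]; ring
        rw [t8]
        linarith
      have hvv : |v (p k).1 - v (p (k + 1)).1| ≤ m * D₂ * |ε| * (|ρ k| + |μ k|) := by
        refine hv'.trans ?_
        rw [hstep1, sub_add_cancel_left, abs_neg, abs_mul, hε2sq, abs_pow, abs_abs]
        have t1 : |ε| ^ 2 ≤ |ε| := by nlinarith
        calc m * (|ε| ^ 2 * |S (p k) ε|) ≤ m * (|ε| * (D₂ * (|ρ k| + |μ k|))) := by gcongr
          _ = _ := by ring
      rw [eM]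
      have t1 := abs_add_le (l * μ k + e₂) (v (p k).1 - v (p (k + 1)).1)
      have t2 := abs_add_le (l * μ k) e₂
      rw [abs_mul, abs_of_pos h.l_pos] at t2
      calc _ ≤ l * |μ k| + D₁ * |ε| * (|ρ k| + |μ k|) + m * D₂ * |ε| * (|ρ k| + |μ k|) := by linarith
        _ = _ := by rw [hD₃]; ring
    · have eR : ρ (k + 1) - (1 + ε ^ 2 * c) * ρ k = ε ^ 2 * (e₃ + κ * μ k + e₁) := by
        have : ρ (k + 1) = ρ k + ε ^ 2 * S (p k) ε := by
          simp only [hρ, hstep1]; ring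
        rw [this, eS]; ring
      rw [eR, abs_mul, abs_of_nonneg (sq_nonneg ε)]
      gcongr
      have t1 := abs_add_le (e₃ + κ * μ k) e₁
      have t2 := abs_add_le e₃ (κ * μ k)
      have t3 : K * |μ k| = |κ| * |μ k| + D₁ * |μ k| := by rw [hK]; ring
      rw [t3]
      linarith
  have hzero := periodic_eq_zero (ρ := ρ) (μ := μ) hn (fun k => by simp only [hρ, hperk])
    (fun k => by simp only [hμ, hperk]) (a := ε ^ 2) (l := l) (d := D₃ * |ε|) (c := c) (K := K)
    (q := q) (by positivity) h.l_pos.le (by positivity) hK0.le hc (fun k => (key k).1)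
    (fun k => (key k).2) (by linarith) (by
      have : q * ((1 - l) / 2) ≤ q * (1 - l - D₃ * |ε|) := by
        gcongr; linarith
      linarith) (by rw [hq]; exact le_of_eq (by field_simp)) (by
      rw [hε2sq]
      nlinarith)
  intro k
  obtain ⟨z1, z2⟩ := hzero k
  simp only [hρ, hμ] at z1 z2
  have e1 : (p k).1 = ps.1 := by linarith
  rw [e1] at z2
  exact Prod.ext e1 (by linarith)

end ReturnData

/-! ### Change of coordinates -/

namespace HalfCoeffs

variable (k : HalfCoeffs)

/-- The vector field in Cartesian coordinates. -/
noncomputable def cart (g : ℝ × ℝ → ℝ) (ε : ℝ) (p : ℝ × ℝ × ℝ) : ℝ × ℝ × ℝ :=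
  (-p.2.1 + ε * Real.cos k.α * k.pert ε p.2.2, p.1 + ε * Real.sin k.α * k.pert ε p.2.2,
    -p.2.2 + g (p.1, p.2.1))

theorem radial_mul_cos_sub (θ : ℝ) :
    k.radial θ * Real.cos θ - k.angular θ * Real.sin θ = Real.cos k.α := by
  rw [radial, angular]
  have := Real.cos_sub θ (θ - k.α)
  rw [sub_sub_cancel] at this
  rw [this]; ring

theorem radial_mul_sin_add (θ : ℝ) :
    k.radial θ * Real.sin θ + k.angular θ * Real.cos θ = Real.sin k.α := by
  rw [radial, angular]
  have := Real.sin_sub θ (θ - k.α)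
  rw [sub_sub_cancel] at this
  rw [this]; ring

end HalfCoeffs

theorem Coeffs.cart_upper (c : Coeffs) (g : ℝ × ℝ → ℝ) (ε : ℝ) :
    c.upper.cart g ε = Xplus c g ε := by
  funext p
  simp only [HalfCoeffs.cart, Coeffs.upper, HalfCoeffs.pert, Xplus, Real.cos_zero, Real.sin_zero]
  ext <;> simp only
  · ring
  · ring

theorem Coeffs.cart_lower (c : Coeffs) (g : ℝ × ℝ → ℝ) (ε : ℝ) :
    c.lower.cart g ε = Xminus c g ε := by
  funext p
  simp only [HalfCoeffs.cart, Coeffs.lower, HalfCoeffs.pert, Xminus, Real.cos_pi_div_two,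
    Real.sin_pi_div_two]
  ext <;> simp only
  · ring
  · ring

/-- The point of `ℝ³` with rescaled polar coordinates `θ, R, W`. -/
noncomputable def toCart (f : ℝ × ℝ → ℝ) (r₀ ε θ : ℝ) (x : ℝ × ℝ) : ℝ × ℝ × ℝ :=
  ((r₀ + ε * x.1) * Real.cos θ, (r₀ + ε * x.1) * Real.sin θ,
    polar f θ (r₀ + ε * x.1) + ε * (Real.exp (-θ) * x.2))

/-- The fourth component of the field is dt/dθ = r / D, the inverse of the angular speed; hence the
factor in front of the Cartesian field. -/
theorem hasDerivWithinAt_toCart {k : HalfCoeffs} {f g : ℝ × ℝ → ℝ} (hf : Differentiable ℝ f)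
    (hfg : IsRotationPrimitive f g) {r₀ ε θ : ℝ} {s : Set ℝ} {X : ℝ → (ℝ × ℝ) × (ℝ × ℝ)}
    (hX : HasDerivWithinAt X (flowField (k.field f g) r₀ ε θ (X θ)) s θ)
    (hD : k.speed f ε θ (r₀ + ε * (X θ).1.1) (Real.exp (-θ) * (X θ).1.2) ≠ 0) :
    HasDerivWithinAt (fun θ => toCart f r₀ ε θ (X θ).1)
      ((flowField (k.field f g) r₀ ε θ (X θ)).2.2 •
        k.cart g ε (toCart f r₀ ε θ (X θ).1)) s θ := by
  have hR := hasDerivWithinAt_fst (hasDerivWithinAt_fst hX)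
  have hW := hasDerivWithinAt_snd (hasDerivWithinAt_fst hX)
  have hr : HasDerivWithinAt (fun θ => r₀ + ε * (X θ).1.1)
      (ε * (flowField (k.field f g) r₀ ε θ (X θ)).1.1) s θ := (hR.const_mul ε).const_add r₀
  have hid : HasDerivWithinAt (fun θ : ℝ => θ) 1 s θ := hasDerivWithinAt_id θ s
  have hx := hr.mul (Real.hasDerivAt_cos θ).hasDerivWithinAt
  have hy := hr.mul (Real.hasDerivAt_sin θ).hasDerivWithinAt
  have hp := hasDerivWithinAt_polar hf hfg hid hr
  have he : HasDerivWithinAt (fun θ : ℝ => Real.exp (-θ)) (Real.exp (-θ) * (-1)) s θ :=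
    (hasDerivAt_neg θ).exp.hasDerivWithinAt
  have hz := hp.add ((he.mul hW).const_mul ε)
  have h1 := k.radial_mul_cos_sub θ
  have h2 := k.radial_mul_sin_add θ
  convert! hx.prodMk (hy.prodMk hz) using 1
  simp only [flowField, HalfCoeffs.field, HalfCoeffs.cart, toCart,
    Prod.smul_mk, smul_eq_mul]
  have hDe : k.speed f ε θ (r₀ + ε * (X θ).1.1) (Real.exp (-θ) * (X θ).1.2) =
      (r₀ + ε * (X θ).1.1) + ε * k.angular θ * k.pert ε (polar f θ (r₀ + ε * (X θ).1.1)
        + ε * (Real.exp (-θ) * (X θ).1.2)) := rfl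
  have hee : Real.exp θ = (Real.exp (-θ))⁻¹ := by rw [Real.exp_neg, inv_inv]
  have hg : g ((r₀ + ε * (X θ).1.1) * Real.cos θ, (r₀ + ε * (X θ).1.1) * Real.sin θ) =
    polar g θ (r₀ + ε * (X θ).1.1) := rfl
  rw [hg, hee]
  have hE : Real.exp (-θ) ≠ 0 := (Real.exp_pos _).ne'
  set r := r₀ + ε * (X θ).1.1
  set P := k.pert ε (polar f θ r + ε * (Real.exp (-θ) * (X θ).1.2))
  set D := k.speed f ε θ r (Real.exp (-θ) * (X θ).1.2)
  set E := Real.exp (-θ)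
  set C := k.radial θ
  set S := k.angular θ
  refine Prod.ext ?_ (Prod.ext ?_ ?_)
  · simp only
    rw [← h1]
    field_simp
    rw [hDe]; ring
  · simp only
    rw [← h2]
    field_simp
    rw [hDe]; ring
  · simp only
    field_simp
    rw [hDe]; ring

/-- The converse passage, needed to compare an arbitrary solution with the flow: in time t the
equation in θ acquires the angular speed as a factor. -/
theorem hasDerivWithinAt_ofCart {k : HalfCoeffs} {f g : ℝ × ℝ → ℝ} (hf : Differentiable ℝ f)
    (hfg : IsRotationPrimitive f g) {r₀ ε t : ℝ} {s : Set ℝ} {Θ ρ z : ℝ → ℝ} (hε : ε ≠ 0)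
    (hρ0 : ρ t ≠ 0)
    (hD : k.speed f ε (Θ t) (ρ t) ((z t - polar f (Θ t) (ρ t)) / ε) ≠ 0)
    (hρ : HasDerivWithinAt ρ (ε * k.pert ε (z t) * k.radial (Θ t)) s t)
    (hΘ : HasDerivWithinAt Θ (1 + ε * k.pert ε (z t) / ρ t * k.angular (Θ t)) s t)
    (hz : HasDerivWithinAt z (-z t + polar g (Θ t) (ρ t)) s t) :
    HasDerivWithinAt
      (fun t => ((ρ t - r₀) / ε, Real.exp (Θ t) * ((z t - polar f (Θ t) (ρ t)) / ε)))
      ((1 + ε * k.pert ε (z t) / ρ t * k.angular (Θ t)) •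
        (k.field f g (Θ t, (r₀, ε), ((ρ t - r₀) / ε,
          Real.exp (Θ t) * ((z t - polar f (Θ t) (ρ t)) / ε)))).1) s t := by
  have hR := (hρ.sub_const r₀).div_const ε
  have hW := hΘ.exp.mul ((hz.sub (hasDerivWithinAt_polar hf hfg hΘ hρ)).div_const ε)
  convert! hR.prodMk hW using 1
  have hE : Real.exp (Θ t) ≠ 0 := (Real.exp_pos _).ne'
  have hEE : Real.exp (-Θ t) * (Real.exp (Θ t) * ((z t - polar f (Θ t) (ρ t)) / ε)) =
      (z t - polar f (Θ t) (ρ t)) / ε := by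
    rw [← mul_assoc, ← Real.exp_add]; simp
  have hrr : r₀ + ε * ((ρ t - r₀) / ε) = ρ t := by field_simp; ring
  have hzz : polar f (Θ t) (ρ t) + ε * ((z t - polar f (Θ t) (ρ t)) / ε) = z t := by
    field_simp; ring
  have hDe : k.speed f ε (Θ t) (ρ t) ((z t - polar f (Θ t) (ρ t)) / ε) =
      ρ t + ε * k.angular (Θ t) * k.pert ε (z t) := by
    rw [HalfCoeffs.speed, hzz]
  simp only [HalfCoeffs.field, hEE, hrr, hzz, Prod.smul_mk, smul_eq_mul, Pi.sub_apply]
  rw [hDe] at hD ⊢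
  set P := k.pert ε (z t)
  set C := k.radial (Θ t)
  set S := k.angular (Θ t)
  have e1 : 1 + ε * P / ρ t * S = (ρ t + ε * S * P) / ρ t := by field_simp
  rw [e1]
  refine Prod.ext ?_ ?_
  · simp only
    field_simp
  · simp only
    field_simp
    ring

/-- The increment of `R` is `ε` times the increment of `Q`, up to the term for `ε = 0`. -/
theorem radial_increment {c : Coeffs} {f g : ℝ × ℝ → ℝ} (hf : ContDiff ℝ 3 f) {r ε : ℝ}
    {X X₀ : ℝ → (ℝ × ℝ) × (ℝ × ℝ)} (hr : r ≠ 0)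
    (hX : IsTwoPieceSolution (flowField (c.upper.field f g) r ε)
      (flowField (c.lower.field f g) r ε) X)
    (hX₀ : IsTwoPieceSolution (flowField (c.upper.field f g) r 0)
      (flowField (c.lower.field f g) r 0) X₀)
    (hU : ∀ θ ∈ Icc 0 (2 * Real.pi),
      c.upper.speed f ε θ (r + ε * (X θ).1.1) (Real.exp (-θ) * (X θ).1.2) ≠ 0)
    (hL : ∀ θ ∈ Icc 0 (2 * Real.pi),
      c.lower.speed f ε θ (r + ε * (X θ).1.1) (Real.exp (-θ) * (X θ).1.2) ≠ 0)
    (h0 : (X 0).1.1 = 0) (h0' : (X 0).2.1 = 0) (h00 : (X₀ 0).1.1 = 0) :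
    (X (2 * Real.pi)).1.1 = (X₀ (2 * Real.pi)).1.1 + ε * (X (2 * Real.pi)).2.1 := by
  -- R' - R'|_{ε=0} = ε Q' is an algebraic identity once the speed is nonzero, so R - R₀ - εQ has
  -- right derivative zero.
  have key : ∀ (k : HalfCoeffs) (θ : ℝ),
      k.speed f ε θ (r + ε * (X θ).1.1) (Real.exp (-θ) * (X θ).1.2) ≠ 0 →
      (flowField (k.field f g) r ε θ (X θ)).1.1 - (flowField (k.field f g) r 0 θ (X₀ θ)).1.1
        - ε * (flowField (k.field f g) r ε θ (X θ)).2.1 = 0 := by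
    intro k θ hD
    have h1 := polar_sub_polar hf θ r (ε * (X θ).1.1)
    have hDe : k.speed f ε θ (r + ε * (X θ).1.1) (Real.exp (-θ) * (X θ).1.2) =
      (r + ε * (X θ).1.1) + ε * k.angular θ * k.pert ε (polar f θ (r + ε * (X θ).1.1)
        + ε * (Real.exp (-θ) * (X θ).1.2)) := rfl
    rw [flowField, flowField, k.field_zero_eq f g hr]
    simp only [HalfCoeffs.field]
    set q := polarQuot f θ r (ε * (X θ).1.1)
    set ρ := r + ε * (X θ).1.1
    have hP : k.pert ε (polar f θ ρ + ε * (Real.exp (-θ) * (X θ).1.2)) =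
      k.c0 + k.c1 * polar f θ r + ε * (k.c1 * (X θ).1.1 * q + k.c1 * (Real.exp (-θ) * (X θ).1.2)
        + k.c2 + k.c3 * (polar f θ ρ + ε * (Real.exp (-θ) * (X θ).1.2))) := by
      rw [HalfCoeffs.pert]
      linear_combination k.c1 * h1
    set Y := k.c1 * (X θ).1.1 * q + k.c1 * (Real.exp (-θ) * (X θ).1.2)
        + k.c2 + k.c3 * (polar f θ ρ + ε * (Real.exp (-θ) * (X θ).1.2))
    set P := k.pert ε (polar f θ ρ + ε * (Real.exp (-θ) * (X θ).1.2))
    set D := k.speed f ε θ ρ (Real.exp (-θ) * (X θ).1.2)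
    have h3 : k.c0 + k.c1 * polar f θ r = P - ε * Y := by linarith
    have h4 : ρ = D - ε * k.angular θ * P := by linarith
    rw [h3, h4]
    field_simp
    ring
  have hpi := Real.pi_pos
  have h := constant_of_has_deriv_right_zero (a := 0) (b := 2 * Real.pi)
    (f := fun θ => (X θ).1.1 - (X₀ θ).1.1 - ε * (X θ).2.1) (by
      have c1 := hX.continuousOn
      have c2 := hX₀.continuousOn
      fun_prop) (fun θ hθ => by
        have hθ' : θ ∈ Icc 0 (2 * Real.pi) := ⟨hθ.1, hθ.2.le⟩
        have d1 := hX.hasDerivWithinAt_Ici hθ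
        have d2 := hX₀.hasDerivWithinAt_Ici hθ
        have d3 := ((hasDerivWithinAt_fst (hasDerivWithinAt_fst d1)).sub
          (hasDerivWithinAt_fst (hasDerivWithinAt_fst d2))).sub
          ((hasDerivWithinAt_fst (hasDerivWithinAt_snd d1)).const_mul ε)
        convert! d3 using 1
        split_ifs
        · exact (key c.upper θ (hU θ hθ')).symm
        · exact (key c.lower θ (hL θ hθ')).symm) (2 * Real.pi) ⟨by positivity, le_rfl⟩
  simp only [h0, h0', h00] at h
  linarith

/-! ### Monotone changes of time -/

theorem mul_le_sub_of_le_deriv_right {h h' : ℝ → ℝ} {a b m : ℝ} (hc : ContinuousOn h (Icc a b))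
    (hd : ∀ x ∈ Ico a b, HasDerivWithinAt h (h' x) (Ici x) x) (hm : ∀ x ∈ Ico a b, m ≤ h' x)
    (hab : a ≤ b) : m * (b - a) ≤ h b - h a := by
  have := image_le_of_deriv_right_le_deriv_boundary (f := fun x => h a + m * (x - a))
    (f' := fun _ => m) (B := h) (B' := h') (a := a) (b := b) (by fun_prop) (fun x _ => by
      have : HasDerivAt (fun x : ℝ => h a + m * (x - a)) (m * 1) x :=
        (((hasDerivAt_id x).sub_const a).const_mul m).const_add (h a)
      rw [mul_one] at this
      exact this.hasDerivWithinAt) (by simp) hc hd hm (right_mem_Icc.2 hab)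
  linarith

/-- The inverse of an increasing function has one-sided derivatives. -/
theorem hasDerivWithinAt_inverse {τ σ : ℝ → ℝ} {m a : ℝ} {s t : Set ℝ}
    (hτ : HasDerivWithinAt τ m s (σ a)) (hm : m ≠ 0) (hσ : ContinuousWithinAt σ t a)
    (hmaps : MapsTo σ t s) (hinv : ∀ x ∈ t, τ (σ x) = x) (ha : a ∈ t) :
    HasDerivWithinAt σ m⁻¹ t a := by
  have h1 : HasFDerivWithinAt τ ((ContinuousLinearEquiv.unitsEquivAut ℝ (Units.mk0 m hm) :
      ℝ ≃L[ℝ] ℝ) : ℝ →L[ℝ] ℝ) s (σ a) := by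
    convert! hτ.hasFDerivWithinAt using 1
  have h2 := HasFDerivWithinAt.of_local_left_inverse (hσ.tendsto_nhdsWithin hmaps) h1 ha
    (eventually_mem_nhdsWithin.mono hinv)
  convert! h2.hasDerivWithinAt using 1
  simp

/-! ### Construction of the crossing solution -/

/-- The extension is t ↦ φ₀(t - ⌊t / T⌋ T). At multiples of T the left derivative comes from the end
of the lower arc and the right one from the start of the upper arc. Minimality of T holds because φ₀
does not meet its starting point in between. -/
theorem exists_periodic_extension {Xp Xm : ℝ × ℝ × ℝ → ℝ × ℝ × ℝ} {φ₀ : ℝ → ℝ × ℝ × ℝ} {t₁ T : ℝ}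
    (ht₁ : 0 < t₁) (ht₁T : t₁ < T) (hper : φ₀ T = φ₀ 0)
    (hU : ∀ t ∈ Icc 0 t₁, HasDerivWithinAt φ₀ (Xp (φ₀ t)) (Icc 0 t₁) t)
    (hL : ∀ t ∈ Icc t₁ T, HasDerivWithinAt φ₀ (Xm (φ₀ t)) (Icc t₁ T) t)
    (hpos : ∀ t ∈ Ioo 0 t₁, 0 < (φ₀ t).2.1) (hneg : ∀ t ∈ Ioo t₁ T, (φ₀ t).2.1 < 0)
    (c0 : IsCrossingPoint Xp Xm (φ₀ 0)) (u0 : 0 < (Xp (φ₀ 0)).2.1)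
    (c1 : IsCrossingPoint Xp Xm (φ₀ t₁)) (u1 : (Xp (φ₀ t₁)).2.1 < 0)
    (hinj : ∀ t ∈ Ioo 0 T, φ₀ t ≠ φ₀ 0) :
    ∃ φ : ℝ → ℝ × ℝ × ℝ, IsCrossingSolution Xp Xm φ ∧ (∀ t ∈ Icc 0 T, φ t = φ₀ t) ∧
      IsLeast {S : ℝ | 0 < S ∧ Function.Periodic φ S} T ∧ range φ = φ₀ '' Icc 0 T := by
  have hT : 0 < T := ht₁.trans ht₁T
  set φ : ℝ → ℝ × ℝ × ℝ := fun t => φ₀ (t - ⌊t / T⌋ * T) with hφ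
  -- The formula includes s = T, where the floor jumps by one and φ₀ T = φ₀ 0 compensates; this
  -- permits one-sided derivatives at the ends of closed arcs.
  have A : ∀ (n : ℤ) (s : ℝ), s ∈ Icc 0 T → φ (n * T + s) = φ₀ s := by
    intro n s hs
    rcases hs.2.lt_or_eq with h | h
    · have : ⌊(n * T + s) / T⌋ = n := by
        rw [Int.floor_eq_iff, le_div_iff₀ hT, div_lt_iff₀ hT]
        constructor <;> nlinarith [hs.1]
      simp only [hφ, this, add_sub_cancel_left]
    · have : ⌊(n * T + s) / T⌋ = n + 1 := by
        rw [Int.floor_eq_iff, le_div_iff₀ hT, div_lt_iff₀ hT]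
        push_cast
        constructor <;> nlinarith
      simp only [hφ, this]
      rw [h, hper]
      congr 1
      push_cast
      ring
  have A0 : ∀ t ∈ Icc 0 T, φ t = φ₀ t := fun t ht => by
    have := A 0 t ht
    simpa using this
  have B : ∀ (n : ℤ) (a b s : ℝ) (v : ℝ × ℝ × ℝ), 0 ≤ a → b ≤ T → s ∈ Icc a b →
      HasDerivWithinAt φ₀ v (Icc a b) s →
      HasDerivWithinAt φ v (Icc (n * T + a) (n * T + b)) (n * T + s) := by
    intro n a b s v ha hb hs hd
    have h1 : HasDerivWithinAt (fun t : ℝ => t - n * T) 1 (Icc (n * T + a) (n * T + b))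
        (n * T + s) := (hasDerivWithinAt_id _ _).sub_const _
    have h2 : HasDerivWithinAt φ₀ v (Icc a b) (n * T + s - n * T) := by
      rwa [add_sub_cancel_left]
    have hm : MapsTo (fun t : ℝ => t - n * T) (Icc (n * T + a) (n * T + b)) (Icc a b) :=
      fun t ht => ⟨by linarith [ht.1], by linarith [ht.2]⟩
    have h3 := HasDerivWithinAt.scomp (n * T + s) h2 h1 hm
    rw [one_smul] at h3
    have h4 : ∀ t ∈ Icc (n * T + a) (n * T + b), φ t = (φ₀ ∘ fun t : ℝ => t - n * T) t := by
      intro t ht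
      have := A n (t - n * T) ⟨by linarith [ht.1], by linarith [ht.2]⟩
      rw [add_sub_cancel] at this
      rw [this, Function.comp_apply]
    exact h3.congr h4 (h4 _ ⟨by linarith [hs.1], by linarith [hs.2]⟩)
  have y0 : (φ₀ 0).2.1 = 0 := c0.1
  have y1 : (φ₀ t₁).2.1 = 0 := c1.1
  have split : ∀ t : ℝ, ∃ (n : ℤ) (s : ℝ), t = n * T + s ∧
      (s = 0 ∨ s ∈ Ioo 0 t₁ ∨ s = t₁ ∨ s ∈ Ioo t₁ T) := by
    intro t
    refine ⟨⌊t / T⌋, t - ⌊t / T⌋ * T, by ring, ?_⟩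
    have h1 := Int.floor_le (t / T)
    have h2 := Int.lt_floor_add_one (t / T)
    rw [le_div_iff₀ hT] at h1
    rw [div_lt_iff₀ hT] at h2
    have h3 : 0 ≤ t - ⌊t / T⌋ * T := by linarith
    have h4 : t - ⌊t / T⌋ * T < T := by linarith
    rcases h3.eq_or_lt with h | h
    · exact Or.inl h.symm
    · rcases lt_trichotomy (t - ⌊t / T⌋ * T) t₁ with h5 | h5 | h5
      · exact Or.inr (Or.inl ⟨h, h5⟩)
      · exact Or.inr (Or.inr (Or.inl h5))
      · exact Or.inr (Or.inr (Or.inr ⟨h5, h4⟩))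
  have m0 : (0 : ℝ) ∈ Icc 0 T := ⟨le_rfl, hT.le⟩
  have m1 : t₁ ∈ Icc 0 T := ⟨ht₁.le, ht₁T.le⟩
  have mU : ∀ s ∈ Ioo 0 t₁, s ∈ Icc 0 T := fun s hs => ⟨hs.1.le, (hs.2.trans ht₁T).le⟩
  have mL : ∀ s ∈ Ioo t₁ T, s ∈ Icc 0 T := fun s hs => ⟨(ht₁.trans hs.1).le, hs.2.le⟩
  refine ⟨φ, ⟨?_, ?_, ?_, ?_, ?_⟩, A0, ⟨⟨hT, ?_⟩, ?_⟩, ?_⟩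
  · intro t ht
    obtain ⟨n, s, rfl, rfl | h | rfl | h⟩ := split t
    · rw [A n _ m0, y0] at ht; exact absurd ht (lt_irrefl _)
    · rw [A n s (mU s h)]
      exact (B n 0 t₁ s _ le_rfl ht₁T.le ⟨h.1.le, h.2.le⟩ (hU s ⟨h.1.le, h.2.le⟩)).hasDerivAt
        (Icc_mem_nhds (by linarith [h.1]) (by linarith [h.2]))
    · rw [A n _ m1, y1] at ht; exact absurd ht (lt_irrefl _)
    · rw [A n s (mL s h)] at ht; exact absurd ht (hneg s h).not_gt
  · intro t ht
    obtain ⟨n, s, rfl, rfl | h | rfl | h⟩ := split t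
    · rw [A n _ m0, y0] at ht; exact absurd ht (lt_irrefl _)
    · rw [A n s (mU s h)] at ht; exact absurd ht (hpos s h).not_gt
    · rw [A n _ m1, y1] at ht; exact absurd ht (lt_irrefl _)
    · rw [A n s (mL s h)]
      exact (B n t₁ T s _ ht₁.le le_rfl ⟨h.1.le, h.2.le⟩ (hL s ⟨h.1.le, h.2.le⟩)).hasDerivAt
        (Icc_mem_nhds (by linarith [h.1]) (by linarith [h.2]))
  · intro t ht
    obtain ⟨n, s, rfl, rfl | h | rfl | h⟩ := split t
    · rw [A n _ m0]; exact c0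
    · rw [A n s (mU s h)] at ht; exact absurd ht (hpos s h).ne'
    · rw [A n _ m1]; exact c1
    · rw [A n s (mL s h)] at ht; exact absurd ht (hneg s h).ne
  · intro t ht hup
    obtain ⟨n, s, rfl, rfl | h | rfl | h⟩ := split t
    · rw [A n _ m0]
      constructor
      · have h1 := B (n - 1) t₁ T T _ ht₁.le le_rfl ⟨ht₁T.le, le_rfl⟩ (hL T ⟨ht₁T.le, le_rfl⟩)
        have e1 : ((n - 1 : ℤ) : ℝ) * T + T = n * T + 0 := by push_cast; ring
        have e2 : ((n - 1 : ℤ) : ℝ) * T + t₁ < n * T + 0 := by push_cast; nlinarith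
        rw [e1, hper] at h1
        exact h1.mono_of_mem_nhdsWithin (Icc_mem_nhdsLE e2)
      · have h1 := B n 0 t₁ 0 _ le_rfl ht₁T.le ⟨le_rfl, ht₁.le⟩ (hU 0 ⟨le_rfl, ht₁.le⟩)
        exact h1.mono_of_mem_nhdsWithin (Icc_mem_nhdsGE (by linarith))
    · rw [A n s (mU s h)] at ht; exact absurd ht (hpos s h).ne'
    · rw [A n _ m1] at hup; exact absurd hup u1.not_gt
    · rw [A n s (mL s h)] at ht; exact absurd ht (hneg s h).ne
  · intro t ht hup
    obtain ⟨n, s, rfl, rfl | h | rfl | h⟩ := split t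
    · rw [A n _ m0] at hup; exact absurd hup u0.not_gt
    · rw [A n s (mU s h)] at ht; exact absurd ht (hpos s h).ne'
    · rw [A n _ m1]
      constructor
      · have h1 := B n 0 s s _ le_rfl ht₁T.le ⟨ht₁.le, le_rfl⟩ (hU s ⟨ht₁.le, le_rfl⟩)
        exact h1.mono_of_mem_nhdsWithin (Icc_mem_nhdsLE (by linarith))
      · have h1 := B n s T s _ ht₁.le le_rfl ⟨le_rfl, ht₁T.le⟩ (hL s ⟨le_rfl, ht₁T.le⟩)
        exact h1.mono_of_mem_nhdsWithin (Icc_mem_nhdsGE (by linarith))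
    · rw [A n s (mL s h)] at ht; exact absurd ht (hneg s h).ne
  · intro t
    have : (t + T) / T = t / T + 1 := by field_simp
    simp only [hφ, this, Int.floor_add_one]
    push_cast
    congr 1
    ring
  · rintro S ⟨hS, hSper⟩
    by_contra hlt
    rw [not_le] at hlt
    have h1 := hSper 0
    rw [zero_add, A0 S ⟨hS.le, hlt.le⟩, A0 0 m0] at h1
    exact hinj S ⟨hS, hlt⟩ h1
  · ext p
    constructor
    · rintro ⟨t, rfl⟩
      obtain ⟨n, s, rfl, h⟩ := split t
      have hs : s ∈ Icc 0 T := by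
        rcases h with rfl | h | rfl | h
        · exact m0
        · exact mU s h
        · exact m1
        · exact mL s h
      exact ⟨s, hs, (A n s hs).symm⟩
    · rintro ⟨s, hs, rfl⟩
      exact ⟨s, A0 s hs⟩

/-- The radius is positive and the angular speed lies between `1 / 2` and `2`. -/
def GoodSpeed (k : HalfCoeffs) (f : ℝ × ℝ → ℝ) (r ε : ℝ) (X : ℝ → (ℝ × ℝ) × (ℝ × ℝ)) : Prop :=
  ∀ θ ∈ Icc 0 (2 * Real.pi), 0 < r + ε * (X θ).1.1 ∧
    (r + ε * (X θ).1.1) / 2 ≤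
      k.speed f ε θ (r + ε * (X θ).1.1) (Real.exp (-θ) * (X θ).1.2) ∧
    k.speed f ε θ (r + ε * (X θ).1.1) (Real.exp (-θ) * (X θ).1.2) ≤ 2 * (r + ε * (X θ).1.1)

theorem GoodSpeed.pos {k : HalfCoeffs} {f : ℝ × ℝ → ℝ} {r ε : ℝ} {X : ℝ → (ℝ × ℝ) × (ℝ × ℝ)}
    (h : GoodSpeed k f r ε X) {θ : ℝ} (hθ : θ ∈ Icc 0 (2 * Real.pi)) :
    0 < k.speed f ε θ (r + ε * (X θ).1.1) (Real.exp (-θ) * (X θ).1.2) := by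
  obtain ⟨h1, h2, -⟩ := h θ hθ
  linarith

theorem GoodSpeed.le_time {k : HalfCoeffs} {f g : ℝ × ℝ → ℝ} {r ε : ℝ}
    {X : ℝ → (ℝ × ℝ) × (ℝ × ℝ)} (h : GoodSpeed k f r ε X) {θ : ℝ}
    (hθ : θ ∈ Icc 0 (2 * Real.pi)) :
    1 / 2 ≤ (flowField (k.field f g) r ε θ (X θ)).2.2 := by
  obtain ⟨h1, h2, h3⟩ := h θ hθ
  change _ ≤ (r + ε * (X θ).1.1) / k.speed f ε θ (r + ε * (X θ).1.1) (Real.exp (-θ) * (X θ).1.2)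
  rw [le_div_iff₀ (h.pos hθ)]
  linarith

/-- Positivity of the speed is thus what makes the points on the plane crossing points: for the
upper field the y-component is x, which there has the sign of cos θ. -/
theorem Xminus_toCart_of_sin_eq_zero (c : Coeffs) (f g : ℝ × ℝ → ℝ) (r ε : ℝ) {θ : ℝ} (x : ℝ × ℝ)
    (hθ : Real.sin θ = 0) : (Xminus c g ε (toCart f r ε θ x)).2.1 =
      Real.cos θ * c.lower.speed f ε θ (r + ε * x.1) (Real.exp (-θ) * x.2) := by
  have h1 : Real.cos θ * Real.cos θ = 1 := by
    have := Real.cos_sq_add_sin_sq θ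
    rw [hθ] at this; linarith
  simp only [← Coeffs.cart_lower, HalfCoeffs.cart, HalfCoeffs.speed, Coeffs.lower_angular, toCart]
  simp only [Coeffs.lower, Real.sin_pi_div_two]
  set P := HalfCoeffs.pert _ ε _
  linear_combination (-(ε * P)) * h1

/-- The solution in θ is reparametrised by the inverse σ of the time τ, which grows at rate at least
1/2 because the angular speed is at most 2. `hR` and `hW` close the orbit after one turn; as σ is
increasing, y has the sign of sin σ. -/
theorem exists_crossingSolution {c : Coeffs} {f g : ℝ × ℝ → ℝ} (hf : Differentiable ℝ f)
    (hfg : IsRotationPrimitive f g) {r ε V : ℝ} {X : ℝ → (ℝ × ℝ) × (ℝ × ℝ)}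
    (hX0 : X 0 = ((0, V), (0, 0)))
    (hX : IsTwoPieceSolution (flowField (c.upper.field f g) r ε)
      (flowField (c.lower.field f g) r ε) X)
    (hU : GoodSpeed c.upper f r ε X) (hL : GoodSpeed c.lower f r ε X)
    (hR : (X (2 * Real.pi)).1.1 = 0) (hW : Real.exp (-(2 * Real.pi)) * (X (2 * Real.pi)).1.2 = V) :
    ∃ φ : ℝ → ℝ × ℝ × ℝ, IsCrossingSolution (Xplus c g ε) (Xminus c g ε) φ ∧
      IsLeast {S : ℝ | 0 < S ∧ Function.Periodic φ S} (X (2 * Real.pi)).2.2 ∧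
      range φ = (fun θ => toCart f r ε θ (X θ).1) '' Icc 0 (2 * Real.pi) ∧
      (∃ t, (φ t).2.1 = 0) ∧
      ∀ t ∈ Icc 0 (X (2 * Real.pi)).2.2, ∃ θ ∈ Icc 0 (2 * Real.pi), t = (X θ).2.2 ∧
        φ t = toCart f r ε θ (X θ).1 := by
  have hpi := Real.pi_pos
  set Z : ℝ → ℝ × ℝ × ℝ := fun θ => toCart f r ε θ (X θ).1 with hZ
  set τ : ℝ → ℝ := fun θ => (X θ).2.2 with hτ
  have τc : ContinuousOn τ (Icc 0 (2 * Real.pi)) :=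
    (continuous_snd.comp continuous_snd).comp_continuousOn hX.continuousOn
  have τ0 : τ 0 = 0 := by simp [hτ, hX0]
  have τexp : ∀ a ∈ Icc 0 (2 * Real.pi), ∀ b ∈ Icc 0 (2 * Real.pi), a ≤ b →
      1 / 2 * (b - a) ≤ τ b - τ a := by
    intro a ha b hb hab
    have hs : Icc a b ⊆ Icc 0 (2 * Real.pi) := Icc_subset_Icc ha.1 hb.2
    refine mul_le_sub_of_le_deriv_right (τc.mono hs) (fun x hx => hasDerivWithinAt_snd
      (hasDerivWithinAt_snd (hX.hasDerivWithinAt_Ici ⟨ha.1.trans hx.1, hx.2.trans_le hb.2⟩)))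
      (fun x hx => ?_) hab
    have hx' := hs ⟨hx.1, hx.2.le⟩
    split_ifs
    · exact hU.le_time hx'
    · exact hL.le_time hx'
  have m0 : (0 : ℝ) ∈ Icc 0 (2 * Real.pi) := ⟨le_rfl, by linarith⟩
  have m1 : Real.pi ∈ Icc 0 (2 * Real.pi) := ⟨hpi.le, by linarith⟩
  have m2 : 2 * Real.pi ∈ Icc 0 (2 * Real.pi) := ⟨by linarith, le_rfl⟩
  have τmono : StrictMonoOn τ (Icc 0 (2 * Real.pi)) := by
    intro a ha b hb hab
    have := τexp a ha b hb hab.le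
    linarith
  set T := τ (2 * Real.pi) with hT
  set t₁ := τ Real.pi with ht₁
  have ht₁0 : 0 < t₁ := by rw [← τ0]; exact τmono m0 m1 hpi
  have ht₁T : t₁ < T := τmono m1 m2 (by linarith)
  have τsurj : ∀ t ∈ Icc 0 T, ∃ θ ∈ Icc 0 (2 * Real.pi), τ θ = t := by
    intro t ht
    have := intermediate_value_Icc (by linarith : (0 : ℝ) ≤ 2 * Real.pi) τc
    rw [τ0] at this
    exact this ht
  choose! σ hσ hτσ using τsurj
  have τmem : ∀ θ ∈ Icc 0 (2 * Real.pi), τ θ ∈ Icc 0 T := by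
    intro θ hθ
    refine ⟨?_, τmono.monotoneOn hθ m2 hθ.2⟩
    rw [← τ0]
    exact τmono.monotoneOn m0 hθ hθ.1
  have στ : ∀ θ ∈ Icc 0 (2 * Real.pi), σ (τ θ) = θ := fun θ hθ =>
    τmono.injOn (hσ _ (τmem θ hθ)) hθ (hτσ _ (τmem θ hθ))
  have σmono : ∀ s ∈ Icc 0 T, ∀ t ∈ Icc 0 T, s < t → σ s < σ t := by
    intro s hs t ht hst
    by_contra hlt
    have := τmono.monotoneOn (hσ t ht) (hσ s hs) (not_lt.1 hlt)
    rw [hτσ t ht, hτσ s hs] at this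
    linarith
  have σlip : ∀ s ∈ Icc 0 T, ∀ t ∈ Icc 0 T, |σ s - σ t| ≤ 2 * |s - t| := by
    have aux : ∀ s ∈ Icc 0 T, ∀ t ∈ Icc 0 T, σ s ≤ σ t → |σ s - σ t| ≤ 2 * |s - t| := by
      intro s hs t ht h
      have := τexp _ (hσ s hs) _ (hσ t ht) h
      rw [hτσ s hs, hτσ t ht] at this
      rw [abs_sub_comm, abs_of_nonneg (sub_nonneg.2 h), abs_sub_comm]
      have := le_abs_self (t - s)
      linarith
    intro s hs t ht
    rcases le_total (σ s) (σ t) with h | h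
    · exact aux s hs t ht h
    · rw [abs_sub_comm, abs_sub_comm s]; exact aux t ht s hs h
  have σcont : ContinuousOn σ (Icc 0 T) := by
    refine LipschitzOnWith.continuousOn (K := 2) (LipschitzOnWith.of_dist_le_mul ?_)
    intro s hs t ht
    rw [Real.dist_eq, Real.dist_eq]
    exact σlip s hs t ht
  have σ0 : σ 0 = 0 := by have := στ 0 m0; rwa [τ0] at this
  have σ1 : σ t₁ = Real.pi := στ _ m1
  have σ2 : σ T = 2 * Real.pi := στ _ m2
  have sub1 : Icc 0 t₁ ⊆ Icc 0 T := Icc_subset_Icc_right ht₁T.le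
  have sub2 : Icc t₁ T ⊆ Icc 0 T := Icc_subset_Icc_left ht₁0.le
  have σmono' : ∀ s ∈ Icc 0 T, ∀ t ∈ Icc 0 T, s ≤ t → σ s ≤ σ t := by
    intro s hs t ht hst
    rcases hst.eq_or_lt with h | h
    · rw [h]
    · exact (σmono s hs t ht h).le
  have m0' : (0 : ℝ) ∈ Icc 0 T := ⟨le_rfl, (ht₁0.trans ht₁T).le⟩
  have m1' : t₁ ∈ Icc 0 T := ⟨ht₁0.le, ht₁T.le⟩
  have m2' : T ∈ Icc 0 T := ⟨(ht₁0.trans ht₁T).le, le_rfl⟩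
  have maps1 : MapsTo σ (Icc 0 t₁) (Icc 0 Real.pi) := by
    intro t ht
    refine ⟨(hσ t (sub1 ht)).1, ?_⟩
    rw [← σ1]
    exact σmono' _ (sub1 ht) _ m1' ht.2
  have maps2 : MapsTo σ (Icc t₁ T) (Icc Real.pi (2 * Real.pi)) := by
    intro t ht
    refine ⟨?_, (hσ t (sub2 ht)).2⟩
    rw [← σ1]
    exact σmono' _ m1' _ (sub2 ht) ht.1
  have dU : ∀ t ∈ Icc 0 t₁, HasDerivWithinAt (Z ∘ σ) (Xplus c g ε ((Z ∘ σ) t)) (Icc 0 t₁) t := by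
    intro t ht
    have ht' := hσ t (sub1 ht)
    have hd := hX.left (σ t) (maps1 ht)
    have hz := hasDerivWithinAt_toCart hf hfg hd (hU.pos ht').ne'
    have hm := hU.le_time (g := g) ht'
    have hi := hasDerivWithinAt_inverse (hasDerivWithinAt_snd (hasDerivWithinAt_snd hd))
      (by linarith) ((σcont.mono sub1) t ht) maps1 (fun x hx => hτσ x (sub1 hx)) ht
    have := HasDerivWithinAt.scomp t hz hi maps1
    rw [smul_smul, inv_mul_cancel₀ (by linarith), one_smul, Coeffs.cart_upper] at this
    exact this
  have dL : ∀ t ∈ Icc t₁ T, HasDerivWithinAt (Z ∘ σ) (Xminus c g ε ((Z ∘ σ) t)) (Icc t₁ T) t := by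
    intro t ht
    have ht' := hσ t (sub2 ht)
    have hd := hX.right (σ t) (maps2 ht)
    have hz := hasDerivWithinAt_toCart hf hfg hd (hL.pos ht').ne'
    have hm := hL.le_time (g := g) ht'
    have hi := hasDerivWithinAt_inverse (hasDerivWithinAt_snd (hasDerivWithinAt_snd hd))
      (by linarith) ((σcont.mono sub2) t ht) maps2 (fun x hx => hτσ x (sub2 hx)) ht
    have := HasDerivWithinAt.scomp t hz hi maps2
    rw [smul_smul, inv_mul_cancel₀ (by linarith), one_smul, Coeffs.cart_lower] at this
    exact this
  have Zper : Z (2 * Real.pi) = Z 0 := by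
    simp only [hZ, toCart, hR, hX0, polar, Real.cos_two_pi, Real.sin_two_pi, Real.cos_zero,
      Real.sin_zero, neg_zero, Real.exp_zero, hW, one_mul]
  have hr0 : 0 < r := by
    have := (hU 0 m0).1
    simpa [hX0] using this
  have Z0 : (Z 0).1 = r ∧ (Z 0).2.1 = 0 := by simp [hZ, toCart, hX0]
  have Z1 : (Z Real.pi).1 = -(r + ε * (X Real.pi).1.1) ∧ (Z Real.pi).2.1 = 0 := by
    simp [hZ, toCart]
  have Xm0 : 0 < (Xminus c g ε (Z 0)).2.1 := by
    simp only [hZ]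
    rw [Xminus_toCart_of_sin_eq_zero c f g r ε _ Real.sin_zero, Real.cos_zero, one_mul]
    exact hL.pos m0
  have Xm1 : (Xminus c g ε (Z Real.pi)).2.1 < 0 := by
    simp only [hZ]
    rw [Xminus_toCart_of_sin_eq_zero c f g r ε _ Real.sin_pi, Real.cos_pi]
    linarith [hL.pos m1]
  have Xp0 : 0 < (Xplus c g ε (Z 0)).2.1 := by
    change 0 < (Z 0).1
    rw [Z0.1]; exact hr0
  have Xp1 : (Xplus c g ε (Z Real.pi)).2.1 < 0 := by
    change (Z Real.pi).1 < 0
    rw [Z1.1]; linarith [(hU _ m1).1]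
  obtain ⟨φ, h1, h2, h3, h4⟩ := exists_periodic_extension (Xp := Xplus c g ε) (Xm := Xminus c g ε)
    (φ₀ := Z ∘ σ) ht₁0 ht₁T (by simp only [Function.comp_apply, σ0, σ2, Zper]) dU dL
    (by
      intro t ht
      have ha := maps1 ⟨ht.1.le, ht.2.le⟩
      have hb := σmono _ m0' t (sub1 ⟨ht.1.le, ht.2.le⟩) ht.1
      have hc := σmono t (sub1 ⟨ht.1.le, ht.2.le⟩) _ m1' ht.2
      rw [σ0] at hb
      rw [σ1] at hc
      exact mul_pos (hU _ (hσ t (sub1 ⟨ht.1.le, ht.2.le⟩))).1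
        (Real.sin_pos_of_pos_of_lt_pi hb hc))
    (by
      intro t ht
      have hb := σmono _ m1' t (sub2 ⟨ht.1.le, ht.2.le⟩) ht.1
      have hc := σmono t (sub2 ⟨ht.1.le, ht.2.le⟩) _ m2' ht.2
      rw [σ1] at hb
      rw [σ2] at hc
      have hs : Real.sin (σ t) < 0 := by
        have := Real.sin_pos_of_pos_of_lt_pi (x := σ t - Real.pi) (by linarith) (by linarith)
        rw [Real.sin_sub_pi] at this
        linarith
      exact mul_neg_of_pos_of_neg (hU _ (hσ t (sub2 ⟨ht.1.le, ht.2.le⟩))).1 hs)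
    (by
      simp only [Function.comp_apply, σ0]
      exact ⟨Z0.2, mul_pos Xp0 Xm0⟩)
    (by simp only [Function.comp_apply, σ0]; exact Xp0)
    (by
      simp only [Function.comp_apply, σ1]
      exact ⟨Z1.2, mul_pos_of_neg_of_neg Xp1 Xm1⟩)
    (by simp only [Function.comp_apply, σ1]; exact Xp1)
    (by
      intro t ht heq
      have ht' : t ∈ Icc 0 T := ⟨ht.1.le, ht.2.le⟩
      have hb := σmono _ m0' t ht' ht.1
      have hc := σmono t ht' _ m2' ht.2
      rw [σ0] at hb
      rw [σ2] at hc
      simp only [Function.comp_apply, σ0] at heq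
      have hy : (r + ε * (X (σ t)).1.1) * Real.sin (σ t) = 0 := by
        have := congrArg (fun p => p.2.1) heq
        simp only [Z0.2] at this
        exact this
      have hx : (r + ε * (X (σ t)).1.1) * Real.cos (σ t) = r := by
        have := congrArg (fun p => p.1) heq
        simp only [Z0.1] at this
        exact this
      have hρ := (hU _ (hσ t ht')).1
      have hs : Real.sin (σ t) = 0 := (mul_eq_zero.1 hy).resolve_left hρ.ne'
      have hcpos : 0 < Real.cos (σ t) := by
        by_contra hcon
        nlinarith
      -- The half-angle formulas exclude sin = 0 with cos > 0 strictly between 0 and 2π, so the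
      -- starting point is not met again.
      have hs2 : Real.sin (σ t / 2) = 0 ∨ Real.cos (σ t / 2) = 0 := by
        have := Real.sin_two_mul (σ t / 2)
        rw [mul_div_cancel₀ _ (two_ne_zero)] at this
        rw [hs] at this
        have h := mul_eq_zero.1 this.symm
        rcases h with h | h
        · exact Or.inl (by linarith)
        · exact Or.inr h
      rcases hs2 with h | h
      · have := Real.sin_pos_of_pos_of_lt_pi (x := σ t / 2) (by linarith) (by linarith)
        linarith
      · have := Real.cos_sq' (σ t / 2)
        have h5 := Real.cos_two_mul (σ t / 2)
        rw [mul_div_cancel₀ _ (two_ne_zero), h] at h5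
        linarith)
  refine ⟨φ, h1, h3, ?_, ⟨0, ?_⟩, fun t ht => ⟨σ t, hσ t ht, (hτσ t ht).symm, h2 t ht⟩⟩
  · rw [h4, image_comp]
    congr 1
    ext θ
    constructor
    · rintro ⟨t, ht, rfl⟩
      exact hσ t ht
    · intro hθ
      exact ⟨τ θ, τmem θ hθ, στ θ hθ⟩
  · rw [h2 0 m0', Function.comp_apply, σ0]
    exact Z0.2

/-! ### Polar coordinates along a crossing solution -/

namespace IsCrossingSolution

variable {c : Coeffs} {g : ℝ × ℝ → ℝ} {ε : ℝ} {ψ : ℝ → ℝ × ℝ × ℝ}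

/-- On the plane the crossing condition rules out a vanishing y-component of `Xp`, so one of the
clauses `upward`, `downward` supplies both one-sided derivatives. -/
theorem continuous {Xp Xm : ℝ × ℝ × ℝ → ℝ × ℝ × ℝ} (h : IsCrossingSolution Xp Xm ψ) :
    Continuous ψ := by
  rw [continuous_iff_continuousAt]
  intro t
  rcases lt_trichotomy (ψ t).2.1 0 with hy | hy | hy
  · exact (h.lower t hy).continuousAt
  · have hc := (h.crossing t hy).2
    rw [continuousAt_iff_continuous_left_right]
    rcases lt_trichotomy (Xp (ψ t)).2.1 0 with hp | hp | hp
    · exact ⟨(h.downward t hy hp).1.continuousWithinAt, (h.downward t hy hp).2.continuousWithinAt⟩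
    · rw [hp, zero_mul] at hc; exact absurd hc (lt_irrefl _)
    · exact ⟨(h.upward t hy hp).1.continuousWithinAt, (h.upward t hy hp).2.continuousWithinAt⟩
  · exact (h.upper t hy).continuousAt

/-- The right derivative depends on the current point only: on y = 0 the sign of x, which is the
y-component of `Xplus`, decides which half-space is entered. -/
theorem hasDerivWithinAt_Ici (h : IsCrossingSolution (Xplus c g ε) (Xminus c g ε) ψ) (t : ℝ) :
    ((0 < (ψ t).2.1 ∨ (ψ t).2.1 = 0 ∧ 0 < (ψ t).1) ∧
        HasDerivWithinAt ψ (c.upper.cart g ε (ψ t)) (Ici t) t) ∨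
      (((ψ t).2.1 < 0 ∨ (ψ t).2.1 = 0 ∧ (ψ t).1 < 0) ∧
        HasDerivWithinAt ψ (c.lower.cart g ε (ψ t)) (Ici t) t) := by
  rw [Coeffs.cart_upper, Coeffs.cart_lower]
  rcases lt_trichotomy (ψ t).2.1 0 with hy | hy | hy
  · exact Or.inr ⟨Or.inl hy, (h.lower t hy).hasDerivWithinAt⟩
  · have hc : 0 < (ψ t).1 * (Xminus c g ε (ψ t)).2.1 := (h.crossing t hy).2
    rcases lt_trichotomy (ψ t).1 0 with hp | hp | hp
    · exact Or.inr ⟨Or.inr ⟨hy, hp⟩, (h.downward t hy hp).2⟩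
    · rw [hp, zero_mul] at hc; exact absurd hc (lt_irrefl _)
    · exact Or.inl ⟨Or.inr ⟨hy, hp⟩, (h.upward t hy hp).2⟩
  · exact Or.inl ⟨Or.inl hy, (h.upper t hy).hasDerivWithinAt⟩

end IsCrossingSolution

/-- A continuous logarithm of a curve has one-sided derivatives. -/
theorem hasDerivWithinAt_of_exp_eq {L u : ℝ → ℂ} {u' : ℂ} {t : ℝ} {s : Set ℝ} (hL : Continuous L)
    (hLu : ∀ t, Complex.exp (L t) = u t) (hu : HasDerivWithinAt u u' s t) :
    HasDerivWithinAt L (u' / u t) s t := by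
  have hne : u t ≠ 0 := by rw [← hLu]; exact Complex.exp_ne_zero _
  have h1 : HasDerivWithinAt (fun x => u x / u t) (u' / u t) s t := hu.div_const _
  have h2 := HasDerivWithinAt.clog_real h1 (by rw [div_self hne]; exact Complex.one_mem_slitPlane)
  rw [div_self hne, div_one] at h2
  refine (h2.const_add (L t)).congr_of_eventuallyEq ?_ (by simp [div_self hne])
  refine eventually_nhdsWithin_of_eventually_nhds ?_
  -- Near t the imaginary part of L x - L t stays below π in absolute value, so the principal
  -- logarithm of u x / u t is L x - L t.
  have h3 : ∀ᶠ x in 𝓝 t, |(L x - L t).im| < Real.pi := by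
    have hc : Continuous fun x => |(L x - L t).im| := by fun_prop
    refine hc.continuousAt.eventually_lt continuousAt_const ?_
    simpa using Real.pi_pos
  filter_upwards [h3] with x hx
  have h4 := abs_lt.1 hx
  rw [← hLu, ← hLu, ← Complex.exp_sub, Complex.log_exp h4.1 h4.2.le]
  ring

/-- The curve lifts through the covering exp of ℂ minus 0, starting at the principal logarithm of u
0. -/
theorem exists_continuous_log {u : ℝ → ℂ} (hu : Continuous u) (h0 : ∀ t, u t ≠ 0) :
    ∃ L : ℝ → ℂ, Continuous L ∧ ∀ t, Complex.exp (L t) = u t := by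
  obtain ⟨L, ⟨-, hL⟩, -⟩ := Complex.isCoveringMapOn_exp.existsUnique_continuousMap_lifts
    (⟨u, hu⟩ : C(ℝ, ℂ)) (a₀ := 0) (e₀ := Complex.log (u 0)) (Complex.exp_log (h0 0))
    (fun t => h0 t)
  exact ⟨L, L.continuous, fun t => congrFun hL t⟩

/-- Polar coordinates with a continuous angle along a crossing solution that avoids the axis. -/
theorem IsCrossingSolution.exists_polar {c : Coeffs} {g : ℝ × ℝ → ℝ} {ε : ℝ}
    {ψ : ℝ → ℝ × ℝ × ℝ} (h : IsCrossingSolution (Xplus c g ε) (Xminus c g ε) ψ)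
    (h0 : ∀ t, (ψ t).1 ≠ 0 ∨ (ψ t).2.1 ≠ 0) :
    ∃ Θ ρ : ℝ → ℝ, Continuous Θ ∧ Continuous ρ ∧ (∀ t, 0 < ρ t) ∧
      (∀ t, ψ t = (ρ t * Real.cos (Θ t), ρ t * Real.sin (Θ t), (ψ t).2.2)) ∧
      ∀ t, ∃ k : HalfCoeffs,
        ((k = c.upper ∧ (0 < Real.sin (Θ t) ∨ Real.sin (Θ t) = 0 ∧ 0 < Real.cos (Θ t))) ∨
          (k = c.lower ∧ (Real.sin (Θ t) < 0 ∨ Real.sin (Θ t) = 0 ∧ Real.cos (Θ t) < 0))) ∧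
        HasDerivWithinAt ρ (ε * k.pert ε (ψ t).2.2 * k.radial (Θ t)) (Ici t) t ∧
        HasDerivWithinAt Θ (1 + ε * k.pert ε (ψ t).2.2 / ρ t * k.angular (Θ t)) (Ici t) t ∧
        HasDerivWithinAt (fun t => (ψ t).2.2) (-(ψ t).2.2 + polar g (Θ t) (ρ t)) (Ici t) t := by
  -- With a continuous logarithm L of x + iy, the radius is exp (Re L) and the angle Im L, so both
  -- equations are read off from L' = u' / u.
  set u : ℝ → ℂ := fun t => ⟨(ψ t).1, (ψ t).2.1⟩ with hu
  have hψc := h.continuous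
  have huc : Continuous u := by
    have : u = fun t => ((ψ t).1 : ℂ) + ((ψ t).2.1 : ℂ) * Complex.I := by
      funext t; exact Complex.mk_eq_add_mul_I _ _
    rw [this]; fun_prop
  have hu0 : ∀ t, u t ≠ 0 := by
    intro t ht
    have h1 := congrArg Complex.re ht
    have h2 := congrArg Complex.im ht
    rcases h0 t with h3 | h3
    · exact h3 h1
    · exact h3 h2
  obtain ⟨L, hLc, hL⟩ := exists_continuous_log huc hu0
  have hx : ∀ t, (ψ t).1 = Real.exp (L t).re * Real.cos (L t).im := fun t => by
    rw [← Complex.exp_re, hL]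
  have hy : ∀ t, (ψ t).2.1 = Real.exp (L t).re * Real.sin (L t).im := fun t => by
    rw [← Complex.exp_im, hL]
  refine ⟨fun t => (L t).im, fun t => Real.exp (L t).re, by fun_prop, by fun_prop,
    fun t => Real.exp_pos _, fun t => ?_, fun t => ?_⟩
  · rw [← hx, ← hy]
  have hpos := Real.exp_pos (L t).re
  have key : ∀ k : HalfCoeffs, HasDerivWithinAt ψ (k.cart g ε (ψ t)) (Ici t) t →
      HasDerivWithinAt (fun t => Real.exp (L t).re)
        (ε * k.pert ε (ψ t).2.2 * k.radial (L t).im) (Ici t) t ∧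
      HasDerivWithinAt (fun t => (L t).im)
        (1 + ε * k.pert ε (ψ t).2.2 / Real.exp (L t).re * k.angular (L t).im) (Ici t) t ∧
      HasDerivWithinAt (fun t => (ψ t).2.2)
        (-(ψ t).2.2 + polar g (L t).im (Real.exp (L t).re)) (Ici t) t := by
    intro k hk
    have dx := hasDerivWithinAt_fst hk
    have dy := hasDerivWithinAt_fst (hasDerivWithinAt_snd hk)
    have dz := hasDerivWithinAt_snd (hasDerivWithinAt_snd hk)
    have du : HasDerivWithinAt u (⟨(k.cart g ε (ψ t)).1, (k.cart g ε (ψ t)).2.1⟩ : ℂ) (Ici t) t := by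
      have h1 := dx.ofReal_comp.add (dy.ofReal_comp.mul_const Complex.I)
      convert! h1 using 1
      · funext t; exact Complex.mk_eq_add_mul_I _ _
      · exact Complex.mk_eq_add_mul_I _ _
    have dL := hasDerivWithinAt_of_exp_eq hLc hL du
    have dre : HasDerivWithinAt (fun t => (L t).re) _ (Ici t) t :=
      Complex.reCLM.hasFDerivAt.comp_hasDerivWithinAt t dL
    have dim : HasDerivWithinAt (fun t => (L t).im) _ (Ici t) t :=
      Complex.imCLM.hasFDerivAt.comp_hasDerivWithinAt t dL
    have hn : Complex.normSq (u t) = Real.exp (L t).re ^ 2 := by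
      rw [Complex.normSq_apply]
      change (ψ t).1 * (ψ t).1 + (ψ t).2.1 * (ψ t).2.1 = _
      rw [hx, hy]
      linear_combination Real.exp (L t).re ^ 2 * Real.sin_sq_add_cos_sq (L t).im
    simp only [Complex.reCLM_apply, Complex.imCLM_apply, Complex.div_re, Complex.div_im, hn]
      at dre dim
    refine ⟨?_, ?_, ?_⟩
    · convert! dre.exp using 1
      simp only [HalfCoeffs.cart, hu, hx, hy]
      rw [HalfCoeffs.radial, Real.cos_sub]
      field_simp
      ring
    · convert! dim using 1
      simp only [HalfCoeffs.cart, hu, hx, hy]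
      rw [HalfCoeffs.angular, Real.sin_sub]
      field_simp
      linear_combination (-Real.exp (L t).re) * Real.sin_sq_add_cos_sq (L t).im
    · rw [polar, ← hx, ← hy]
      exact dz
  rcases h.hasDerivWithinAt_Ici t with ⟨hs, hd⟩ | ⟨hs, hd⟩
  · refine ⟨c.upper, Or.inl ⟨rfl, ?_⟩, key _ hd⟩
    rw [hx, hy] at hs
    simpa [hpos, hpos.ne'] using hs
  · refine ⟨c.lower, Or.inr ⟨rfl, ?_⟩, key _ hd⟩
    rw [hx, hy] at hs
    simpa [hpos, hpos.ne', mul_neg_iff, hpos.not_gt] using hs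

/-! ### Comparison of crossing solutions with the flow -/

theorem HalfCoeffs.rate_eq_speed_div {k : HalfCoeffs} {f : ℝ × ℝ → ℝ} {ε θ ρ z : ℝ} (hε : ε ≠ 0)
    (hρ : ρ ≠ 0) : 1 + ε * k.pert ε z / ρ * k.angular θ =
      k.speed f ε θ ρ ((z - polar f θ ρ) / ε) / ρ := by
  have : polar f θ ρ + ε * ((z - polar f θ ρ) / ε) = z := by field_simp; ring
  rw [HalfCoeffs.speed, this]
  field_simp

/-- In rescaled polar coordinates a solution follows the flow. -/
theorem eq_flow_of_polar {c : Coeffs} {f g : ℝ × ℝ → ℝ} (hf : Differentiable ℝ f)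
    (hfg : IsRotationPrimitive f g) {ε K M a b : ℝ} (hε : ε ≠ 0)
    {Θ ρ z : ℝ → ℝ} {X : ℝ → (ℝ × ℝ) × (ℝ × ℝ)} {k : ℝ → HalfCoeffs}
    (hΘc : Continuous Θ) (hρc : Continuous ρ) (hzc : Continuous z)
    (hΘm : Monotone Θ) (hΘa : Θ a = 0) (hΘb : Θ b ≤ 2 * Real.pi)
    (hΘlt : ∀ t ∈ Ico a b, Θ t < 2 * Real.pi)
    (hk : ∀ t ∈ Ico a b, k t = if Θ t < Real.pi then c.upper else c.lower)
    (hρ0 : ∀ t, 0 < ρ t)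
    (hρ : ∀ t ∈ Ico a b, HasDerivWithinAt ρ (ε * (k t).pert ε (z t) * (k t).radial (Θ t)) (Ici t) t)
    (hΘ : ∀ t ∈ Ico a b, HasDerivWithinAt Θ
      (1 + ε * (k t).pert ε (z t) / ρ t * (k t).angular (Θ t)) (Ici t) t)
    (hz : ∀ t ∈ Ico a b, HasDerivWithinAt z (-z t + polar g (Θ t) (ρ t)) (Ici t) t)
    (hspeed : ∀ t ∈ Ico a b,
      ρ t / 2 ≤ (k t).speed f ε (Θ t) (ρ t) ((z t - polar f (Θ t) (ρ t)) / ε) ∧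
      (k t).speed f ε (Θ t) (ρ t) ((z t - polar f (Θ t) (ρ t)) / ε) ≤ 2 * ρ t)
    (hK : 0 ≤ K)
    (hLip : ∀ h, (h = c.upper ∨ h = c.lower) → ∀ θ ∈ Icc 0 (2 * Real.pi),
      ∀ x ∈ Icc (-M) M ×ˢ Icc (-M) M, ∀ y ∈ Icc (-M) M ×ˢ Icc (-M) M,
      ‖(h.field f g (θ, (ρ a, ε), x)).1 - (h.field f g (θ, (ρ a, ε), y)).1‖ ≤ K * ‖x - y‖)
    (hY : ∀ t ∈ Icc a b, ((ρ t - ρ a) / ε,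
      Real.exp (Θ t) * ((z t - polar f (Θ t) (ρ t)) / ε)) ∈ Icc (-M) M ×ˢ Icc (-M) M)
    (hX0 : (X 0).1 = (0, (z a - polar f 0 (ρ a)) / ε))
    (hX : IsTwoPieceSolution (flowField (c.upper.field f g) (ρ a) ε)
      (flowField (c.lower.field f g) (ρ a) ε) X)
    (hXM : ∀ θ ∈ Icc 0 (2 * Real.pi), (X θ).1 ∈ Icc (-M) M ×ˢ Icc (-M) M) :
    ∀ t ∈ Icc a b, ((ρ t - ρ a) / ε, Real.exp (Θ t) * ((z t - polar f (Θ t) (ρ t)) / ε)) =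
      (X (Θ t)).1 := by
  have hΘmem : ∀ t ∈ Icc a b, Θ t ∈ Icc 0 (2 * Real.pi) := fun t ht =>
    ⟨hΘa ▸ hΘm ht.1, (hΘm ht.2).trans hΘb⟩
  have hkor : ∀ t ∈ Ico a b, k t = c.upper ∨ k t = c.lower := by
    intro t ht
    rw [hk t ht]
    split_ifs
    · exact Or.inl rfl
    · exact Or.inr rfl
  have hcp : Continuous fun t => polar f (Θ t) (ρ t) := by
    have := hf.continuous
    unfold polar; fun_prop
  have hrate : ∀ t ∈ Ico a b, |1 + ε * (k t).pert ε (z t) / ρ t * (k t).angular (Θ t)| ≤ 2 := by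
    intro t ht
    obtain ⟨h1, h2⟩ := hspeed t ht
    have h3 := hρ0 t
    rw [HalfCoeffs.rate_eq_speed_div (f := f) hε h3.ne', abs_le]
    constructor
    · rw [le_div_iff₀ h3]; linarith
    · rw [div_le_iff₀ h3]; exact h2
  -- Uniqueness in the variable t: the angular speed along the given solution is treated as a known
  -- function of t, at most 2. The rescaled coordinates and X ∘ Θ then solve the same equation with
  -- the same initial value; both stay in the square where the Lipschitz bound holds.
  have hmain := dist_le_of_trajectories_ODE_of_mem (a := a) (b := b) (δ := 0)
    (K := (2 * K).toNNReal)
    (v := fun t y => (1 + ε * (k t).pert ε (z t) / ρ t * (k t).angular (Θ t)) •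
      ((k t).field f g (Θ t, (ρ a, ε), y)).1)
    (s := fun _ => Icc (-M) M ×ˢ Icc (-M) M)
    (f := fun t => ((ρ t - ρ a) / ε, Real.exp (Θ t) * ((z t - polar f (Θ t) (ρ t)) / ε)))
    (g := fun t => (X (Θ t)).1) (fun t ht => by
      refine LipschitzOnWith.of_dist_le_mul fun x hx y hy => ?_
      rw [dist_eq_norm, dist_eq_norm, ← smul_sub, norm_smul, Real.norm_eq_abs]
      have h1 := hLip _ (hkor t ht) (Θ t) (hΘmem t ⟨ht.1, ht.2.le⟩) x hx y hy
      calc _ ≤ 2 * (K * ‖x - y‖) := by gcongr; exact hrate t ht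
        _ = _ := by rw [Real.coe_toNNReal _ (by positivity)]; ring)
    (by fun_prop)
    (fun t ht => by
      have h1 := hspeed t ht
      have h2 := hρ0 t
      exact hasDerivWithinAt_ofCart hf hfg hε h2.ne' (by linarith) (hρ t ht) (hΘ t ht) (hz t ht))
    (fun t ht => hY t ⟨ht.1, ht.2.le⟩)
    ((continuous_fst.comp_continuousOn hX.continuousOn).comp hΘc.continuousOn hΘmem)
    (fun t ht => by
      have h1 := hX.hasDerivWithinAt_Ici (t := Θ t)
        ⟨(hΘmem t ⟨ht.1, ht.2.le⟩).1, hΘlt t ht⟩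
      have h2 := HasDerivWithinAt.scomp t (hasDerivWithinAt_fst h1) (hΘ t ht)
        (fun x hx => hΘm hx)
      convert! h2 using 1
      rw [hk t ht]
      split_ifs <;> rfl)
    (fun t ht => hXM _ (hΘmem t ⟨ht.1, ht.2.le⟩)) (by
      rw [hΘa, hX0, sub_self, zero_div, Real.exp_zero, one_mul, dist_self])
  intro t ht
  have := hmain t ht
  rw [zero_mul] at this
  exact dist_le_zero.1 this

/-- The points of `ℝ³` near the orbit of radius `rs`, with a stronger condition on the half-plane
`y = 0`, `x ≥ 0`. -/
def tube (f : ℝ × ℝ → ℝ) (rs vs A δ ε : ℝ) : Set (ℝ × ℝ × ℝ) :=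
  {q | |√(q.1 ^ 2 + q.2.1 ^ 2) - rs| < A * |ε| ∧ |(q.2.2 - f (q.1, q.2.1)) / ε| < A ∧
    (q.2.1 ≠ 0 ∨ q.1 < 0 ∨ |(q.2.2 - f (q.1, q.2.1)) / ε - vs| < δ)}

theorem isOpen_tube {f : ℝ × ℝ → ℝ} (hf : Continuous f) (rs vs A δ ε : ℝ) :
    IsOpen (tube f rs vs A δ ε) := by
  have h1 : Continuous fun q : ℝ × ℝ × ℝ => (q.2.2 - f (q.1, q.2.1)) / ε := by fun_prop
  simp only [tube, ofPred_and, ofPred_or]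
  refine IsOpen.inter ?_ (IsOpen.inter ?_ (IsOpen.union ?_ (IsOpen.union ?_ ?_)))
  · exact isOpen_lt (f := fun q : ℝ × ℝ × ℝ => |√(q.1 ^ 2 + q.2.1 ^ 2) - rs|) (by fun_prop)
      continuous_const
  · exact isOpen_lt h1.abs continuous_const
  · exact isOpen_ne_fun (by fun_prop) continuous_const
  · exact isOpen_lt continuous_fst continuous_const
  · exact isOpen_lt (h1.sub continuous_const).abs continuous_const

theorem tube_polar {f : ℝ × ℝ → ℝ} {rs vs A δ ε ρ θ z : ℝ} (hρ : 0 < ρ)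
    (h : (ρ * Real.cos θ, ρ * Real.sin θ, z) ∈ tube f rs vs A δ ε) :
    |ρ - rs| < A * |ε| ∧ |(z - polar f θ ρ) / ε| < A ∧
      (Real.sin θ = 0 → 0 < Real.cos θ → |(z - polar f θ ρ) / ε - vs| < δ) := by
  obtain ⟨h1, h2, h3⟩ := h
  simp only at h1 h2 h3
  have : (ρ * Real.cos θ) ^ 2 + (ρ * Real.sin θ) ^ 2 = ρ ^ 2 := by
    linear_combination ρ ^ 2 * Real.sin_sq_add_cos_sq θ
  rw [this, Real.sqrt_sq hρ.le] at h1
  refine ⟨h1, h2, fun hs hc => ?_⟩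
  rcases h3 with h | h | h
  · exact absurd (by rw [hs, mul_zero]) h
  · exact absurd h (mul_pos hρ hc).not_gt
  · exact h

theorem polar_sub_nat_mul_two_pi (f : ℝ × ℝ → ℝ) (θ r : ℝ) (n : ℕ) :
    polar f (θ - n * (2 * Real.pi)) r = polar f θ r := by
  simp [polar, Real.cos_sub_nat_mul_two_pi, Real.sin_sub_nat_mul_two_pi]

namespace HalfCoeffs

variable (k : HalfCoeffs)

theorem radial_sub_nat_mul_two_pi (θ : ℝ) (n : ℕ) :
    k.radial (θ - n * (2 * Real.pi)) = k.radial θ := by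
  rw [radial, sub_right_comm, Real.cos_sub_nat_mul_two_pi, radial]

theorem angular_sub_nat_mul_two_pi (θ : ℝ) (n : ℕ) :
    k.angular (θ - n * (2 * Real.pi)) = k.angular θ := by
  rw [angular, sub_right_comm, Real.sin_sub_nat_mul_two_pi, angular]

end HalfCoeffs

theorem lt_pi_of_sin {θ : ℝ}
    (h : 0 < Real.sin θ ∨ Real.sin θ = 0 ∧ 0 < Real.cos θ) (h2 : θ < 2 * Real.pi) :
    θ < Real.pi := by
  by_contra! hlt
  have h1 : 0 ≤ Real.sin (θ - Real.pi) :=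
    Real.sin_nonneg_of_nonneg_of_le_pi (by linarith) (by linarith)
  rw [Real.sin_sub_pi] at h1
  rcases h with h | ⟨h, hc⟩
  · linarith
  · rcases hlt.eq_or_lt with h3 | h3
    · rw [← h3, Real.cos_pi] at hc; linarith
    · have := Real.sin_pos_of_pos_of_lt_pi (x := θ - Real.pi) (by linarith) (by linarith)
      rw [Real.sin_sub_pi] at this
      linarith

theorem pi_le_of_sin {θ : ℝ} (h0 : 0 ≤ θ)
    (h : Real.sin θ < 0 ∨ Real.sin θ = 0 ∧ Real.cos θ < 0) : Real.pi ≤ θ := by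
  by_contra! hlt
  rcases h0.eq_or_lt with h3 | h3
  · rw [← h3] at h
    simp at h
    linarith
  · have := Real.sin_pos_of_pos_of_lt_pi h3 hlt
    rcases h with h | ⟨h, -⟩ <;> linarith

set_option maxHeartbeats 800000 in
/-- A periodic crossing solution in the tube is the orbit of a fixed point of the return map, if
the return map has no other periodic points there. -/
theorem range_eq_of_subset_tube {c : Coeffs} {f g : ℝ × ℝ → ℝ} (hf : Differentiable ℝ f)
    (hfg : IsRotationPrimitive f g) {rs vs ε A δ K M : ℝ} (hε : ε ≠ 0)
    (hAε : A * |ε| < rs) (hMA : 2 * A ≤ M) (hMA' : Real.exp (2 * Real.pi) * A ≤ M) (hK : 0 ≤ K)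
    (hspeed : ∀ h, (h = c.upper ∨ h = c.lower) → ∀ θ r V, |r - rs| ≤ A * |ε| → |V| ≤ A →
      r / 2 ≤ h.speed f ε θ r V ∧ h.speed f ε θ r V ≤ 2 * r)
    (hLip : ∀ h, (h = c.upper ∨ h = c.lower) → ∀ r, |r - rs| ≤ A * |ε| →
      ∀ θ ∈ Icc 0 (2 * Real.pi),
      ∀ x ∈ Icc (-M) M ×ˢ Icc (-M) M, ∀ y ∈ Icc (-M) M ×ˢ Icc (-M) M,
      ‖(h.field f g (θ, (r, ε), x)).1 - (h.field f g (θ, (r, ε), y)).1‖ ≤ K * ‖x - y‖)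
    {X : ℝ × ℝ → ℝ → (ℝ × ℝ) × (ℝ × ℝ)}
    (hX : ∀ p : ℝ × ℝ, |p.1 - rs| ≤ A * |ε| → |p.2 - vs| ≤ δ →
      X p 0 = ((0, p.2), (0, 0)) ∧
      IsTwoPieceSolution (flowField (c.upper.field f g) p.1 ε)
        (flowField (c.lower.field f g) p.1 ε) (X p) ∧
      (∀ θ ∈ Icc 0 (2 * Real.pi), (X p θ).1 ∈ Icc (-M) M ×ˢ Icc (-M) M) ∧
      (X p (2 * Real.pi)).1.1 = ε * (X p (2 * Real.pi)).2.1)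
    {ps : ℝ × ℝ}
    (hrec : ∀ (n : ℕ) (p : ℕ → ℝ × ℝ), 0 < n →
      (∀ k, |(p k).1 - rs| ≤ A * |ε| ∧ |(p k).2 - vs| ≤ δ) →
      (∀ k, p (k + 1) = ((p k).1 + ε ^ 2 * (X (p k) (2 * Real.pi)).2.1,
        Real.exp (-(2 * Real.pi)) * (X (p k) (2 * Real.pi)).1.2)) →
      p n = p 0 → ∀ k, p k = ps)
    {ψ : ℝ → ℝ × ℝ × ℝ} {S : ℝ} (hψ : IsCrossingSolution (Xplus c g ε) (Xminus c g ε) ψ)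
    (hS : 0 < S) (hper : Function.Periodic ψ S) (hsub : range ψ ⊆ tube f rs vs A δ ε) :
    range ψ = (fun θ => toCart f ps.1 ε θ (X ps θ).1) '' Icc 0 (2 * Real.pi) := by
  have hpi := Real.pi_pos
  have haxis : ∀ t, (ψ t).1 ≠ 0 ∨ (ψ t).2.1 ≠ 0 := by
    intro t
    by_contra! h
    have h1 := (hsub ⟨t, rfl⟩).1
    rw [h.1, h.2] at h1
    simp at h1
    linarith [le_abs_self rs]
  obtain ⟨Θ, ρ, hΘc, hρc, hρ0, hψp, hd⟩ := hψ.exists_polar haxis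
  choose k hk hdρ hdΘ hdz using hd
  set z : ℝ → ℝ := fun t => (ψ t).2.2 with hz
  have hzc : Continuous z := (continuous_snd.comp continuous_snd).comp hψ.continuous
  set V : ℝ → ℝ := fun t => (z t - polar f (Θ t) (ρ t)) / ε with hV
  have hT : ∀ t, |ρ t - rs| < A * |ε| ∧ |V t| < A ∧
      (Real.sin (Θ t) = 0 → 0 < Real.cos (Θ t) → |V t - vs| < δ) := fun t =>
    tube_polar (hρ0 t) (hψp t ▸ hsub ⟨t, rfl⟩)
  have hkor : ∀ t, k t = c.upper ∨ k t = c.lower := fun t => (hk t).imp And.left And.left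
  -- Angular speed at least 1/2 makes Θ an increasing bijection of ℝ, so the section is passed at
  -- exactly one time T n for each angle 2πn.
  have hgrow : ∀ a b, a ≤ b → 1 / 2 * (b - a) ≤ Θ b - Θ a := by
    intro a b hab
    refine mul_le_sub_of_le_deriv_right hΘc.continuousOn (fun t _ => hdΘ t) (fun t _ => ?_) hab
    rw [HalfCoeffs.rate_eq_speed_div (f := f) hε (hρ0 t).ne', le_div_iff₀ (hρ0 t)]
    have := (hspeed _ (hkor t) (Θ t) (ρ t) (V t) (hT t).1.le (hT t).2.1.le).1
    linarith
  have hmono : StrictMono Θ := by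
    intro a b hab
    have := hgrow a b hab.le
    linarith
  have hsurj : ∀ y, ∃ t, Θ t = y := by
    intro y
    refine mem_range_of_exists_le_of_exists_ge hΘc ⟨min 0 (2 * (y - Θ 0)), ?_⟩
      ⟨max 0 (2 * (y - Θ 0)), ?_⟩
    · have h1 := hgrow _ _ (min_le_left 0 (2 * (y - Θ 0)))
      have h2 := min_le_right 0 (2 * (y - Θ 0))
      linarith
    · have h1 := hgrow _ _ (le_max_left 0 (2 * (y - Θ 0)))
      have h2 := le_max_right 0 (2 * (y - Θ 0))
      linarith
  choose σ hσ using hsurj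
  set T : ℕ → ℝ := fun n => σ (n * (2 * Real.pi)) with hTdef
  have hΘT : ∀ n : ℕ, Θ (T n) = n * (2 * Real.pi) := fun n => hσ _
  have hTsucc : ∀ n, T n < T (n + 1) := by
    intro n
    rw [← hmono.lt_iff_lt, hΘT, hΘT]
    push_cast
    linarith
  have hpolT : ∀ (n : ℕ) (r : ℝ), polar f (n * (2 * Real.pi)) r = polar f 0 r := by
    intro n r
    have := polar_sub_nat_mul_two_pi f (n * (2 * Real.pi)) r n
    rw [sub_self] at this
    exact this.symm
  have hsT : ∀ n : ℕ, Real.sin (Θ (T n)) = 0 := fun n => by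
    rw [hΘT]
    simpa using Real.sin_add_nat_mul_two_pi 0 n
  have hcT : ∀ n : ℕ, Real.cos (Θ (T n)) = 1 := fun n => by
    rw [hΘT]
    simp
  set p : ℕ → ℝ × ℝ := fun n => (ρ (T n), V (T n)) with hp
  -- Here the third condition of the tube is used: away from the section V is only bounded by A, but
  -- on it V is δ-close to vs, as uniqueness of periodic points requires.
  have hpmem : ∀ n, |(p n).1 - rs| ≤ A * |ε| ∧ |(p n).2 - vs| ≤ δ := fun n =>
    ⟨(hT _).1.le, ((hT _).2.2 (hsT n) (by rw [hcT]; exact one_pos)).le⟩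
  have hseg : ∀ n, ∀ t ∈ Icc (T n) (T (n + 1)),
      ((ρ t - ρ (T n)) / ε, Real.exp (Θ t - n * (2 * Real.pi)) * V t) =
        (X (p n) (Θ t - n * (2 * Real.pi))).1 := by
    intro n
    obtain ⟨hX0, hXs, hXM, -⟩ := hX (p n) (hpmem n).1 (hpmem n).2
    have hlo : ∀ t ∈ Icc (T n) (T (n + 1)), 0 ≤ Θ t - n * (2 * Real.pi) := by
      intro t ht
      have := hmono.monotone ht.1
      rw [hΘT] at this
      linarith
    have hhi : ∀ t ∈ Icc (T n) (T (n + 1)), Θ t - n * (2 * Real.pi) ≤ 2 * Real.pi := by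
      intro t ht
      have := hmono.monotone ht.2
      rw [hΘT] at this
      push_cast at this
      linarith
    have hlt : ∀ t ∈ Ico (T n) (T (n + 1)), Θ t - n * (2 * Real.pi) < 2 * Real.pi := by
      intro t ht
      have := hmono ht.2
      rw [hΘT] at this
      push_cast at this
      linarith
    have h := eq_flow_of_polar (c := c) (Θ := fun t => Θ t - n * (2 * Real.pi)) (ρ := ρ) (z := z)
      (k := k) (X := X (p n)) (M := M) (K := K) hf hfg hε (by fun_prop) hρc hzc
      (fun a b hab => sub_le_sub_right (hmono.monotone hab) _) (by rw [hΘT, sub_self])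
      (hhi _ ⟨(hTsucc n).le, le_rfl⟩) hlt (fun t ht => by
        have h0 := hlo t ⟨ht.1, ht.2.le⟩
        have h2 := hlt t ht
        rcases hk t with ⟨e, hs⟩ | ⟨e, hs⟩
        · rw [e, if_pos (lt_pi_of_sin (by
            rwa [Real.sin_sub_nat_mul_two_pi, Real.cos_sub_nat_mul_two_pi]) h2)]
        · rw [e, if_neg (not_lt.2 (pi_le_of_sin h0 (by
            rwa [Real.sin_sub_nat_mul_two_pi, Real.cos_sub_nat_mul_two_pi])))])
      hρ0 (fun t _ => by
        rw [HalfCoeffs.radial_sub_nat_mul_two_pi]; exact hdρ t) (fun t _ => by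
        rw [HalfCoeffs.angular_sub_nat_mul_two_pi]; exact (hdΘ t).sub_const _) (fun t _ => by
        rw [polar_sub_nat_mul_two_pi]; exact hdz t) (fun t _ => by
        rw [polar_sub_nat_mul_two_pi]
        exact hspeed _ (hkor t) _ _ _ (hT t).1.le (hT t).2.1.le) hK
      (fun h hh => hLip h hh _ (hpmem n).1) (fun t ht => by
        rw [polar_sub_nat_mul_two_pi]
        have hε' := abs_pos.2 hε
        -- Two radii in the tube differ by less than 2A|ε|, and W = e^θ V with θ ≤ 2π; hence the two
        -- lower bounds imposed on M.
        have b1 : |(ρ t - ρ (T n)) / ε| ≤ M := by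
          rw [abs_div, div_le_iff₀ hε']
          have h1 := (hT t).1
          have h2 := (hT (T n)).1
          have h3 := abs_sub_le (ρ t) rs (ρ (T n))
          rw [abs_sub_comm rs] at h3
          nlinarith
        have b2 : |Real.exp (Θ t - n * (2 * Real.pi)) * V t| ≤ M := by
          rw [abs_mul, abs_of_pos (Real.exp_pos _)]
          refine le_trans ?_ hMA'
          gcongr
          · exact hhi t ht
          · exact (hT t).2.1.le
        exact ⟨abs_le.1 b1, abs_le.1 b2⟩) (by
        rw [hX0]
        simp only [hp, hV, hΘT, hpolT]) hXs hXM
    intro t ht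
    have := h t ht
    rwa [polar_sub_nat_mul_two_pi] at this
  have hcart : ∀ n, ∀ t ∈ Icc (T n) (T (n + 1)), ψ t =
      toCart f (p n).1 ε (Θ t - n * (2 * Real.pi)) (X (p n) (Θ t - n * (2 * Real.pi))).1 := by
    intro n t ht
    rw [← hseg n t ht, toCart, polar_sub_nat_mul_two_pi, Real.cos_sub_nat_mul_two_pi,
      Real.sin_sub_nat_mul_two_pi, ← mul_assoc (Real.exp _), ← Real.exp_add, neg_add_cancel,
      Real.exp_zero, one_mul]
    have e1 : (p n).1 + ε * ((ρ t - ρ (T n)) / ε) = ρ t := by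
      simp only [hp]
      field_simp
      ring
    have e2 : polar f (Θ t) (ρ t) + ε * V t = z t := by
      simp only [hV]
      field_simp
      ring
    rw [e1, e2]
    exact hψp t
  have hstep : ∀ n, p (n + 1) = ((p n).1 + ε ^ 2 * (X (p n) (2 * Real.pi)).2.1,
      Real.exp (-(2 * Real.pi)) * (X (p n) (2 * Real.pi)).1.2) := by
    intro n
    have h1 := hseg n (T (n + 1)) ⟨(hTsucc n).le, le_rfl⟩
    have e1 : Θ (T (n + 1)) - n * (2 * Real.pi) = 2 * Real.pi := by
      rw [hΘT]; push_cast; ring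
    rw [e1] at h1
    obtain ⟨-, -, -, h2⟩ := hX (p n) (hpmem n).1 (hpmem n).2
    have h3 := congrArg Prod.fst h1
    have h4 := congrArg Prod.snd h1
    simp only [h2] at h3 h4
    rw [← h4, ← mul_assoc, ← Real.exp_add, neg_add_cancel, Real.exp_zero, one_mul]
    refine Prod.ext ?_ rfl
    simp only [hp]
    rw [div_eq_iff hε] at h3
    linear_combination h3
  have hρψ : ∀ s t, ψ s = ψ t → ρ s = ρ t ∧ Real.cos (Θ s) = Real.cos (Θ t) ∧ z s = z t := by
    intro s t hst
    have e : ∀ t, ρ t = √((ψ t).1 ^ 2 + (ψ t).2.1 ^ 2) := by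
      intro t
      have : (ψ t).1 ^ 2 + (ψ t).2.1 ^ 2 = ρ t ^ 2 := by
        rw [hψp t]
        linear_combination ρ t ^ 2 * Real.sin_sq_add_cos_sq (Θ t)
      rw [this, Real.sqrt_sq (hρ0 t).le]
    have h1 : ρ s = ρ t := by rw [e, e, hst]
    refine ⟨h1, ?_, by simp only [hz, hst]⟩
    have h2 := congrArg Prod.fst hst
    rw [hψp s, hψp t] at h2
    simp only [h1] at h2
    exact mul_left_cancel₀ (hρ0 t).ne' h2
  -- After the period S the cosine of the angle is again 1, so the angle has grown by a multiple of
  -- 2π, positive since Θ increases.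
  obtain ⟨N, hN, hTN⟩ : ∃ N : ℕ, 0 < N ∧ T 0 + S = T N := by
    have h1 := (hρψ _ _ (hper (T 0))).2.1
    rw [hcT, Real.cos_eq_one_iff] at h1
    obtain ⟨m, hm⟩ := h1
    have h2 : Θ (T 0) < Θ (T 0 + S) := hmono (by linarith)
    rw [hΘT, ← hm] at h2
    have hm0 : 0 < m := by
      simp only [Nat.cast_zero, zero_mul] at h2
      have := pos_of_mul_pos_left h2 (by positivity)
      exact_mod_cast this
    obtain ⟨N, rfl⟩ := Int.eq_ofNat_of_zero_le hm0.le
    refine ⟨N, by exact_mod_cast hm0, hmono.injective ?_⟩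
    rw [hΘT, ← hm]
    simp
  have hpN : p N = p 0 := by
    obtain ⟨h1, -, h2⟩ := hρψ _ _ (hper (T 0))
    rw [hTN] at h1 h2
    simp only [hp, hV, hΘT, hpolT, h1, h2]
  have hall := hrec N p hN hpmem hstep hpN
  ext q
  constructor
  -- Adding a multiple of S moves t beyond T 0, where the arcs between section times cover
  -- everything.
  · rintro ⟨t, rfl⟩
    obtain ⟨m, hm⟩ := exists_nat_ge ((T 0 - t) / S)
    rw [div_le_iff₀ hS] at hm
    have h1 : ψ t = ψ (t + m * S) := (hper.nat_mul m t).symm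
    set s := t + m * S
    have h2 : 0 ≤ Θ s := by
      have := hmono.monotone (show T 0 ≤ s by linarith)
      rwa [hΘT, Nat.cast_zero, zero_mul] at this
    set n := ⌊Θ s / (2 * Real.pi)⌋₊
    have h3 : n * (2 * Real.pi) ≤ Θ s := by
      rw [← le_div_iff₀ (by positivity)]; exact Nat.floor_le (by positivity)
    have h4 : Θ s < (n + 1) * (2 * Real.pi) := by
      rw [← div_lt_iff₀ (by positivity)]; exact Nat.lt_floor_add_one _
    have h5 : s ∈ Icc (T n) (T (n + 1)) := by
      constructor
      · rw [← hmono.le_iff_le, hΘT]; exact h3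
      · rw [← hmono.le_iff_le, hΘT]; push_cast; exact h4.le
    rw [h1, hcart n s h5, hall n]
    exact ⟨_, ⟨by linarith, by linarith⟩, rfl⟩
  · rintro ⟨θ, hθ, rfl⟩
    refine ⟨σ θ, ?_⟩
    have h5 : σ θ ∈ Icc (T 0) (T (0 + 1)) := by
      constructor
      · rw [← hmono.le_iff_le, hΘT, hσ]; simpa using hθ.1
      · rw [← hmono.le_iff_le, hΘT, hσ]; simpa using hθ.2
    rw [hcart 0 _ h5, hall 0, hσ]
    simp

/-! ### The return map of the piecewise field -/

theorem HalfCoeffs.periodic_speed (k : HalfCoeffs) (f : ℝ × ℝ → ℝ) (ε r V : ℝ) :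
    Function.Periodic (fun θ => k.speed f ε θ r V) (2 * Real.pi) := by
  intro θ
  simp only [HalfCoeffs.speed, HalfCoeffs.angular, polar, Real.cos_add_two_pi, Real.sin_add_two_pi]
  rw [add_sub_right_comm, Real.sin_add_two_pi]

theorem exists_field_bounds (c : Coeffs) {f g : ℝ × ℝ → ℝ} (hf : ContDiff ℝ 3 f)
    (hg : ContDiff ℝ 3 g) {rs M : ℝ} (hrs : 0 < rs) (hM : 0 < M) :
    ∃ e > 0, ∃ K ≥ 0, ∀ h, (h = c.upper ∨ h = c.lower) →
      (∀ u ∈ box rs M e, rs / 4 ≤ u.2.1.1 + u.2.1.2 * u.2.2.1 ∧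
        u.2.1.1 + u.2.1.2 * u.2.2.1 ≤ 2 * rs ∧
        (u.2.1.1 + u.2.1.2 * u.2.2.1) / 2 ≤
          h.speed f u.2.1.2 u.1 (u.2.1.1 + u.2.1.2 * u.2.2.1) (Real.exp (-u.1) * u.2.2.2) ∧
        h.speed f u.2.1.2 u.1 (u.2.1.1 + u.2.1.2 * u.2.2.1) (Real.exp (-u.1) * u.2.2.2) ≤
          2 * (u.2.1.1 + u.2.1.2 * u.2.2.1)) ∧
      (∀ u ∈ box rs M e, ContDiffAt ℝ 2 (h.field f g) u) ∧
      ∀ u ∈ box rs M e, ∀ w ∈ box rs M e, ‖h.field f g u - h.field f g w‖ ≤ K * ‖u - w‖ := by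
  have key : ∀ h : HalfCoeffs, ∃ e > 0, ∃ K ≥ 0,
      (∀ u ∈ box rs M e, rs / 4 ≤ u.2.1.1 + u.2.1.2 * u.2.2.1 ∧
        u.2.1.1 + u.2.1.2 * u.2.2.1 ≤ 2 * rs ∧
        (u.2.1.1 + u.2.1.2 * u.2.2.1) / 2 ≤
          h.speed f u.2.1.2 u.1 (u.2.1.1 + u.2.1.2 * u.2.2.1) (Real.exp (-u.1) * u.2.2.2) ∧
        h.speed f u.2.1.2 u.1 (u.2.1.1 + u.2.1.2 * u.2.2.1) (Real.exp (-u.1) * u.2.2.2) ≤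
          2 * (u.2.1.1 + u.2.1.2 * u.2.2.1)) ∧
      (∀ u ∈ box rs M e, ContDiffAt ℝ 2 (h.field f g) u) ∧
      ∀ u ∈ box rs M e, ∀ w ∈ box rs M e, ‖h.field f g u - h.field f g w‖ ≤ K * ‖u - w‖ := by
    intro h
    obtain ⟨e, he, hs⟩ := h.exists_speed_bounds hf hrs hM
    have hc : ∀ u ∈ box rs M e, ContDiffAt ℝ 2 (h.field f g) u := by
      intro u hu
      obtain ⟨h1, -, h2, -⟩ := hs u hu
      exact h.contDiffAt_field hf hg u (by linarith)
    obtain ⟨K, hK, -, hl, -⟩ := exists_doubleDiff_bound (isCompact_box rs M e)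
      (convex_box rs M e) hc
    exact ⟨e, he, K, hK, hs, hc, hl⟩
  obtain ⟨e₁, he₁, K₁, hK₁, hs₁, hc₁, hl₁⟩ := key c.upper
  obtain ⟨e₂, he₂, K₂, hK₂, hs₂, hc₂, hl₂⟩ := key c.lower
  have m₁ := box_mono (rs := rs) (M := M) (min_le_left e₁ e₂)
  have m₂ := box_mono (rs := rs) (M := M) (min_le_right e₁ e₂)
  refine ⟨min e₁ e₂, lt_min he₁ he₂, max K₁ K₂, hK₁.trans (le_max_left _ _), ?_⟩
  rintro h (rfl | rfl)
  · refine ⟨fun u hu => hs₁ u (m₁ hu), fun u hu => hc₁ u (m₁ hu), fun u hu w hw =>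
      (hl₁ u (m₁ hu) w (m₁ hw)).trans ?_⟩
    gcongr
    exact le_max_left _ _
  · refine ⟨fun u hu => hs₂ u (m₂ hu), fun u hu => hc₂ u (m₂ hu), fun u hu w hw =>
      (hl₂ u (m₂ hu) w (m₂ hw)).trans ?_⟩
    gcongr
    exact le_max_right _ _

/-- The first-order height of the periodic solution over the section `θ = 0`. -/
noncomputable def heightShift (c : Coeffs) (f g : ℝ × ℝ → ℝ) (r : ℝ) : ℝ :=
  disp c f g r / (Real.exp (2 * Real.pi) - 1)

/-- The flow in rescaled polar coordinates and its return map. -/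
theorem exists_returnData {c : Coeffs} {f g : ℝ × ℝ → ℝ} (hf : ContDiff ℝ 3 f)
    (hg : ContDiff ℝ 3 g) (hfg : IsRotationPrimitive f g) (hf₁ : ∀ r, 0 < r → f₁ c f r = 0)
    {rs vs : ℝ} (hrs : 0 < rs) (hzero : f₂ c f g rs = 0) (hvs : heightShift c f g rs = vs) :
    ∃ M > 0, ∃ e > 0, ∃ C > 0, ∃ X : ℝ × ℝ → ℝ → ℝ → (ℝ × ℝ) × (ℝ × ℝ),
      (∀ p ∈ Icc (rs / 2) (3 * rs / 2) ×ˢ Icc (vs - 1) (vs + 1), ∀ ε ∈ Icc (-e) e,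
        X p ε 0 = ((0, p.2), (0, 0)) ∧
        IsTwoPieceSolution (flowField (c.upper.field f g) p.1 ε)
          (flowField (c.lower.field f g) p.1 ε) (X p ε) ∧
        (∀ θ ∈ Icc 0 (2 * Real.pi), (X p ε θ).1 ∈ Icc (-M) M ×ˢ Icc (-M) M) ∧
        GoodSpeed c.upper f p.1 ε (X p ε) ∧ GoodSpeed c.lower f p.1 ε (X p ε) ∧
        (∀ θ ∈ Icc 0 (2 * Real.pi), p.1 + ε * (X p ε θ).1.1 ∈ Icc (rs / 4) (2 * rs)) ∧
        (X p ε (2 * Real.pi)).1.1 = ε * (X p ε (2 * Real.pi)).2.1 ∧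
        ∀ θ ∈ Icc 0 (2 * Real.pi), |(X p ε θ).2.2 - θ| ≤ C * |ε|) ∧
      ReturnData rs vs e C (Real.exp (-(2 * Real.pi))) (kappa c) (f₂ c f g) (heightShift c f g)
        (fun p ε => (X p ε (2 * Real.pi)).2.1)
        (fun p ε => Real.exp (-(2 * Real.pi)) * (X p ε (2 * Real.pi)).1.2) := by
  have hpi := Real.pi_pos
  have m2 : 2 * Real.pi ∈ Icc 0 (2 * Real.pi) := ⟨by linarith, le_rfl⟩
  obtain ⟨k₁, hk₁0, hk₁⟩ := c.upper.exists_field_zero_bound hf hg hrs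
  obtain ⟨k₂, hk₂0, hk₂⟩ := c.lower.exists_field_zero_bound hf hg hrs
  obtain ⟨M, hM, e₁, he₁, C, hC, X, hX, hlip, hdd⟩ := exists_flow (c.upper.field f g)
    (c.lower.field f g) (rs := rs) (k := max k₁ k₂) (vs := vs) (hk₁0.trans (le_max_left _ _))
    (fun M hM => by
      obtain ⟨e, he, K, hK, h⟩ := exists_field_bounds c hf hg hrs hM
      exact ⟨e, he, fun u hu => ⟨(h _ (Or.inl rfl)).2.1 u hu, (h _ (Or.inr rfl)).2.1 u hu⟩⟩)
    (fun θ hθ r hr x => (hk₁ θ hθ r hr x).trans (le_max_left _ _))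
    (fun θ hθ r hr x => (hk₂ θ hθ r hr x).trans (le_max_right _ _))
  obtain ⟨e₂, he₂, K, hK, hb⟩ := exists_field_bounds c hf hg hrs hM
  set e := min e₁ e₂ with he
  have he0 : 0 < e := lt_min he₁ he₂
  have sub₁ : Icc (-e) e ⊆ Icc (-e₁) e₁ :=
    Icc_subset_Icc (neg_le_neg (min_le_left _ _)) (min_le_left _ _)
  have sub₂ : Icc (-e) e ⊆ Icc (-e₂) e₂ :=
    Icc_subset_Icc (neg_le_neg (min_le_right _ _)) (min_le_right _ _)
  have zero_mem : (0 : ℝ) ∈ Icc (-e) e := ⟨by linarith, he0.le⟩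
  have hgood : ∀ h, (h = c.upper ∨ h = c.lower) →
      ∀ p ∈ Icc (rs / 2) (3 * rs / 2) ×ˢ Icc (vs - 1) (vs + 1), ∀ ε ∈ Icc (-e) e,
      GoodSpeed h f p.1 ε (X p ε) ∧
        ∀ θ ∈ Icc 0 (2 * Real.pi), p.1 + ε * (X p ε θ).1.1 ∈ Icc (rs / 4) (2 * rs) := by
    intro h hh p hp ε hε
    have hu : ∀ θ ∈ Icc 0 (2 * Real.pi), (θ, (p.1, ε), (X p ε θ).1) ∈ box rs M e₂ := fun θ hθ =>
      ⟨hθ, ⟨hp.1, sub₂ hε⟩, (hX p hp ε (sub₁ hε)).2.2 θ hθ⟩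
    constructor
    · intro θ hθ
      obtain ⟨h1, -, h2, h3⟩ := (hb h hh).1 _ (hu θ hθ)
      exact ⟨by linarith, h2, h3⟩
    · intro θ hθ
      obtain ⟨h1, h2, -⟩ := (hb h hh).1 _ (hu θ hθ)
      exact ⟨h1, h2⟩
  have heval : ∀ p ∈ Icc (rs / 2) (3 * rs / 2) ×ˢ Icc (vs - 1) (vs + 1), _ := fun p hp =>
    solution_zero_eval hf hg hfg (lt_of_lt_of_le (by linarith) hp.1.1)
      (hf₁ p.1 (lt_of_lt_of_le (by linarith) hp.1.1)) (hX p hp 0 (sub₁ zero_mem)).1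
      (hX p hp 0 (sub₁ zero_mem)).2.1
  have hl1 : Real.exp (-(2 * Real.pi)) < 1 := by
    rw [Real.exp_lt_one_iff]; linarith
  have hE : Real.exp (-(2 * Real.pi)) * Real.exp (2 * Real.pi) = 1 := by
    rw [← Real.exp_add, neg_add_cancel, Real.exp_zero]
  have hlpos := Real.exp_pos (-(2 * Real.pi))
  have hne : Real.exp (2 * Real.pi) - 1 ≠ 0 := by
    have : 1 < Real.exp (2 * Real.pi) := Real.one_lt_exp_iff.2 (by positivity)
    linarith
  have hcomp : ∀ a : (ℝ × ℝ) × (ℝ × ℝ), |a.2.1| ≤ ‖a‖ ∧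
      |Real.exp (-(2 * Real.pi)) * a.1.2| ≤ ‖a‖ := by
    intro a
    refine ⟨(norm_fst_le a.2).trans (norm_snd_le a), ?_⟩
    rw [abs_mul, abs_of_pos hlpos]
    have h1 : |a.1.2| ≤ ‖a‖ := (norm_snd_le a.1).trans (norm_fst_le a)
    exact (mul_le_of_le_one_left (abs_nonneg _) hl1.le).trans h1
  refine ⟨M, hM, e, he0, C, hC, X, fun p hp ε hε => ?_, ?_⟩
  · obtain ⟨h0, hs, hm⟩ := hX p hp ε (sub₁ hε)
    obtain ⟨gU, hr⟩ := hgood _ (Or.inl rfl) p hp ε hε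
    obtain ⟨gL, -⟩ := hgood _ (Or.inr rfl) p hp ε hε
    have hp0 : 0 < p.1 := lt_of_lt_of_le (by linarith) hp.1.1
    obtain ⟨h1, -, -, h2⟩ := heval p hp
    refine ⟨h0, hs, hm, gU, gL, hr, ?_, fun θ hθ => ?_⟩
    -- As f₁ = 0, the component R for ε = 0 ends at 0 and only εQ is left.
    · have := radial_increment hf hp0.ne' hs (hX p hp 0 (sub₁ zero_mem)).2.1
        (fun θ hθ => (gU.pos hθ).ne') (fun θ hθ => (gL.pos hθ).ne') (by rw [h0]) (by rw [h0])
        (by rw [(hX p hp 0 (sub₁ zero_mem)).1])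
      rw [this, h1, zero_add]
    · have h3 := hlip p hp ε (sub₁ hε) p hp 0 (sub₁ zero_mem) θ hθ
      rw [sub_self, norm_zero, zero_add, sub_zero] at h3
      refine le_trans ?_ h3
      have h4 := (norm_snd_le (X p ε θ - X p 0 θ).2).trans (norm_snd_le (X p ε θ - X p 0 θ))
      rw [Prod.snd_sub, Prod.snd_sub, h2 θ hθ, Real.norm_eq_abs] at h4
      exact h4
  · refine ⟨hrs, he0, hC, hlpos, hl1, hvs, hzero, fun p hp => (heval p hp).2.2.1, fun p hp => ?_,
      ?_, ?_⟩
    -- N(p, 0) = e^{-2π} (V + disp), where disp is (e^{2π} - 1) times `heightShift`.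
    · have h1 := (heval p hp).2.1
      simp only [h1, heightShift]
      field_simp
      linear_combination disp c f g p.1 * hE
    · intro H hH p hp ε hε q hq ε' hε'
      refine le_trans ?_ (hlip p hp ε (sub₁ hε) q hq ε' (sub₁ hε') _ m2)
      obtain ⟨h1, h2⟩ := hcomp (X p ε (2 * Real.pi) - X q ε' (2 * Real.pi))
      rcases hH with rfl | rfl
      · exact h1
      · simp only [← mul_sub]
        exact h2
    · intro H hH p hp q hq p' hp' q' hq' ε hε ε' hε'
      refine le_trans ?_ (hdd p hp q hq p' hp' q' hq' ε (sub₁ hε) ε' (sub₁ hε') _ m2)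
      obtain ⟨h1, h2⟩ := hcomp (X p ε (2 * Real.pi) - X q ε (2 * Real.pi)
        - X p' ε' (2 * Real.pi) + X q' ε' (2 * Real.pi))
      rcases hH with rfl | rfl
      · exact h1
      · simp only [← mul_sub, ← mul_add]
        exact h2

/-! ### The limit cycle and its isolating tube -/

theorem toCart_mem_tube {f : ℝ × ℝ → ℝ} {rs vs A δ ε r θ : ℝ} {x : ℝ × ℝ} (hε : ε ≠ 0)
    (hρ : 0 < r + ε * x.1) (h1 : |r + ε * x.1 - rs| < A * |ε|) (h2 : |Real.exp (-θ) * x.2| < A)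
    (h3 : Real.sin θ = 0 → 0 < Real.cos θ → |Real.exp (-θ) * x.2 - vs| < δ) :
    toCart f r ε θ x ∈ tube f rs vs A δ ε := by
  have e1 : ((r + ε * x.1) * Real.cos θ) ^ 2 + ((r + ε * x.1) * Real.sin θ) ^ 2 =
      (r + ε * x.1) ^ 2 := by
    linear_combination (r + ε * x.1) ^ 2 * Real.sin_sq_add_cos_sq θ
  have e2 : (polar f θ (r + ε * x.1) + ε * (Real.exp (-θ) * x.2) -
      f ((r + ε * x.1) * Real.cos θ, (r + ε * x.1) * Real.sin θ)) / ε = Real.exp (-θ) * x.2 := by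
    rw [polar, add_sub_cancel_left, mul_div_cancel_left₀ _ hε]
  refine ⟨?_, ?_, ?_⟩
  · simp only [toCart]
    rwa [e1, Real.sqrt_sq hρ.le]
  · simp only [toCart]
    rwa [e2]
  · simp only [toCart]
    rw [e2]
    by_cases hs : Real.sin θ = 0
    · have hc : Real.cos θ ≠ 0 := by
        intro hc
        have := Real.sin_sq_add_cos_sq θ
        rw [hs, hc] at this
        norm_num at this
      rcases hc.lt_or_gt with hc | hc
      · exact Or.inr (Or.inl (mul_neg_of_pos_of_neg hρ hc))
      · exact Or.inr (Or.inr (h3 hs hc))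
    · exact Or.inl (mul_ne_zero hρ.ne' hs)

theorem eq_zero_or_eq_two_pi {θ : ℝ} (hθ : θ ∈ Icc 0 (2 * Real.pi)) (hs : Real.sin θ = 0)
    (hc : 0 < Real.cos θ) : θ = 0 ∨ θ = 2 * Real.pi := by
  rcases hθ.2.eq_or_lt with h | h
  · exact Or.inr h
  · refine Or.inl ?_
    have h1 := lt_pi_of_sin (Or.inr ⟨hs, hc⟩) h
    exact (Real.sin_eq_zero_iff_of_lt_of_lt (by linarith [hθ.1, Real.pi_pos]) h1).1 hs

theorem contDiff_baseOrbit {f : ℝ × ℝ → ℝ} {n : WithTop ℕ∞} (hf : ContDiff ℝ n f) :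
    ContDiff ℝ n (fun q : ℝ × ℝ => baseOrbit f q.1 q.2) := by
  unfold baseOrbit
  fun_prop

theorem norm_toCart_sub_baseOrbit_le (f : ℝ × ℝ → ℝ) (r ε θ : ℝ) (x : ℝ × ℝ) :
    ‖toCart f r ε θ x - baseOrbit f (r + ε * x.1) θ‖ ≤ |ε| * |Real.exp (-θ) * x.2| := by
  simp only [toCart, baseOrbit, polar, Prod.mk_sub_mk, sub_self, add_sub_cancel_left]
  refine max_le (by simp; positivity) (max_le (by simp; positivity) ?_)
  simp only [Real.norm_eq_abs, abs_mul]
  exact le_rfl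

set_option maxHeartbeats 800000 in
theorem exists_crossingLimitCycle {c : Coeffs} {f g : ℝ × ℝ → ℝ} (hf : ContDiff ℝ 3 f)
    (hg : ContDiff ℝ 3 g) (hfg : IsRotationPrimitive f g) (hf₁ : ∀ r, 0 < r → f₁ c f r = 0)
    {rs c' : ℝ} (hrs : 0 < rs) (hzero : f₂ c f g rs = 0) (hc : c' ≠ 0)
    (hd : HasDerivAt (f₂ c f g) c' rs) :
    ∃ C > (0 : ℝ), ∃ ε₀ > (0 : ℝ), ∀ ε : ℝ, ε ≠ 0 → |ε| < ε₀ →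
      ∃ (φ : ℝ → ℝ × ℝ × ℝ) (T : ℝ), IsCrossingLimitCycle (Xplus c g ε) (Xminus c g ε) φ T ∧
        |T - 2 * Real.pi| ≤ C * |ε| ∧ ∀ t ∈ Icc (0 : ℝ) T, ‖φ t - baseOrbit f rs t‖ ≤ C * |ε| := by
  have hpi := Real.pi_pos
  have hfd : Differentiable ℝ f := hf.differentiable (by norm_num)
  have m0 : (0 : ℝ) ∈ Icc 0 (2 * Real.pi) := ⟨le_rfl, by linarith⟩
  have m2 : 2 * Real.pi ∈ Icc 0 (2 * Real.pi) := ⟨by linarith, le_rfl⟩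
  set vs := heightShift c f g rs with hvs
  obtain ⟨M, hM, e, he, C, hC, X, hX, hR⟩ := exists_returnData hf hg hfg hf₁ hrs hzero hvs.symm
  obtain ⟨B, hB, ε₁, hε₁, hfix⟩ := hR.exists_fixedPoint hc hd
  obtain ⟨δ, hδ, hδr, hδ1, ε₂, hε₂, huniq⟩ := hR.eq_fixedPoint_of_periodic hc hd
  -- The width of the tube in units of |ε|: B for the position of the fixed point, M for the
  -- excursion of R, and 1 for strict inequalities. M bounds V as well.
  set A := B + M + 1 with hA
  have hA0 : 0 < A := by positivity
  have hexp1 : 1 ≤ Real.exp (2 * Real.pi) := Real.one_le_exp (by positivity)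
  -- A competing solution is only known to lie in the tube, where |V| < A and radii differ by less
  -- than 2A|ε|; its coordinates R and W need this larger box.
  set M' := 2 * A * Real.exp (2 * Real.pi) with hM'
  have hM'0 : 0 < M' := by positivity
  have hMM' : M ≤ M' := by nlinarith
  obtain ⟨e₂, he₂, K, hK, hb⟩ := exists_field_bounds c hf hg hrs hM'0
  -- the Lipschitz constant of the unperturbed orbits
  obtain ⟨K', hK', -, hl', -⟩ := exists_doubleDiff_bound
    (H := fun q : ℝ × ℝ => baseOrbit f q.1 q.2)
    (B := Icc (rs / 4) (2 * rs) ×ˢ Icc (-(C * e)) (2 * Real.pi + C * e))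
    (isCompact_Icc.prod isCompact_Icc) ((convex_Icc _ _).prod (convex_Icc _ _))
    (fun q _ => (contDiff_baseOrbit (hf.of_le (by norm_num))).contDiffAt)
  refine ⟨C + M + K' * (B + M + C), by positivity,
    min (min ε₁ ε₂) (min (min e e₂) (δ / A)), by positivity, fun ε hε0 hε => ?_⟩
  simp only [lt_min_iff] at hε
  obtain ⟨⟨hεa, hεb⟩, ⟨hεe, hεc⟩, hεd⟩ := hε
  -- A|ε| < δ places the radii of the tube in the region where the fixed point is the only periodic
  -- point.
  rw [lt_div_iff₀ hA0, mul_comm] at hεd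
  have hεpos := abs_pos.2 hε0
  have hεmem : ε ∈ Icc (-e) e := abs_le.1 hεe.le
  have hεmem₂ : ε ∈ Icc (-e₂) e₂ := abs_le.1 hεc.le
  obtain ⟨ps, hps, hpsB, hS, hN⟩ := hfix ε hεa
  obtain ⟨h0, hs, hm, gU, gL, hrad, hinc, htime⟩ := hX ps hps ε hεmem
  have hps1 : |ps.1 - rs| ≤ B * |ε| := (abs_fst_le_norm (ps - (rs, vs))).trans hpsB
  have hps2 : |ps.2 - vs| ≤ B * |ε| := (abs_snd_le_norm (ps - (rs, vs))).trans hpsB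
  have hBδ : B * |ε| < δ := lt_of_le_of_lt (by gcongr; linarith) hεd
  have hR0 : (X ps ε (2 * Real.pi)).1.1 = 0 := by rw [hinc, hS, mul_zero]
  obtain ⟨φ, hφ, hper, hrange, hmeets, hval⟩ := exists_crossingSolution hfd hfg h0 hs gU gL hR0 hN
  have hVM : ∀ θ ∈ Icc 0 (2 * Real.pi), |Real.exp (-θ) * (X ps ε θ).1.2| ≤ M := by
    intro θ hθ
    rw [abs_mul, abs_of_pos (Real.exp_pos _)]
    have h1 : |(X ps ε θ).1.2| ≤ M := abs_le.2 (hm θ hθ).2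
    have h2 : Real.exp (-θ) ≤ 1 := by rw [Real.exp_le_one_iff]; linarith [hθ.1]
    exact (mul_le_of_le_one_left (abs_nonneg _) h2).trans h1
  have hρM : ∀ θ ∈ Icc 0 (2 * Real.pi), |ps.1 + ε * (X ps ε θ).1.1 - rs| ≤ (B + M) * |ε| := by
    intro θ hθ
    have h1 : |(X ps ε θ).1.1| ≤ M := abs_le.2 (hm θ hθ).1
    have e1 : ps.1 + ε * (X ps ε θ).1.1 - rs = (ps.1 - rs) + ε * (X ps ε θ).1.1 := by ring
    rw [e1]
    refine (abs_add_le _ _).trans ?_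
    rw [abs_mul]
    nlinarith
  refine ⟨φ, (X ps ε (2 * Real.pi)).2.2, ⟨hφ, hper, hmeets, tube f rs vs A δ ε,
    isOpen_tube hf.continuous _ _ _ _ _, ?_, ?_⟩, ?_, ?_⟩
  · rw [hrange]
    rintro _ ⟨θ, hθ, rfl⟩
    refine toCart_mem_tube hε0 (gU θ hθ).1 ?_ ?_ ?_
    · refine (hρM θ hθ).trans_lt ?_
      rw [hA]; nlinarith
    · exact (hVM θ hθ).trans_lt (by linarith)
    · intro hsin hcos
      have : Real.exp (-θ) * (X ps ε θ).1.2 = ps.2 := by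
        rcases eq_zero_or_eq_two_pi hθ hsin hcos with rfl | rfl
        · rw [h0, neg_zero, Real.exp_zero, one_mul]
        · exact hN
      rw [this]
      exact hps2.trans_lt hBδ
  · intro ψ S hψ hS0 hψper hsub
    rw [hrange]
    have hrbox : ∀ r, |r - rs| ≤ A * |ε| → r ∈ Icc (rs / 2) (3 * rs / 2) := by
      intro r hr
      have := abs_le.1 (hr.trans hεd.le)
      exact ⟨by linarith [this.1], by linarith [this.2]⟩
    refine range_eq_of_subset_tube (A := A) (δ := δ) (K := K) (M := M') (X := fun p => X p ε)
      hfd hfg hε0 (by linarith) (by nlinarith) (by nlinarith) hK ?_ ?_ ?_ ?_ hψ hS0 hψper hsub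
    · intro h hh θ r V hr hV
      -- The speed at fixed r and V is periodic in the angle, so the bounds on [0, 2π] suffice; they
      -- are applied with r₀ = r, R = 0 and W = e^{θ'} V.
      obtain ⟨θ', hθ', hθe⟩ := (h.periodic_speed f ε r V).exists_mem_Ico₀ (by positivity) θ
      rw [hθe]
      have hW : |Real.exp θ' * V| ≤ M' := by
        rw [abs_mul, abs_of_pos (Real.exp_pos _)]
        calc Real.exp θ' * |V| ≤ Real.exp (2 * Real.pi) * A := by
              gcongr
              exact hθ'.2.le
          _ ≤ M' := by nlinarith
      obtain ⟨-, -, h1, h2⟩ := (hb h hh).1 (θ', (r, ε), (0, Real.exp θ' * V))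
        ⟨⟨hθ'.1, hθ'.2.le⟩, ⟨hrbox r hr, hεmem₂⟩, ⟨by linarith, hM'0.le⟩, abs_le.1 hW⟩
      simp only [mul_zero, add_zero, ← mul_assoc, ← Real.exp_add, neg_add_cancel, Real.exp_zero,
        one_mul] at h1 h2
      exact ⟨h1, h2⟩
    · intro h hh r hr θ hθ x hx y hy
      have h1 := (hb h hh).2.2 (θ, (r, ε), x) ⟨hθ, ⟨hrbox r hr, hεmem₂⟩, hx⟩ (θ, (r, ε), y)
        ⟨hθ, ⟨hrbox r hr, hεmem₂⟩, hy⟩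
      refine ((norm_fst_le (_ - _ : (ℝ × ℝ) × (ℝ × ℝ))).trans h1).trans ?_
      gcongr
      simp only [Prod.mk_sub_mk (θ : ℝ), Prod.mk_sub_mk (r, ε), sub_self]
      simp
    · intro p hp1 hp2
      have := abs_le.1 hp2
      obtain ⟨q0, qs, qm, -, -, -, qi, -⟩ := hX p ⟨hrbox _ hp1, by linarith [this.1],
        by linarith [this.2]⟩ ε hεmem
      have hsub' : Icc (-M) M ⊆ Icc (-M') M' := Icc_subset_Icc (by linarith) hMM'
      exact ⟨q0, qs, fun θ hθ => ⟨hsub' (qm θ hθ).1, hsub' (qm θ hθ).2⟩, qi⟩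
    · intro n p hn hp hrec hpn
      exact huniq ε hε0 hεb ps (hpsB.trans hBδ.le) hS hN n p hn
        (fun k => max_le ((hp k).1.trans hεd.le) (hp k).2) hrec hpn
  · refine (htime _ m2).trans ?_
    gcongr
    have : 0 ≤ K' * (B + M + C) := by positivity
    linarith
  · intro t ht
    obtain ⟨θ, hθ, htθ, hφt⟩ := hval t ht
    have h1 := norm_toCart_sub_baseOrbit_le f ps.1 ε θ (X ps ε θ).1
    have h2 : |t - θ| ≤ C * |ε| := htθ ▸ htime θ hθ
    have h3 := abs_le.1 (h2.trans (show C * |ε| ≤ C * e by gcongr))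
    have hCe : 0 ≤ C * e := by positivity
    -- The base orbit is compared at time t, not at the angle θ; t differs from θ by at most C|ε|,
    -- which the Lipschitz bound in both arguments absorbs.
    have h4 := hl' (ps.1 + ε * (X ps ε θ).1.1, θ)
      ⟨hrad θ hθ, by linarith [hθ.1], by linarith [hθ.2]⟩ (rs, t)
      ⟨⟨by linarith, by linarith⟩, by linarith [hθ.1, h3.1], by linarith [hθ.2, h3.2]⟩
    have h5 : ‖((ps.1 + ε * (X ps ε θ).1.1, θ) : ℝ × ℝ) - (rs, t)‖ ≤ (B + M + C) * |ε| := by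
      have hBM : 0 ≤ (B + M) * |ε| := by positivity
      have hCε : 0 ≤ C * |ε| := by positivity
      refine max_le ((hρM θ hθ).trans (by linarith)) ?_
      rw [abs_sub_comm] at h2
      exact h2.trans (by linarith)
    rw [hφt]
    calc ‖toCart f ps.1 ε θ (X ps ε θ).1 - baseOrbit f rs t‖
        ≤ ‖toCart f ps.1 ε θ (X ps ε θ).1 - baseOrbit f (ps.1 + ε * (X ps ε θ).1.1) θ‖
          + ‖baseOrbit f (ps.1 + ε * (X ps ε θ).1.1) θ - baseOrbit f rs t‖ :=
          norm_sub_le_norm_sub_add_norm_sub _ _ _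
      _ ≤ |ε| * M + K' * ((B + M + C) * |ε|) := by
          refine add_le_add (h1.trans ?_) (h4.trans ?_)
          · gcongr
            exact hVM θ hθ
          · gcongr
      _ ≤ _ := by nlinarith [mul_pos hC hεpos]

end PiecewiseField

theorem mainTheorem4 (c : PiecewiseField.Coeffs) (f g : ℝ × ℝ → ℝ)
    (hf : Differentiable ℝ f) (hg : ContDiff ℝ 3 g)
    (hfg : ∀ x y : ℝ, g (x, y) =
      f (x, y) + x * fderiv ℝ f (x, y) (0, 1) - y * fderiv ℝ f (x, y) (1, 0))
    (hf₁ : ∀ r : ℝ, 0 < r → PiecewiseField.f₁ c f r = 0)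
    (rs : ℝ) (hrs : 0 < rs)
    (hzero : PiecewiseField.f₂ c f g rs = 0)
    (hsimple : deriv (PiecewiseField.f₂ c f g) rs ≠ 0) :
    ∃ C > (0 : ℝ), ∃ ε₀ > (0 : ℝ), ∀ ε : ℝ, ε ≠ 0 → |ε| < ε₀ →
      ∃ (φ : ℝ → ℝ × ℝ × ℝ) (T : ℝ),
        PiecewiseField.IsCrossingLimitCycle
          (PiecewiseField.Xplus c g ε) (PiecewiseField.Xminus c g ε) φ T ∧
        |T - 2 * Real.pi| ≤ C * |ε| ∧
        ∀ t ∈ Set.Icc (0 : ℝ) T, ‖φ t - PiecewiseField.baseOrbit f rs t‖ ≤ C * |ε| := by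
  have hf3 := PiecewiseField.contDiff_of_isRotationPrimitive hf hg hfg
  -- `deriv` is 0 where there is no derivative, so the simplicity of the zero already contains the
  -- differentiability of f₂ at r*.
  exact PiecewiseField.exists_crossingLimitCycle hf3 hg hfg hf₁ hrs hzero hsimple
    (differentiableAt_of_deriv_ne_zero hsimple).hasDerivAt
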